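/- **Conventions.** Let $V$ denote a variable finite dimensional $\mathbb{F}_2$-vector space (for instance $V=A/2$, where $A$ is a finitely generated free abelian group). All functors of $V$ below are strict polynomial functors over $\mathbb{F}_2$, that is, for every commutative $\mathbb{F}_2$-algebra $S$, every $S$-linear map $S\otimes V\to S\otimes W$ acts $S$-linearly $S\otimes F(V)\to S\otimes F(W)$, functorially and compatibly with extension of scalars. Morphisms, isomorphisms, kernels, images and cokernels are those of strict polynomial functors. Write $V^{(r)}$ for the $r$-th Frobenius twist of $V$, $\Lambda^d(V)$ for the exterior power, and $\Gamma(V)=\bigoplus_{n\ge 0}\Gamma^n(V)$ for the divided power algebra over $\mathbb{F}_2$, with the comultiplication $\gamma_n(v)\mapsto\sum_{i+j=n}\gamma_i(v)\otimes\gamma_j(v)$. The Verschiebung is the morphism $\Gamma^2(V)\twoheadrightarrow V^{(1)}$ with $\gamma_2(v)\mapsto v$, which vanishes on products of two elements of $\Gamma^1(V)$. Let $$L(V)=\bigotimes_{r\ge 0}\Gamma(V^{(r)})=\Gamma\Big(\bigoplus_{r\ge 0}V^{(r)}\Big),$$ with the weight and the degree for which $\gamma_n(v)$, $v\in V^{(r)}$,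 has weight $n2^r$ and degree $n$, and let $L^d_i(V)$ be its component of weight $d\geq 0$ and degree $i\in\mathbb{Z}$. The skew Koszul differential $\partial: L^d_i\to L^d_{i-1}$ is the derivation with $\partial\gamma_n(v)=\gamma_{n-2}(v)\,\gamma_1(v^{(+1)})$ for $v\in V^{(r)}$ and $n\ge2$, and $\partial\gamma_n(v)=0$ for $n\le 1$, where $v^{(+1)}$ is $v$ seen in $V^{(r+1)}$; in other words $\partial$ is the comultiplication, followed by the Verschiebung $\Gamma^2(V^{(r)})\to V^{(r+1)}$ and the multiplication. The skew Koszul kernel algebra $SK$ is the kernel of $\partial$, with components $SK^d_i=\ker(\partial:L^d_i\to L^d_{i-1})$. **Proposition.** Let $d\ge 0$. (0) $SK^d_d\simeq\Lambda^d(V)$, where $v_1\wedge\dots\wedge v_d$ corresponds to $\gamma_1(v_1)\cdots\gamma_1(v_d)\in\Gamma^d(V)=L^d_d$. (1) For $d\ge 1$, $SK^d_{d-1}\simeq\Phi^d$, where $\Phi^1=0$, where $\Phi^2=V^{(1)}$, embedded in $L^2_1$ by $w\mapsto\gamma_1(w)$, where $\Phi^3=V\otimes V^{(1)}$, embedded in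 $L^3_2$ by $v\otimes w\mapsto\gamma_1(v)\gamma_1(w)$, and where for $d\ge 4$ the following holds. There is exactly one nonzero morphism $f:\Gamma^d(V)\to\Gamma^{d-2}(V)\otimes V^{(1)}$, namely the one induced by the comultiplication and the Verschiebung; there is exactly one nonzero morphism $g:\Gamma^{d-2}(V)\otimes V^{(1)}\to\Gamma^{d-4}(V)\otimes\Gamma^2(V^{(1)})$, namely the one induced by the comultiplication $\Gamma^{d-2}(V)\to\Gamma^{d-4}(V)\otimes\Gamma^2(V)$, the Verschiebung, and the multiplication $V^{(1)}\otimes V^{(1)}\to\Gamma^2(V^{(1)})$. The inclusion of $SK^d_{d-1}$ into $L$ factors through the multiplication $\Gamma^{d-2}(V)\otimes V^{(1)}\to L(V)$, and by the resulting morphism $SK^d_{d-1}\to\Gamma^{d-2}(V)\otimes V^{(1)}$ the functor $\Phi^d=SK^d_{d-1}$ is (a) the kernel of $g$; (b) the image of $f$; (c) the cokernel, by the morphism $\Gamma^d(V)\to SK^d_{d-1}$ induced by $f$, of the canonical inclusion $\Lambda^d(V)\hookrightarrow\Gamma^d(V)$, $v_1\wedge\dots\wedge v_d\mapsto\gamma_1(v_1)\cdots\gamma_1(v_d)$.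 (2) For $i<d-1$, $SK^d_i\subseteq L^d_i$ is (a) the kernel of $\partial:L^d_i\to L^d_{i-1}$; (b) the image of $\partial:L^d_{i+1}\to L^d_i$; (c) the cokernel of $\partial:L^d_{i+2}\to L^d_{i+1}$, by the morphism $L^d_{i+1}\to SK^d_i$ induced by $\partial$. -/

import Mathlib

universe u

open scoped TensorProduct PowerSeries

noncomputable section

namespace SkewKoszul

section Exponential

variable {B : Type*} [CommRing B]

/-- A power series `∑ aₙ Xⁿ` is of exponential type if `a₀ = 1` and
`aₘ aₙ = (m+n choose m) aₘ₊ₙ`. -/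
def IsExp (e : B⟦X⟧) : Prop :=
  PowerSeries.coeff 0 e = 1 ∧ ∀ m n, PowerSeries.coeff m e * PowerSeries.coeff n e =
    (m + n).choose m • PowerSeries.coeff (m + n) e

theorem IsExp.map {B' : Type*} [CommRing B'] {e : B⟦X⟧} (h : IsExp e) (f : B →+* B') :
    IsExp (PowerSeries.map f e) := by
  refine ⟨by simp only [PowerSeries.coeff_map, h.1, map_one], fun m n => ?_⟩
  simp only [PowerSeries.coeff_map, ← map_mul, h.2, map_nsmul]

theorem IsExp.rescale_add {e : B⟦X⟧} (h : IsExp e) (a b : B) :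
    PowerSeries.rescale (a + b) e = PowerSeries.rescale a e * PowerSeries.rescale b e := by
  ext n
  rw [PowerSeries.coeff_rescale, PowerSeries.coeff_mul, (Commute.all a b).add_pow', Finset.sum_mul]
  refine Finset.sum_congr rfl fun p hp => ?_
  rw [PowerSeries.coeff_rescale, PowerSeries.coeff_rescale, mul_mul_mul_comm, h.2,
    Finset.HasAntidiagonal.mem_antidiagonal.mp hp]
  simp only [nsmul_eq_mul]
  ring

theorem isExp_of_rescale {e : B⟦X⟧} (h0 : PowerSeries.coeff 0 e = 1)
    (h : PowerSeries.rescale (1 + Polynomial.X) (PowerSeries.map Polynomial.C e) =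
      PowerSeries.rescale 1 (PowerSeries.map Polynomial.C e) *
        PowerSeries.rescale Polynomial.X (PowerSeries.map Polynomial.C e)) : IsExp e := by
  refine ⟨h0, fun m n => ?_⟩
  have h1 := congrArg (fun f => Polynomial.coeff (PowerSeries.coeff (m + n) f) n) h
  simp only [PowerSeries.coeff_rescale, PowerSeries.coeff_mul, PowerSeries.coeff_map, one_pow,
    one_mul, Polynomial.finsetSum_coeff, Polynomial.coeff_mul_C, Polynomial.coeff_C_mul,
    Polynomial.coeff_X_pow, Polynomial.coeff_one_add_X_pow] at h1
  rw [Finset.sum_eq_single (m, n)] at h1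
  · simp only [if_true, one_mul] at h1
    rw [← h1, nsmul_eq_mul, Nat.choose_symm_add]
  · rintro ⟨i, j⟩ hij hne
    rw [Finset.HasAntidiagonal.mem_antidiagonal] at hij
    rw [if_neg, zero_mul, mul_zero]
    rintro rfl
    exact hne (by simp only [Prod.mk.injEq, and_true]; simp at hij; omega)
  · intro hn
    exact absurd ((Finset.HasAntidiagonal.mem_antidiagonal (n := m + n) (a := (m, n))).mpr rfl) hn

theorem IsExp.mul {e f : B⟦X⟧} (he : IsExp e) (hf : IsExp f) : IsExp (e * f) := by
  refine isExp_of_rescale ?_ ?_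
  · have h1 := he.1
    have h2 := hf.1
    simp only [PowerSeries.coeff_zero_eq_constantCoeff] at h1 h2 ⊢
    rw [map_mul, h1, h2, one_mul]
  · rw [map_mul, map_mul, map_mul, map_mul, (he.map _).rescale_add, (hf.map _).rescale_add]
    ring

theorem IsExp.rescale {e : B⟦X⟧} (h : IsExp e) (a : B) : IsExp (PowerSeries.rescale a e) := by
  refine ⟨by rw [PowerSeries.coeff_rescale, h.1, pow_zero, one_mul], fun m n => ?_⟩
  rw [PowerSeries.coeff_rescale, PowerSeries.coeff_rescale, PowerSeries.coeff_rescale,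
    mul_mul_mul_comm, h.2, pow_add, mul_smul_comm]

theorem isExp_one : IsExp (1 : B⟦X⟧) := by
  refine isExp_of_rescale (by simp) (by simp)

end Exponential

section Gamma

/-- The divided power algebra `Γ(M)` of a `k`-module `M`: Mathlib's `DividedPowerAlgebra k M`
with its commutative ring and `k`-algebra structures. -/
def Gam (k : Type*) [CommRing k] (M : Type*) [AddCommGroup M] [Module k M] :=
  DividedPowerAlgebra k M

instance (k : Type*) [CommRing k] (M : Type*) [AddCommGroup M] [Module k M] :
    CommRing (Gam k M) := inferInstanceAs (CommRing (DividedPowerAlgebra k M))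

instance (k : Type*) [CommRing k] (M : Type*) [AddCommGroup M] [Module k M] :
    Algebra k (Gam k M) := inferInstanceAs (Algebra k (DividedPowerAlgebra k M))

variable {k : Type*} [CommRing k] {M : Type*} [AddCommGroup M] [Module k M]
variable {B : Type*} [CommRing B] [Algebra k B]

variable (k) in
/-- The divided power `γₙ(m)`. -/
def dp (n : ℕ) (m : M) : Gam k M := DividedPowerAlgebra.dp k n m

theorem dp_zero (m : M) : dp k 0 m = 1 := DividedPowerAlgebra.dp_zero

theorem dp_mul (i j : ℕ) (m : M) : dp k i m * dp k j m = (i + j).choose i • dp k (i + j) m :=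
  DividedPowerAlgebra.dp_mul

theorem dp_add (n : ℕ) (m m' : M) :
    dp k n (m + m') = ∑ p ∈ Finset.HasAntidiagonal.antidiagonal n, dp k p.1 m * dp k p.2 m' :=
  DividedPowerAlgebra.dp_add

theorem dp_smul (r : k) (n : ℕ) (m : M) : dp k n (r • m) = r ^ n • dp k n m :=
  DividedPowerAlgebra.dp_smul

theorem dp_null (n : ℕ) : dp k n (0 : M) = if n = 0 then 1 else 0 := DividedPowerAlgebra.dp_null

theorem Gam.algHom_ext {f g : Gam k M →ₐ[k] B} (h : ∀ n m, f (dp k n m) = g (dp k n m)) : f = g :=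
  DividedPowerAlgebra.algHom_ext (f := f) (g := g) h

theorem Gam.induction_on {P : Gam k M → Prop} (x : Gam k M) (C : ∀ a, P (algebraMap k _ a))
    (add : ∀ x y, P x → P y → P (x + y)) (dp : ∀ x n m, P x → P (x * dp k n m)) : P x :=
  DividedPowerAlgebra.induction_on x C add dp

/-- The algebra morphism out of `Γ(M)` that sends `γₙ(m)` to the `n`-th coefficient of `ε m`,
for a family of series of exponential type with `ε (m + m') = ε m * ε m'` and
`ε (r m)(X) = ε m (r X)`. -/
def liftExp (ε : M → B⟦X⟧) (he : ∀ m, IsExp (ε m)) (hadd : ∀ m m', ε (m + m') = ε m * ε m')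
    (hsmul : ∀ (r : k) m, ε (r • m) = PowerSeries.rescale (algebraMap k B r) (ε m)) :
    Gam k M →ₐ[k] B :=
  DividedPowerAlgebra.lift' (f := fun p => PowerSeries.coeff p.1 (ε p.2))
    (fun m => (he m).1)
    (fun n r m => by
      simp only [hsmul, PowerSeries.coeff_rescale, Algebra.smul_def, map_pow])
    (fun n p m => (he m).2 n p)
    (fun n u v => by simp only [hadd, PowerSeries.coeff_mul])

theorem liftExp_dp (ε : M → B⟦X⟧) (he : ∀ m, IsExp (ε m))
    (hadd : ∀ m m', ε (m + m') = ε m * ε m')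
    (hsmul : ∀ (r : k) m, ε (r • m) = PowerSeries.rescale (algebraMap k B r) (ε m))
    (n : ℕ) (m : M) :
    liftExp ε he hadd hsmul (dp k n m) = PowerSeries.coeff n (ε m) :=
  DividedPowerAlgebra.lift'_apply_dp _ _ _ _ n m

variable (k) in
/-- The series `∑ γₙ(m) Xⁿ`. -/
def dpSeries (m : M) : (Gam k M)⟦X⟧ :=
  PowerSeries.mk fun n => dp k n m

theorem isExp_dpSeries (m : M) : IsExp (dpSeries k m) :=
  ⟨by simp only [dpSeries, PowerSeries.coeff_mk, dp_zero],
    fun i j => by simp only [dpSeries, PowerSeries.coeff_mk, dp_mul]⟩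

theorem dpSeries_add (m m' : M) : dpSeries k (m + m') = dpSeries k m * dpSeries k m' := by
  ext n
  simp only [dpSeries, PowerSeries.coeff_mk, PowerSeries.coeff_mul, dp_add]

theorem dpSeries_smul (r : k) (m : M) :
    dpSeries k (r • m) = PowerSeries.rescale (algebraMap k _ r) (dpSeries k m) := by
  ext n
  simp only [dpSeries, PowerSeries.coeff_mk, PowerSeries.coeff_rescale,
    dp_smul, Algebra.smul_def, map_pow]

variable (S : Type*) [CommRing S] [Algebra k S]

/-- The series `∑ sⁿ ⊗ γₙ(m) Xⁿ` attached to `s ⊗ m`. -/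
def extSeriesAux (s : S) (m : M) : (S ⊗[k] Gam k M)⟦X⟧ :=
  PowerSeries.rescale (s ⊗ₜ 1)
    (PowerSeries.map (Algebra.TensorProduct.includeRight :
      Gam k M →ₐ[k] S ⊗[k] Gam k M).toRingHom (dpSeries k m))

variable {S} in
theorem coeff_extSeriesAux (s : S) (m : M) (n : ℕ) :
    PowerSeries.coeff n (extSeriesAux S s m) = (s ^ n) ⊗ₜ[k] dp k n m := by
  rw [extSeriesAux, PowerSeries.coeff_rescale, PowerSeries.coeff_map, dpSeries,
    PowerSeries.coeff_mk, Algebra.TensorProduct.tmul_pow, one_pow]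
  exact (Algebra.TensorProduct.tmul_mul_tmul _ _ _ _).trans (by rw [mul_one, one_mul])

theorem extSeriesAux_add_left (s s' : S) (m : M) :
    extSeriesAux (k := k) S (s + s') m = extSeriesAux S s m * extSeriesAux S s' m := by
  rw [extSeriesAux, TensorProduct.add_tmul (R := k)]
  exact ((isExp_dpSeries m).map _).rescale_add _ _

theorem extSeriesAux_add_right (s : S) (m m' : M) :
    extSeriesAux (k := k) S s (m + m') = extSeriesAux S s m * extSeriesAux S s m' := by
  simp only [extSeriesAux, dpSeries_add, map_mul]

theorem extSeriesAux_zero_left (m : M) : extSeriesAux (k := k) S 0 m = 1 := by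
  ext n
  rw [coeff_extSeriesAux, PowerSeries.coeff_one]
  split_ifs with h
  · rw [h, pow_zero, dp_zero]; rfl
  · rw [zero_pow h, TensorProduct.zero_tmul]

theorem extSeriesAux_zero_right (s : S) : extSeriesAux (k := k) S s (0 : M) = 1 := by
  ext n
  rw [coeff_extSeriesAux, PowerSeries.coeff_one, dp_null]
  split_ifs with h
  · rw [h, pow_zero]; rfl
  · rw [TensorProduct.tmul_zero]

variable (k M) in
/-- The extension of `m ↦ ∑ γₙ(m) Xⁿ` to a map from `S ⊗ M` to the power series over `S ⊗ Γ(M)`,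
turning sums into products. -/
def extSeriesHom : (S ⊗[k] M) →+ Additive ((S ⊗[k] Gam k M)⟦X⟧) :=
  TensorProduct.liftAddHom (R := k) (M := S) (N := M)
    { toFun := fun s =>
        { toFun := fun m => Additive.ofMul (extSeriesAux S s m)
          map_zero' := congrArg Additive.ofMul (extSeriesAux_zero_right S s)
          map_add' := fun m m' => congrArg Additive.ofMul (extSeriesAux_add_right S s m m') }
      map_zero' := AddMonoidHom.ext fun m =>
        congrArg Additive.ofMul (extSeriesAux_zero_left S m)
      map_add' := fun s s' => AddMonoidHom.ext fun m =>
        congrArg Additive.ofMul (extSeriesAux_add_left S s s' m) }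
    (fun r s m => congrArg Additive.ofMul (by
      ext n
      simp only [coeff_extSeriesAux, dp_smul, smul_pow,
        TensorProduct.smul_tmul]))

/-- The series `∑ γₙ(x) Xⁿ` of the divided powers of `x ∈ S ⊗ M` in `S ⊗ Γ(M)`:
`γₙ(∑ sᵢ ⊗ mᵢ) = ∑_{∑ nᵢ = n} ∏ sᵢ ^ nᵢ ⊗ ∏ γ_{nᵢ}(mᵢ)`. -/
def extSeries (x : S ⊗[k] M) : (S ⊗[k] Gam k M)⟦X⟧ :=
  Additive.toMul (extSeriesHom k M S x)

variable {S}

theorem extSeries_tmul (s : S) (m : M) : extSeries S (s ⊗ₜ[k] m) = extSeriesAux S s m := by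
  rfl

theorem extSeries_add (x y : S ⊗[k] M) : extSeries S (x + y) = extSeries S x * extSeries S y :=
  congrArg Additive.toMul (map_add (extSeriesHom k M S) x y)

theorem extSeries_zero : extSeries S (0 : S ⊗[k] M) = 1 :=
  congrArg Additive.toMul (map_zero (extSeriesHom k M S))

theorem isExp_extSeries (x : S ⊗[k] M) : IsExp (extSeries S x) := by
  induction x using TensorProduct.induction_on with
  | zero => rw [extSeries_zero]; exact isExp_one
  | tmul s m => exact ((isExp_dpSeries m).map _).rescale _
  | add x y hx hy => rw [extSeries_add]; exact hx.mul hy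

theorem extSeries_smul (s : S) (x : S ⊗[k] M) :
    extSeries S (s • x) = PowerSeries.rescale (s ⊗ₜ 1) (extSeries S x) := by
  induction x using TensorProduct.induction_on with
  | zero => rw [smul_zero, extSeries_zero, map_one]
  | tmul t m =>
    ext n
    rw [TensorProduct.smul_tmul', extSeries_tmul, extSeries_tmul, PowerSeries.coeff_rescale,
      coeff_extSeriesAux, coeff_extSeriesAux, Algebra.TensorProduct.tmul_pow, one_pow,
      Algebra.TensorProduct.tmul_mul_tmul, one_mul, smul_eq_mul, mul_pow]
  | add x y hx hy => rw [smul_add, extSeries_add, extSeries_add, map_mul, hx, hy]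

variable {N : Type*} [AddCommGroup N] [Module k N] {P : Type*} [AddCommGroup P] [Module k P]

/-- The action of an `S`-linear map `φ : S ⊗ M → S ⊗ N` on divided power algebras:
the morphism of `S`-algebras `S ⊗ Γ(M) → S ⊗ Γ(N)` with `1 ⊗ γₙ(m) ↦ γₙ(φ(1 ⊗ m))`. -/
def gammaMap (φ : S ⊗[k] M →ₗ[S] S ⊗[k] N) :
    S ⊗[k] Gam k M →ₐ[S] S ⊗[k] Gam k N :=
  Algebra.TensorProduct.lift (Algebra.ofId S _)
    (liftExp (k := k) (fun m => extSeries S (φ (1 ⊗ₜ m))) (fun m => isExp_extSeries _)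
      (fun m m' => by rw [TensorProduct.tmul_add, map_add, extSeries_add])
      (fun r m => by
        rw [← TensorProduct.smul_tmul, ← mul_one (r • (1 : S)), ← smul_eq_mul,
          ← TensorProduct.smul_tmul', map_smul, extSeries_smul,
          ← Algebra.algebraMap_eq_smul_one]
        rfl))
    (fun _ _ => Commute.all _ _)

theorem gammaMap_tmul_dp (φ : S ⊗[k] M →ₗ[S] S ⊗[k] N) (n : ℕ) (m : M) :
    gammaMap φ (1 ⊗ₜ dp k n m) =
      PowerSeries.coeff n (extSeries S (φ (1 ⊗ₜ m))) := by
  rw [gammaMap, Algebra.TensorProduct.lift_tmul, map_one, one_mul, liftExp_dp]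

theorem map_gammaMap_extSeries (φ : S ⊗[k] M →ₗ[S] S ⊗[k] N) (x : S ⊗[k] M) :
    PowerSeries.map (gammaMap φ).toRingHom (extSeries S x) = extSeries S (φ x) := by
  induction x using TensorProduct.induction_on with
  | zero => rw [map_zero, extSeries_zero, extSeries_zero, map_one]
  | tmul s m =>
    have hs : s ⊗ₜ[k] m = s • ((1 : S) ⊗ₜ[k] m) := by
      rw [TensorProduct.smul_tmul', smul_eq_mul, mul_one]
    rw [hs, map_smul, extSeries_smul, extSeries_smul]
    ext n
    rw [PowerSeries.coeff_map, PowerSeries.coeff_rescale, PowerSeries.coeff_rescale, map_mul,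
      map_pow, extSeries_tmul, coeff_extSeriesAux, one_pow]
    congr 1
    · congr 1
      change gammaMap φ (s ⊗ₜ 1) = _
      exact (gammaMap φ).commutes s
    · exact gammaMap_tmul_dp φ n m
  | add x y hx hy => rw [map_add, extSeries_add, extSeries_add, map_mul, hx, hy]

/-- Two morphisms of `S`-algebras out of `S ⊗ Γ(M)` agree if they agree on the `1 ⊗ γₙ(m)`. -/
theorem baseChange_gamma_ext {B : Type*} [CommRing B] [Algebra S B] [Algebra k B]
    [IsScalarTower k S B]
    {f g : S ⊗[k] Gam k M →ₐ[S] B}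
    (h : ∀ n m, f (1 ⊗ₜ dp k n m) = g (1 ⊗ₜ dp k n m)) :
    f = g := by
  refine Algebra.TensorProduct.ext (by ext) ?_
  exact Gam.algHom_ext h

theorem gammaMap_id : gammaMap (LinearMap.id : S ⊗[k] M →ₗ[S] S ⊗[k] M) = AlgHom.id S _ := by
  refine baseChange_gamma_ext fun n m => ?_
  rw [gammaMap_tmul_dp, LinearMap.id_apply, extSeries_tmul, coeff_extSeriesAux, one_pow]
  rfl

theorem gammaMap_comp (ψ : S ⊗[k] N →ₗ[S] S ⊗[k] P) (φ : S ⊗[k] M →ₗ[S] S ⊗[k] N) :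
    gammaMap (ψ ∘ₗ φ) = (gammaMap ψ).comp (gammaMap φ) := by
  refine baseChange_gamma_ext fun n m => ?_
  rw [gammaMap_tmul_dp, AlgHom.comp_apply, gammaMap_tmul_dp, LinearMap.comp_apply,
    ← map_gammaMap_extSeries, PowerSeries.coeff_map]
  rfl

variable {T : Type*} [CommRing T] [Algebra k T]

theorem map_extSeries (σ : S →ₐ[k] T) (x : S ⊗[k] M) :
    PowerSeries.map (Algebra.TensorProduct.map σ
      (AlgHom.id k (Gam k M))).toRingHom (extSeries S x) =
      extSeries T (σ.toLinearMap.rTensor M x) := by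
  induction x using TensorProduct.induction_on with
  | zero => rw [map_zero, extSeries_zero, extSeries_zero, map_one]
  | tmul s m =>
    rw [LinearMap.rTensor_tmul, extSeries_tmul, extSeries_tmul]
    ext n
    rw [PowerSeries.coeff_map, coeff_extSeriesAux, coeff_extSeriesAux]
    exact (Algebra.TensorProduct.map_tmul _ _ _ _).trans (by rw [map_pow]; rfl)
  | add x y hx hy => rw [map_add, extSeries_add, extSeries_add, map_mul, hx, hy]

theorem gammaMap_baseChange (σ : S →ₐ[k] T) (φ : S ⊗[k] M →ₗ[S] S ⊗[k] N)
    (φ' : T ⊗[k] M →ₗ[T] T ⊗[k] N)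
    (h : ∀ x, φ' (σ.toLinearMap.rTensor M x) = σ.toLinearMap.rTensor N (φ x))
    (y : S ⊗[k] Gam k M) :
    gammaMap φ' (σ.toLinearMap.rTensor _ y) = σ.toLinearMap.rTensor _ (gammaMap φ y) := by
  have key : ((gammaMap φ').restrictScalars k).comp (Algebra.TensorProduct.map σ (AlgHom.id k _)) =
      (Algebra.TensorProduct.map σ (AlgHom.id k _)).comp ((gammaMap φ).restrictScalars k) := by
    refine Algebra.TensorProduct.ext ?_ ?_
    · ext s
      change gammaMap φ' (σ s ⊗ₜ 1) = Algebra.TensorProduct.map σ (AlgHom.id k _)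
        (gammaMap φ (s ⊗ₜ 1))
      have h1 : gammaMap φ (s ⊗ₜ 1) = s ⊗ₜ 1 := (gammaMap φ).commutes s
      have h2 : gammaMap φ' (σ s ⊗ₜ 1) = σ s ⊗ₜ 1 := (gammaMap φ').commutes (σ s)
      rw [h1, h2, Algebra.TensorProduct.map_tmul, map_one]
    · refine Gam.algHom_ext fun n m => ?_
      change gammaMap φ' (σ 1 ⊗ₜ dp k n m) = Algebra.TensorProduct.map σ (AlgHom.id k _)
        (gammaMap φ (1 ⊗ₜ dp k n m))
      have h3 : φ' (1 ⊗ₜ m) = σ.toLinearMap.rTensor N (φ (1 ⊗ₜ m)) := by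
        rw [← h, LinearMap.rTensor_tmul, AlgHom.toLinearMap_apply, map_one]
      rw [map_one, gammaMap_tmul_dp, gammaMap_tmul_dp, h3, ← map_extSeries,
        PowerSeries.coeff_map]
      rfl
  exact DFunLike.congr_fun key y

end Gamma

section GammaStructure

variable {k : Type*} [CommRing k] {M : Type*} [AddCommGroup M] [Module k M]

/-- The comultiplication `Γ(M) → Γ(M) ⊗ Γ(M)`, `γₙ(m) ↦ ∑_{i+j=n} γᵢ(m) ⊗ γⱼ(m)`. -/
def comul : Gam k M →ₐ[k] Gam k M ⊗[k] Gam k M :=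
  liftExp
    (fun m =>
      PowerSeries.map (Algebra.TensorProduct.includeLeft :
        Gam k M →ₐ[k] Gam k M ⊗[k] Gam k M).toRingHom (dpSeries k m) *
      PowerSeries.map (Algebra.TensorProduct.includeRight :
        Gam k M →ₐ[k] Gam k M ⊗[k] Gam k M).toRingHom (dpSeries k m))
    (fun m => ((isExp_dpSeries m).map _).mul ((isExp_dpSeries m).map _))
    (fun m m' => by simp only [dpSeries_add, map_mul]; ring)
    (fun r m => by
      rw [map_mul]
      congr 1 <;> ext n <;>
      · simp only [PowerSeries.coeff_map, PowerSeries.coeff_rescale, dpSeries_smul, map_mul,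
          map_pow]
        congr 2 <;> exact AlgHom.commutes _ r)

theorem comul_dp (n : ℕ) (m : M) : comul (dp k n m) =
    ∑ p ∈ Finset.HasAntidiagonal.antidiagonal n, dp k p.1 m ⊗ₜ[k] dp k p.2 m := by
  rw [comul, liftExp_dp, PowerSeries.coeff_mul]
  refine Finset.sum_congr rfl fun p _ => ?_
  rw [PowerSeries.coeff_map, PowerSeries.coeff_map, dpSeries, PowerSeries.coeff_mk,
    PowerSeries.coeff_mk]
  exact (Algebra.TensorProduct.tmul_mul_tmul _ _ _ _).trans (by rw [mul_one, one_mul])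

/-- The counit `Γ(M) → k`, which kills all `γₙ(m)` with `n > 0`. -/
def counit : Gam k M →ₐ[k] k :=
  liftExp (fun _ => 1) (fun _ => isExp_one) (fun _ _ => (one_mul 1).symm)
    (fun _ _ => (map_one _).symm)

theorem counit_dp (n : ℕ) (m : M) : counit (dp k n m) = if n = 0 then 1 else 0 := by
  rw [counit, liftExp_dp, PowerSeries.coeff_one]

variable (k M) in
/-- The canonical map `M = Γ¹(M) → Γ(M)`, `m ↦ γ₁(m)`. -/
def emb : M →ₗ[k] Gam k M := DividedPowerAlgebra.embed k M

theorem emb_apply (m : M) : emb k M m = dp k 1 m := rfl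

variable (k M) in
/-- The morphism of algebras `Γ(M) → Γ(M)[X]`, `γₙ(m) ↦ γₙ(m) Xⁿ`, that records degrees. -/
def degHom : Gam k M →ₐ[k] Polynomial (Gam k M) :=
  liftExp (fun m => PowerSeries.rescale Polynomial.X (PowerSeries.map Polynomial.C (dpSeries k m)))
    (fun m => ((isExp_dpSeries m).map _).rescale _)
    (fun m m' => by simp only [dpSeries_add, map_mul])
    (fun r m => by
      ext1 n
      simp only [PowerSeries.coeff_map, PowerSeries.coeff_rescale, dpSeries_smul, map_mul,
          map_pow, ← mul_assoc, Polynomial.algebraMap_apply]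
      ring)

theorem degHom_dp (n : ℕ) (m : M) : degHom k M (dp k n m) = Polynomial.monomial n (dp k n m) := by
  rw [degHom, liftExp_dp, PowerSeries.coeff_rescale, PowerSeries.coeff_map, dpSeries,
    PowerSeries.coeff_mk, mul_comm, Polynomial.C_mul_X_pow_eq_monomial]

/-- Let `j i : V → M` be a family of maps, with `w i` the degree given to the image of `j i`.
This is the component of degree `a` of `Γ(M)`: the span of all products
`∏ γ_{n_t}(j i_t v_t)` with `∑ n_t • w i_t = a`. -/
def gradedPiece {ι V A : Type*} [AddCommMonoid A] (w : ι → A) (j : ι → V → M) (a : A) :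
    Submodule k (Gam k M) :=
  Submodule.span k {x | ∃ l : List (ι × ℕ × V),
    (l.map fun p => p.2.1 • w p.1).sum = a ∧ (l.map fun p => dp k p.2.1 (j p.1 p.2.2)).prod = x}

section Pieces

variable {ι V A : Type*} [AddCommMonoid A] {w : ι → A} {j : ι → V → M}

theorem dp_mem_gradedPiece (i : ι) (n : ℕ) (v : V) :
    dp k n (j i v) ∈ gradedPiece (k := k) w j (n • w i) :=
  Submodule.subset_span ⟨[(i, n, v)], by simp, by simp⟩

theorem one_mem_gradedPiece : (1 : Gam k M) ∈ gradedPiece (k := k) w j 0 :=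
  Submodule.subset_span ⟨[], by simp, by simp⟩

theorem mul_mem_gradedPiece {a b : A} {x y : Gam k M} (hx : x ∈ gradedPiece (k := k) w j a)
    (hy : y ∈ gradedPiece (k := k) w j b) : x * y ∈ gradedPiece (k := k) w j (a + b) := by
  have h := Submodule.mul_mem_mul hx hy
  rw [gradedPiece, gradedPiece, Submodule.span_mul_span] at h
  refine Submodule.span_mono ?_ h
  rintro _ ⟨_, ⟨l, rfl, rfl⟩, _, ⟨l', rfl, rfl⟩, rfl⟩
  exact ⟨l ++ l', by simp, by simp⟩

theorem mul_mem_baseChange_gradedPiece {S : Type*} [CommRing S] [Algebra k S] {a b : A}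
    {x y : S ⊗[k] Gam k M} (hx : x ∈ (gradedPiece (k := k) w j a).baseChange S)
    (hy : y ∈ (gradedPiece (k := k) w j b).baseChange S) :
    x * y ∈ (gradedPiece (k := k) w j (a + b)).baseChange S := by
  obtain ⟨x, rfl⟩ := hx
  obtain ⟨y, rfl⟩ := hy
  induction x using TensorProduct.induction_on with
  | zero => rw [map_zero, zero_mul]; exact zero_mem _
  | add x x' hx hx' => rw [map_add, add_mul]; exact add_mem hx hx'
  | tmul s x =>
    induction y using TensorProduct.induction_on with
    | zero => rw [map_zero, mul_zero]; exact zero_mem _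
    | add y y' hy hy' => rw [map_add, mul_add]; exact add_mem hy hy'
    | tmul t y =>
      rw [LinearMap.baseChange_tmul, LinearMap.baseChange_tmul,
        Algebra.TensorProduct.tmul_mul_tmul]
      exact Submodule.tmul_mem_baseChange_of_mem _ (mul_mem_gradedPiece x.2 y.2)

/-- An algebra morphism out of `S ⊗ Γ(M)` respects pieces as soon as it does so on generators. -/
theorem gradedPiece_stable {S : Type*} [CommRing S] [Algebra k S]
    {N : Type*} [AddCommGroup N] [Module k N] {V' : Type*} {j' : ι → V' → N}
    (f : S ⊗[k] Gam k M →ₐ[S] S ⊗[k] Gam k N)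
    (hf : ∀ i n v, f (1 ⊗ₜ dp k n (j i v)) ∈
      (gradedPiece (k := k) w j' (n • w i)).baseChange S)
    {a : A} {x : Gam k M} (hx : x ∈ gradedPiece (k := k) w j a) :
    f (1 ⊗ₜ x) ∈ (gradedPiece (k := k) w j' a).baseChange S := by
  induction hx using Submodule.span_induction with
  | zero => rw [TensorProduct.tmul_zero, map_zero]; exact zero_mem _
  | add x y _ _ hx hy => rw [TensorProduct.tmul_add, map_add]; exact add_mem hx hy
  | smul r x _ hx =>
    rw [TensorProduct.tmul_smul, ← algebraMap_smul S r, map_smul]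
    exact Submodule.smul_mem _ _ hx
  | mem x hx =>
    obtain ⟨l, rfl, rfl⟩ := hx
    induction l with
    | nil =>
      simp only [List.map_nil, List.sum_nil, List.prod_nil]
      rw [← Algebra.TensorProduct.one_def, map_one]
      exact Submodule.tmul_mem_baseChange_of_mem _ one_mem_gradedPiece
    | cons p l ih =>
      simp only [List.map_cons, List.sum_cons, List.prod_cons]
      have : (1 : S) ⊗ₜ[k] (dp k p.2.1 (j p.1 p.2.2) *
          (List.map (fun p => dp k p.2.1 (j p.1 p.2.2)) l).prod) =
          (1 ⊗ₜ dp k p.2.1 (j p.1 p.2.2)) *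
            (1 ⊗ₜ (List.map (fun p => dp k p.2.1 (j p.1 p.2.2)) l).prod) := by
        rw [Algebra.TensorProduct.tmul_mul_tmul, one_mul]
      rw [this, map_mul]
      exact mul_mem_baseChange_gradedPiece (hf _ _ _) ih

/-- The divided powers of an element that comes from `S ⊗ V` lie in the expected piece. -/
theorem extSeries_mem_gradedPiece {S : Type*} [CommRing S] [Algebra k S]
    {V : Type*} [AddCommGroup V] [Module k V] (g : ι → V →ₗ[k] M) (i : ι) (n : ℕ)
    (y : S ⊗[k] V) : PowerSeries.coeff n (extSeries S ((g i).baseChange S y)) ∈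
      (gradedPiece (k := k) w (fun i => g i) (n • w i)).baseChange S := by
  induction y using TensorProduct.induction_on generalizing n with
  | zero =>
    rw [map_zero, extSeries_zero, PowerSeries.coeff_one]
    split_ifs with h
    · rw [h, zero_smul]
      exact Submodule.tmul_mem_baseChange_of_mem _ one_mem_gradedPiece
    · exact zero_mem _
  | tmul s v =>
    rw [LinearMap.baseChange_tmul, extSeries_tmul, coeff_extSeriesAux]
    exact Submodule.tmul_mem_baseChange_of_mem _
      (dp_mem_gradedPiece (j := fun i => g i) i n v)
  | add x y hx hy =>
    rw [map_add, extSeries_add, PowerSeries.coeff_mul]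
    refine sum_mem fun p hp => ?_
    rw [← Finset.HasAntidiagonal.mem_antidiagonal.mp hp, add_smul]
    exact mul_mem_baseChange_gradedPiece (hx _) (hy _)

end Pieces

variable (k M) in
/-- The homogeneous component `Γⁿ(M)` of the divided power algebra: the span of all products
`γ_{n₁}(m₁) ⋯ γ_{nₛ}(mₛ)` with `n₁ + ⋯ + nₛ = n`. -/
def gamPiece (n : ℕ) : Submodule k (Gam k M) :=
  gradedPiece (fun _ : Unit => 1) (fun _ m => m) n

theorem coeff_degHom_mem (n : ℕ) (x : Gam k M) : (degHom k M x).coeff n ∈ gamPiece k M n := by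
  induction x using Gam.induction_on generalizing n with
  | C a =>
    rw [AlgHom.commutes, Polynomial.algebraMap_apply, Polynomial.coeff_C]
    split_ifs with h
    · rw [h, Algebra.algebraMap_eq_smul_one]
      exact Submodule.smul_mem _ _ one_mem_gradedPiece
    · exact zero_mem _
  | add x y hx hy => rw [map_add, Polynomial.coeff_add]; exact add_mem (hx n) (hy n)
  | dp x i m hx =>
    rw [map_mul, degHom_dp]
    by_cases h : i ≤ n
    · obtain ⟨a, rfl⟩ := Nat.exists_eq_add_of_le' h
      rw [Polynomial.coeff_mul_monomial]
      have := dp_mem_gradedPiece (k := k) (w := fun _ : Unit => 1) (j := fun _ (m : M) => m) () i m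
      rw [smul_eq_mul, mul_one] at this
      exact mul_mem_gradedPiece (hx a) this
    · rw [Polynomial.coeff_mul, Finset.sum_eq_zero]
      · exact zero_mem _
      · intro p hp
        have := Finset.HasAntidiagonal.mem_antidiagonal.mp hp
        rw [Polynomial.coeff_monomial, if_neg (by omega), mul_zero]

variable (k M) in
/-- The projection of `Γ(M)` onto `Γⁿ(M)`. -/
def gamProj (n : ℕ) : Gam k M →ₗ[k] gamPiece k M n :=
  (((Polynomial.lcoeff (Gam k M) n).restrictScalars k) ∘ₗ (degHom k M).toLinearMap).codRestrict _
    (coeff_degHom_mem n)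

theorem coe_gamProj (n : ℕ) (x : Gam k M) :
    (gamProj k M n x : Gam k M) = (degHom k M x).coeff n := rfl

end GammaStructure

section Verschiebung

variable {M : Type*} [AddCommGroup M] [Module (ZMod 2) M]

/-- The right action of the commutative ring `ZMod 2` on a module. -/
abbrev opModule : Module (ZMod 2)ᵐᵒᵖ M :=
  Module.compHom M ((RingHom.id (ZMod 2)).fromOpposite fun x y => mul_comm x y)

attribute [local instance] opModule

theorem opModule_central : IsCentralScalar (ZMod 2) M := ⟨fun _ _ => rfl⟩

attribute [local instance] opModule_central

/-- The algebra morphism `Γ(M) → 𝔽₂ ⊕ M` (with `M` of square zero) that sends `γ₂(m)` to `m` and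
the other `γₙ(m)` with `n > 0` to zero. -/
def verschAux : Gam (ZMod 2) M →ₐ[ZMod 2] TrivSqZeroExt (ZMod 2) M :=
  DividedPowerAlgebra.lift'
    (f := fun p => if p.1 = 0 then 1 else if p.1 = 2 then TrivSqZeroExt.inr p.2 else 0)
    (fun m => by simp)
    (fun n r m => by
      by_cases h0 : n = 0
      · simp [h0]
      by_cases h2 : n = 2
      · have : r ^ 2 = r := ZMod.pow_card r
        simp [h2, this]
      · simp [h0, h2])
    (fun n p m => by
      by_cases hn : n = 0
      · simp [hn]
      by_cases hp : p = 0
      · simp [hp]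
      have h0 : n + p ≠ 0 := by omega
      by_cases h2 : n + p = 2
      · have h1 : n = 1 := by omega
        have h1' : p = 1 := by omega
        subst h1 h1'
        have : (2 : ℕ) • (TrivSqZeroExt.inr m : TrivSqZeroExt (ZMod 2) M) = 0 := by
          rw [← Nat.cast_smul_eq_nsmul (ZMod 2)]
          have : ((2 : ℕ) : ZMod 2) = 0 := rfl
          rw [this, zero_smul]
        simpa using this.symm
      · simp only [hn, hp, h0, h2, if_false, smul_zero]
        split_ifs <;> simp)
    (fun n u v => by
      rcases n with _ | _ | _ | n
      · simp
      · simp [Finset.Nat.antidiagonal_succ]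
      · simp [Finset.Nat.antidiagonal_succ, add_comm]
      · rw [Finset.sum_eq_zero]
        · simp
        · intro p hp
          have := Finset.HasAntidiagonal.mem_antidiagonal.mp hp
          rcases p with ⟨a, b⟩
          simp only at this ⊢
          split_ifs <;> first | omega | simp)

/-- The Verschiebung, extended by zero from `Γ²(M)` to `Γ(M)`: it sends `γ₂(m)` to `m`, and it
kills `Γⁿ(M)` for `n ≠ 2` and all products of elements of positive degree. -/
def versch : Gam (ZMod 2) M →ₗ[ZMod 2] M :=
  (TrivSqZeroExt.sndHom (ZMod 2) M) ∘ₗ verschAux.toLinearMap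

theorem verschAux_dp (n : ℕ) (m : M) : verschAux (dp (ZMod 2) n m) =
    if n = 0 then 1 else if n = 2 then TrivSqZeroExt.inr m else 0 :=
  DividedPowerAlgebra.lift'_apply_dp _ _ _ _ n m

theorem versch_dp (n : ℕ) (m : M) : versch (dp (ZMod 2) n m) = if n = 2 then m else 0 := by
  change (verschAux _).snd = _
  rw [verschAux_dp]
  split_ifs with h h'
  · omega
  · simp
  · simp
  · simp

theorem versch_algebraMap (r : ZMod 2) :
    versch (algebraMap (ZMod 2) (Gam (ZMod 2) M) r) = 0 := by
  change (verschAux _).snd = _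
  rw [AlgHom.commutes]
  rfl

theorem fst_verschAux (x : Gam (ZMod 2) M) : (verschAux x).fst = counit x := by
  have : (TrivSqZeroExt.fstHom (ZMod 2) (ZMod 2) M).comp verschAux = counit := by
    refine Gam.algHom_ext fun n m => ?_
    rw [AlgHom.comp_apply, verschAux_dp, counit_dp]
    split_ifs <;> simp
  exact DFunLike.congr_fun this x

theorem versch_mul (x y : Gam (ZMod 2) M) :
    versch (x * y) = counit x • versch y + counit y • versch x := by
  change (verschAux _).snd = counit x • (verschAux y).snd + counit y • (verschAux x).snd
  rw [map_mul, TrivSqZeroExt.snd_mul, fst_verschAux, fst_verschAux]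
  rfl

end Verschiebung

section Differential

variable {M : Type*} [AddCommGroup M] [Module (ZMod 2) M]

/-- For a linear endomorphism `σ` of `M`, the composite
`Γ(M) → Γ(M) ⊗ Γ(M) → Γ(M) ⊗ M → Γ(M)` of the comultiplication, the Verschiebung followed by `σ`,
and the multiplication. -/
def skewDiff (σ : M →ₗ[ZMod 2] M) : Gam (ZMod 2) M →ₗ[ZMod 2] Gam (ZMod 2) M :=
  LinearMap.mul' (ZMod 2) (Gam (ZMod 2) M) ∘ₗ
    (emb (ZMod 2) M ∘ₗ σ ∘ₗ versch).lTensor (Gam (ZMod 2) M) ∘ₗ comul.toLinearMap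

theorem skewDiff_dp (σ : M →ₗ[ZMod 2] M) (n : ℕ) (m : M) : skewDiff σ (dp (ZMod 2) n m) =
    if 2 ≤ n then dp (ZMod 2) (n - 2) m * dp (ZMod 2) 1 (σ m) else 0 := by
  simp only [skewDiff, LinearMap.comp_apply, AlgHom.toLinearMap_apply, comul_dp, map_sum,
    LinearMap.lTensor_tmul, LinearMap.mul'_apply, versch_dp]
  split_ifs with h
  · rw [Finset.sum_eq_single (n - 2, 2)]
    · simp [emb_apply]
    · rintro ⟨a, b⟩ hab hne
      have := Finset.HasAntidiagonal.mem_antidiagonal.mp hab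
      rw [if_neg, map_zero, map_zero, mul_zero]
      rintro rfl
      simp only at this hne
      exact hne (by rw [Prod.mk.injEq]; omega)
    · intro hn
      exact absurd (Finset.HasAntidiagonal.mem_antidiagonal.mpr (Nat.sub_add_cancel h)) hn
  · refine Finset.sum_eq_zero ?_
    rintro ⟨a, b⟩ hab
    have := Finset.HasAntidiagonal.mem_antidiagonal.mp hab
    simp only at this
    rw [if_neg (by omega), map_zero, map_zero, mul_zero]

theorem comul_counit (x : Gam (ZMod 2) M) :
    Algebra.TensorProduct.lift (AlgHom.id (ZMod 2) (Gam (ZMod 2) M))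
      ((Algebra.ofId (ZMod 2) (Gam (ZMod 2) M)).comp counit) (fun _ _ => Commute.all _ _)
      (comul x) = x := by
  have : (Algebra.TensorProduct.lift (AlgHom.id (ZMod 2) (Gam (ZMod 2) M))
      ((Algebra.ofId (ZMod 2) (Gam (ZMod 2) M)).comp counit)
      (fun _ _ => Commute.all _ _)).comp comul = AlgHom.id (ZMod 2) _ := by
    refine Gam.algHom_ext fun n m => ?_
    rw [AlgHom.comp_apply, comul_dp, map_sum, Finset.sum_eq_single (n, 0)]
    · simp [counit_dp]
    · rintro ⟨a, b⟩ hab hne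
      have := Finset.HasAntidiagonal.mem_antidiagonal.mp hab
      simp only at this
      have hb : b ≠ 0 := by
        rintro rfl
        exact hne (by rw [Prod.mk.injEq]; omega)
      simp [counit_dp, hb]
    · intro hn
      exact absurd (Finset.HasAntidiagonal.mem_antidiagonal.mpr (Nat.add_zero n)) hn
  exact DFunLike.congr_fun this x

/-- `skewDiff σ` is a derivation. -/
theorem skewDiff_mul (σ : M →ₗ[ZMod 2] M) (x y : Gam (ZMod 2) M) :
    skewDiff σ (x * y) = x * skewDiff σ y + skewDiff σ x * y := by
  let η := Algebra.TensorProduct.lift (AlgHom.id (ZMod 2) (Gam (ZMod 2) M))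
      ((Algebra.ofId (ZMod 2) (Gam (ZMod 2) M)).comp (counit (k := ZMod 2) (M := M)))
      (fun _ _ => Commute.all _ _)
  let θ : Gam (ZMod 2) M ⊗[ZMod 2] Gam (ZMod 2) M →ₗ[ZMod 2] Gam (ZMod 2) M :=
    LinearMap.mul' (ZMod 2) (Gam (ZMod 2) M) ∘ₗ
      (emb (ZMod 2) M ∘ₗ σ ∘ₗ versch).lTensor (Gam (ZMod 2) M)
  have key : ∀ u v, θ (u * v) = η u * θ v + θ u * η v := by
    intro u v
    induction u using TensorProduct.induction_on with
    | zero => simp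
    | add u u' hu hu' => simp only [add_mul, map_add, hu, hu']; ring
    | tmul a b =>
      induction v using TensorProduct.induction_on with
      | zero => simp
      | add v v' hv hv' => simp only [mul_add, map_add, hv, hv']; ring
      | tmul c d =>
        simp only [θ, η, Algebra.TensorProduct.tmul_mul_tmul, LinearMap.comp_apply,
          LinearMap.lTensor_tmul, LinearMap.mul'_apply, versch_mul, map_add, map_smul,
          Algebra.TensorProduct.lift_tmul, AlgHom.id_apply, AlgHom.comp_apply,
          Algebra.ofId_apply, Algebra.smul_def]
        ring
  have h : ∀ z, skewDiff σ z = θ (comul z) := fun _ => rfl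
  rw [h, h, h, map_mul, key]
  congr 2 <;> exact comul_counit _

theorem skewDiff_algebraMap (σ : M →ₗ[ZMod 2] M) (r : ZMod 2) :
    skewDiff σ (algebraMap (ZMod 2) _ r) = 0 := by
  have h : skewDiff σ (1 : Gam (ZMod 2) M) = 0 := by
    rw [← dp_zero (k := ZMod 2) (0 : M), skewDiff_dp, if_neg (by omega)]
  rw [Algebra.algebraMap_eq_smul_one, map_smul, h, smul_zero]

end Differential

section Exterior

variable {k : Type*} [CommRing k] {M N P : Type*} [AddCommGroup M] [Module k M]
  [AddCommGroup N] [Module k N] [AddCommGroup P] [Module k P]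
  {S : Type*} [CommRing S] [Algebra k S]

theorem baseChange_ι_anticomm (x y : S ⊗[k] N) :
    (ExteriorAlgebra.ι k).baseChange S x * (ExteriorAlgebra.ι k).baseChange S y +
      (ExteriorAlgebra.ι k).baseChange S y * (ExteriorAlgebra.ι k).baseChange S x = 0 := by
  induction x using TensorProduct.induction_on with
  | zero => simp
  | add x x' hx hx' =>
    rw [map_add, add_mul, mul_add, add_add_add_comm, hx, hx', add_zero]
  | tmul s m =>
    induction y using TensorProduct.induction_on with
    | zero => simp
    | add y y' hy hy' =>
      rw [map_add, add_mul, mul_add, add_add_add_comm, hy, hy', add_zero]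
    | tmul t n =>
      rw [LinearMap.baseChange_tmul, LinearMap.baseChange_tmul,
        Algebra.TensorProduct.tmul_mul_tmul, Algebra.TensorProduct.tmul_mul_tmul, mul_comm t s,
        ← TensorProduct.tmul_add, ExteriorAlgebra.ι_add_mul_swap, TensorProduct.tmul_zero]

theorem baseChange_ι_sq (x : S ⊗[k] N) :
    (ExteriorAlgebra.ι k).baseChange S x * (ExteriorAlgebra.ι k).baseChange S x = 0 := by
  induction x using TensorProduct.induction_on with
  | zero => simp
  | tmul s m => simp
  | add x y hx hy =>
    rw [map_add, add_mul, mul_add, mul_add, hx, hy, zero_add, add_zero,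
      baseChange_ι_anticomm]

/-- The restriction of an `S`-linear map `φ : S ⊗ M → S ⊗ N` to a map `M → S ⊗ N ⊆ S ⊗ Λ(N)`. -/
def extLin (φ : S ⊗[k] M →ₗ[S] S ⊗[k] N) : M →ₗ[k] S ⊗[k] ExteriorAlgebra k N :=
  ((ExteriorAlgebra.ι k).baseChange S).restrictScalars k ∘ₗ φ.restrictScalars k ∘ₗ
    TensorProduct.mk k S M 1

theorem extLin_sq (φ : S ⊗[k] M →ₗ[S] S ⊗[k] N) (m : M) : extLin φ m * extLin φ m = 0 :=
  baseChange_ι_sq _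

theorem extLin_commute (φ : S ⊗[k] M →ₗ[S] S ⊗[k] N) (s : S) (x : ExteriorAlgebra k M) :
    Commute (Algebra.ofId S (S ⊗[k] ExteriorAlgebra k N) s)
      (ExteriorAlgebra.lift k ⟨extLin φ, extLin_sq φ⟩ x) :=
  Algebra.commutes s _

/-- The action of an `S`-linear map `φ : S ⊗ M → S ⊗ N` on exterior algebras:
the morphism of `S`-algebras `S ⊗ Λ(M) → S ⊗ Λ(N)` that extends `φ`. -/
def extMap (φ : S ⊗[k] M →ₗ[S] S ⊗[k] N) :
    S ⊗[k] ExteriorAlgebra k M →ₐ[S] S ⊗[k] ExteriorAlgebra k N :=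
  Algebra.TensorProduct.lift (Algebra.ofId S _)
    (ExteriorAlgebra.lift k ⟨extLin φ, extLin_sq φ⟩)
    (extLin_commute φ)

theorem extMap_ι (φ : S ⊗[k] M →ₗ[S] S ⊗[k] N) (x : S ⊗[k] M) :
    extMap φ ((ExteriorAlgebra.ι k).baseChange S x) = (ExteriorAlgebra.ι k).baseChange S (φ x) := by
  induction x using TensorProduct.induction_on with
  | zero => simp
  | add x y hx hy => simp only [map_add, hx, hy]
  | tmul s m =>
    have hs : s ⊗ₜ[k] m = s • ((1 : S) ⊗ₜ[k] m) := by
      rw [TensorProduct.smul_tmul', smul_eq_mul, mul_one]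
    rw [hs, map_smul, map_smul, map_smul, map_smul]
    congr 1
    rw [LinearMap.baseChange_tmul, extMap, Algebra.TensorProduct.lift_tmul, map_one, one_mul,
      ExteriorAlgebra.lift_ι_apply]
    rfl

theorem extMap_ext {f g : S ⊗[k] ExteriorAlgebra k M →ₐ[S] S ⊗[k] ExteriorAlgebra k N}
    (h : ∀ m, f (1 ⊗ₜ ExteriorAlgebra.ι k m) = g (1 ⊗ₜ ExteriorAlgebra.ι k m)) : f = g := by
  refine Algebra.TensorProduct.ext (by ext) ?_
  refine ExteriorAlgebra.hom_ext (LinearMap.ext h)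

theorem extMap_id : extMap (LinearMap.id : S ⊗[k] M →ₗ[S] S ⊗[k] M) = AlgHom.id S _ := by
  refine extMap_ext fun m => ?_
  have := extMap_ι (k := k) (LinearMap.id : S ⊗[k] M →ₗ[S] S ⊗[k] M) (1 ⊗ₜ m)
  simpa using this

theorem extMap_comp (ψ : S ⊗[k] N →ₗ[S] S ⊗[k] P) (φ : S ⊗[k] M →ₗ[S] S ⊗[k] N) :
    extMap (ψ ∘ₗ φ) = (extMap ψ).comp (extMap φ) := by
  refine extMap_ext fun m => ?_
  have h1 := extMap_ι (ψ ∘ₗ φ) (1 ⊗ₜ m)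
  have h2 := extMap_ι φ (1 ⊗ₜ m)
  rw [LinearMap.baseChange_tmul] at h1 h2
  rw [h1, AlgHom.comp_apply, h2, extMap_ι, LinearMap.comp_apply]

variable {T : Type*} [CommRing T] [Algebra k T]

theorem rTensor_baseChange (σ : S →ₐ[k] T) (f : M →ₗ[k] N) (x : S ⊗[k] M) :
    σ.toLinearMap.rTensor N (f.baseChange S x) = f.baseChange T (σ.toLinearMap.rTensor M x) := by
  induction x using TensorProduct.induction_on with
  | zero => simp
  | add x y hx hy => simp only [map_add, hx, hy]
  | tmul s m => simp

theorem extMap_baseChange (σ : S →ₐ[k] T) (φ : S ⊗[k] M →ₗ[S] S ⊗[k] N)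
    (φ' : T ⊗[k] M →ₗ[T] T ⊗[k] N)
    (h : ∀ x, φ' (σ.toLinearMap.rTensor M x) = σ.toLinearMap.rTensor N (φ x))
    (y : S ⊗[k] ExteriorAlgebra k M) :
    extMap φ' (σ.toLinearMap.rTensor _ y) = σ.toLinearMap.rTensor _ (extMap φ y) := by
  have key : ((extMap φ').restrictScalars k).comp (Algebra.TensorProduct.map σ (AlgHom.id k _)) =
      (Algebra.TensorProduct.map σ (AlgHom.id k _)).comp ((extMap φ).restrictScalars k) := by
    refine Algebra.TensorProduct.ext ?_ ?_
    · ext s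
      change extMap φ' (σ s ⊗ₜ 1) = Algebra.TensorProduct.map σ (AlgHom.id k _)
        (extMap φ (s ⊗ₜ 1))
      have h1 : extMap φ (s ⊗ₜ 1) = s ⊗ₜ 1 := (extMap φ).commutes s
      have h2 : extMap φ' (σ s ⊗ₜ 1) = σ s ⊗ₜ 1 := (extMap φ').commutes (σ s)
      rw [h1, h2, Algebra.TensorProduct.map_tmul, map_one]
    · refine ExteriorAlgebra.hom_ext (LinearMap.ext fun m => ?_)
      change extMap φ' (σ 1 ⊗ₜ ExteriorAlgebra.ι k m) =
        σ.toLinearMap.rTensor _ (extMap φ (1 ⊗ₜ ExteriorAlgebra.ι k m))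
      have h1 := extMap_ι φ (1 ⊗ₜ m)
      have h2 := extMap_ι φ' (1 ⊗ₜ m)
      rw [LinearMap.baseChange_tmul] at h1 h2
      have h3 : φ' (1 ⊗ₜ m) = σ.toLinearMap.rTensor N (φ (1 ⊗ₜ m)) := by
        rw [← h, LinearMap.rTensor_tmul, AlgHom.toLinearMap_apply, map_one]
      rw [map_one, h1, h2, h3, rTensor_baseChange]
  exact DFunLike.congr_fun key y

/-- `extMap φ` respects the exterior powers. -/
theorem extMap_mem (φ : S ⊗[k] M →ₗ[S] S ⊗[k] N) (d : ℕ) {x : ExteriorAlgebra k M}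
    (hx : x ∈ ⋀[k]^d M) : extMap φ (1 ⊗ₜ x) ∈ (⋀[k]^d N).baseChange S := by
  induction hx using Submodule.pow_induction_on_left' with
  | algebraMap r =>
    rw [Algebra.algebraMap_eq_smul_one, TensorProduct.tmul_smul, ← algebraMap_smul S r, map_smul,
      ← Algebra.TensorProduct.one_def, map_one]
    exact Submodule.smul_mem _ _ (Submodule.tmul_mem_baseChange_of_mem _
      (by rw [ExteriorAlgebra.exteriorPower, pow_zero]; exact Submodule.one_le.mp le_rfl))
  | add x y i hx hy hx' hy' => rw [TensorProduct.tmul_add, map_add]; exact add_mem hx' hy'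
  | mem_mul m hm i x hx ih =>
    obtain ⟨m, rfl⟩ := hm
    have h1 := extMap_ι φ (1 ⊗ₜ m)
    rw [LinearMap.baseChange_tmul] at h1
    have : (1 : S) ⊗ₜ[k] (ExteriorAlgebra.ι k m * x) =
        (1 ⊗ₜ ExteriorAlgebra.ι k m) * (1 ⊗ₜ x) := by
      rw [Algebra.TensorProduct.tmul_mul_tmul, one_mul]
    rw [this, map_mul, h1]
    generalize φ (1 ⊗ₜ m) = z
    obtain ⟨y, hy⟩ := ih
    rw [← hy]
    induction z using TensorProduct.induction_on with
    | zero => rw [map_zero, zero_mul]; exact zero_mem _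
    | add z z' hz hz' => rw [map_add, add_mul]; exact add_mem hz hz'
    | tmul s n =>
      clear hy
      induction y using TensorProduct.induction_on with
      | zero => rw [map_zero, mul_zero]; exact zero_mem _
      | add y y' hy hy' => rw [map_add, mul_add]; exact add_mem hy hy'
      | tmul t y =>
        rw [LinearMap.baseChange_tmul, LinearMap.baseChange_tmul,
          Algebra.TensorProduct.tmul_mul_tmul]
        refine Submodule.tmul_mem_baseChange_of_mem _ ?_
        have := Submodule.mul_mem_mul (LinearMap.mem_range_self (ExteriorAlgebra.ι k) n) y.2
        rwa [← pow_succ'] at this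

end Exterior

/-- A strict polynomial functor over `𝔽₂`, in the sense of Friedlander and Suslin: every finite
dimensional `𝔽₂`-vector space `V` is sent to a vector space `F(V)`, and every `S`-linear map
`S ⊗ V → S ⊗ W`, for every commutative `𝔽₂`-algebra `S`, acts as an `S`-linear map
`S ⊗ F(V) → S ⊗ F(W)`. The action is functorial, and compatible with extension of the scalars
`S`: it is a polynomial map from `Hom(V, W)` to `Hom(F(V), F(W))`. -/
structure PolyFunctor : Type (u + 1) where
  /-- The value on a finite dimensional vector space. -/
  obj : FGModuleCat.{u} (ZMod 2) → Type u
  [addCommGroup : ∀ V, AddCommGroup (obj V)]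
  [module : ∀ V, Module (ZMod 2) (obj V)]
  /-- The action of the `S`-linear maps `S ⊗ V → S ⊗ W`. -/
  map : ∀ {V W : FGModuleCat.{u} (ZMod 2)} {S : Type u} [CommRing S] [Algebra (ZMod 2) S],
    (S ⊗[ZMod 2] V →ₗ[S] S ⊗[ZMod 2] W) → (S ⊗[ZMod 2] obj V →ₗ[S] S ⊗[ZMod 2] obj W)
  map_id : ∀ (V : FGModuleCat.{u} (ZMod 2)) (S : Type u) [CommRing S] [Algebra (ZMod 2) S],
    map (LinearMap.id : S ⊗[ZMod 2] V →ₗ[S] S ⊗[ZMod 2] V) = LinearMap.id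
  map_comp : ∀ {U V W : FGModuleCat.{u} (ZMod 2)} {S : Type u} [CommRing S] [Algebra (ZMod 2) S]
    (ψ : S ⊗[ZMod 2] V →ₗ[S] S ⊗[ZMod 2] W) (φ : S ⊗[ZMod 2] U →ₗ[S] S ⊗[ZMod 2] V),
    map (ψ ∘ₗ φ) = map ψ ∘ₗ map φ
  map_scalars : ∀ {V W : FGModuleCat.{u} (ZMod 2)} {S T : Type u} [CommRing S]
    [Algebra (ZMod 2) S] [CommRing T] [Algebra (ZMod 2) T] (σ : S →ₐ[ZMod 2] T)
    (φ : S ⊗[ZMod 2] V →ₗ[S] S ⊗[ZMod 2] W) (φ' : T ⊗[ZMod 2] V →ₗ[T] T ⊗[ZMod 2] W),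
    (∀ x, φ' (σ.toLinearMap.rTensor V x) = σ.toLinearMap.rTensor W (φ x)) →
    ∀ y, map φ' (σ.toLinearMap.rTensor (obj V) y) = σ.toLinearMap.rTensor (obj W) (map φ y)

attribute [instance] PolyFunctor.addCommGroup PolyFunctor.module

namespace PolyFunctor

/-- A morphism of strict polynomial functors: linear maps `F(V) → G(V)` that commute with the
action of all `S`-linear maps `S ⊗ V → S ⊗ W`. -/
@[ext]
structure Hom (F G : PolyFunctor.{u}) : Type (u + 1) where
  /-- The linear map `F(V) → G(V)`. -/
  app : ∀ V, F.obj V →ₗ[ZMod 2] G.obj V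
  naturality : ∀ {V W : FGModuleCat.{u} (ZMod 2)} {S : Type u} [CommRing S] [Algebra (ZMod 2) S]
    (φ : S ⊗[ZMod 2] V →ₗ[S] S ⊗[ZMod 2] W) (x : S ⊗[ZMod 2] F.obj V),
    (app W).baseChange S (F.map φ x) = G.map φ ((app V).baseChange S x)

namespace Hom

variable {F G H K : PolyFunctor.{u}}

instance : Zero (Hom F G) where
  zero :=
    { app := fun _ => 0
      naturality := fun φ x => by simp }

/-- The identity morphism. -/
def id (F : PolyFunctor.{u}) : Hom F F where
  app _ := LinearMap.id
  naturality φ x := by simp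

/-- Composition of morphisms. -/
def comp (g : Hom G H) (f : Hom F G) : Hom F H where
  app V := g.app V ∘ₗ f.app V
  naturality φ x := by
    rw [LinearMap.baseChange_comp, LinearMap.baseChange_comp, LinearMap.comp_apply,
      LinearMap.comp_apply, f.naturality, g.naturality]

/-- An isomorphism of strict polynomial functors (the inverse linear maps are automatically
compatible with the action of `S`-linear maps). -/
def IsIso (e : Hom F G) : Prop := ∀ V, Function.Bijective (e.app V)

/-- `i : K → F` is a kernel of `g : F → G`. -/
def IsKernel (i : Hom K F) (g : Hom F G) : Prop :=
  ∀ V, Function.Injective (i.app V) ∧ LinearMap.range (i.app V) = LinearMap.ker (g.app V)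

/-- `i : K → G` is an image of `f : F → G`. -/
def IsImage (i : Hom K G) (f : Hom F G) : Prop :=
  ∀ V, Function.Injective (i.app V) ∧ LinearMap.range (i.app V) = LinearMap.range (f.app V)

/-- `q : G → K` is a cokernel of `f : F → G`. -/
def IsCokernel (q : Hom G K) (f : Hom F G) : Prop :=
  ∀ V, Function.Surjective (q.app V) ∧ LinearMap.ker (q.app V) = LinearMap.range (f.app V)

/-- `f` is the only nonzero morphism of strict polynomial functors from `F` to `G`. -/
def IsUniqueNonzero (f : Hom F G) : Prop := f ≠ 0 ∧ ∀ f' : Hom F G, f' ≠ 0 → f' = f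

end Hom

section Sub

theorem baseChange_subtype_injective (S : Type*) [CommRing S] [Algebra (ZMod 2) S]
    {M : Type*} [AddCommGroup M] [Module (ZMod 2) M] (U : Submodule (ZMod 2) M) :
    Function.Injective (U.subtype.baseChange S) := by
  rw [LinearMap.baseChange_eq_ltensor]
  exact Module.Flat.lTensor_preserves_injective_linearMap _ U.injective_subtype

variable (F : PolyFunctor.{u}) (U : ∀ V, Submodule (ZMod 2) (F.obj V))

/-- The subspaces `U(V) ⊆ F(V)` are stable under the action of all `S`-linear maps. -/
def IsStable : Prop :=
  ∀ {V W : FGModuleCat.{u} (ZMod 2)} {S : Type u} [CommRing S] [Algebra (ZMod 2) S]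
    (φ : S ⊗[ZMod 2] V →ₗ[S] S ⊗[ZMod 2] W) (x : F.obj V),
    x ∈ U V → F.map φ (1 ⊗ₜ x) ∈ (U W).baseChange S

variable {F U}

theorem IsStable.map_mem (h : F.IsStable U) {V W : FGModuleCat.{u} (ZMod 2)} {S : Type u}
    [CommRing S] [Algebra (ZMod 2) S] (φ : S ⊗[ZMod 2] V →ₗ[S] S ⊗[ZMod 2] W)
    (x : S ⊗[ZMod 2] U V) :
    (F.map φ ∘ₗ (U V).subtype.baseChange S) x ∈ (U W).baseChange S := by
  induction x using TensorProduct.induction_on with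
  | zero => rw [_root_.map_zero]; exact zero_mem _
  | add x y hx hy => rw [_root_.map_add]; exact add_mem hx hy
  | tmul s x =>
    have hs : s ⊗ₜ[ZMod 2] x = s • ((1 : S) ⊗ₜ[ZMod 2] x) := by
      rw [TensorProduct.smul_tmul', smul_eq_mul, mul_one]
    rw [hs, _root_.map_smul]
    exact Submodule.smul_mem _ _ (h φ x.1 x.2)

/-- The restriction to `S ⊗ U(V) → S ⊗ U(W)` of the action on `F`. -/
def subMap (h : F.IsStable U) {V W : FGModuleCat.{u} (ZMod 2)} {S : Type u}
    [CommRing S] [Algebra (ZMod 2) S] (φ : S ⊗[ZMod 2] V →ₗ[S] S ⊗[ZMod 2] W) :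
    S ⊗[ZMod 2] U V →ₗ[S] S ⊗[ZMod 2] U W :=
  (LinearEquiv.ofInjective _ (baseChange_subtype_injective S (U W))).symm.toLinearMap ∘ₗ
    (F.map φ ∘ₗ (U V).subtype.baseChange S).codRestrict _ (h.map_mem φ)

theorem subtype_subMap (h : F.IsStable U) {V W : FGModuleCat.{u} (ZMod 2)} {S : Type u}
    [CommRing S] [Algebra (ZMod 2) S] (φ : S ⊗[ZMod 2] V →ₗ[S] S ⊗[ZMod 2] W)
    (x : S ⊗[ZMod 2] U V) :
    (U W).subtype.baseChange S (subMap h φ x) = F.map φ ((U V).subtype.baseChange S x) := by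
  have := congrArg Subtype.val (LinearEquiv.apply_symm_apply
    (LinearEquiv.ofInjective _ (baseChange_subtype_injective S (U W)))
    ((F.map φ ∘ₗ (U V).subtype.baseChange S).codRestrict _ (h.map_mem φ) x))
  exact this

variable (F U)

/-- The subfunctor given by a stable family of subspaces. -/
abbrev sub (h : F.IsStable U) : PolyFunctor.{u} where
  obj V := U V
  map φ := subMap h φ
  map_id V S _ _ := by
    refine LinearMap.ext fun x => baseChange_subtype_injective S (U V) ?_
    rw [subtype_subMap, F.map_id]
    rfl
  map_comp ψ φ := by
    refine LinearMap.ext fun x => baseChange_subtype_injective _ (U _) ?_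
    rw [subtype_subMap, F.map_comp, LinearMap.comp_apply, LinearMap.comp_apply, subtype_subMap,
      subtype_subMap]
  map_scalars σ φ φ' hφ y := by
    refine baseChange_subtype_injective _ (U _) ?_
    rw [subtype_subMap, ← rTensor_baseChange, ← rTensor_baseChange, subtype_subMap,
      F.map_scalars σ φ φ' hφ]

/-- The inclusion of a subfunctor. -/
def subι (h : F.IsStable U) : Hom (F.sub U h) F where
  app V := (U V).subtype
  naturality φ x := subtype_subMap h φ x

variable {F U}

/-- A morphism with values in a subfunctor. -/
def Hom.codRestrict {G : PolyFunctor.{u}} (f : Hom G F) (h : F.IsStable U)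
    (hf : ∀ V x, f.app V x ∈ U V) : Hom G (F.sub U h) where
  app V := (f.app V).codRestrict (U V) (hf V)
  naturality {V W S} _ _ φ x := by
    refine baseChange_subtype_injective _ (U _) ?_
    refine Eq.trans ?_ (subtype_subMap h φ _).symm
    have e : ∀ (V) (x : S ⊗[ZMod 2] G.obj V), (U V).subtype.baseChange S
        (((f.app V).codRestrict (U V) (hf V)).baseChange S x) = (f.app V).baseChange S x := by
      intro V x
      rw [← LinearMap.comp_apply, ← LinearMap.baseChange_comp, LinearMap.subtype_comp_codRestrict]
    exact (e W _).trans ((f.naturality φ x).trans (congrArg (F.map φ) (e V x).symm))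

theorem Hom.isStable_ker {G : PolyFunctor.{u}} (f : Hom F G) :
    F.IsStable fun V => LinearMap.ker (f.app V) := by
  intro V W S _ _ φ x hx
  have h0 : (f.app W).baseChange S (F.map φ (1 ⊗ₜ x)) = 0 := by
    rw [f.naturality, LinearMap.baseChange_tmul, LinearMap.mem_ker.mp hx,
      TensorProduct.tmul_zero, _root_.map_zero]
  have h1 : F.map φ (1 ⊗ₜ x) ∈ LinearMap.ker
      (TensorProduct.AlgebraTensorModule.lTensor S S (f.app W)) := h0
  rw [Module.Flat.ker_lTensor_eq] at h1
  obtain ⟨y, hy⟩ := h1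
  exact ⟨y, hy⟩

/-- The kernel of a morphism of strict polynomial functors. -/
abbrev Hom.ker {G : PolyFunctor.{u}} (f : Hom F G) : PolyFunctor.{u} :=
  F.sub (fun V => LinearMap.ker (f.app V)) f.isStable_ker

/-- The inclusion of the kernel. -/
def Hom.kerι {G : PolyFunctor.{u}} (f : Hom F G) : Hom f.ker F :=
  F.subι (fun V => LinearMap.ker (f.app V)) f.isStable_ker

end Sub

section Tensor

variable {M N M' N' : Type*} [AddCommGroup M] [Module (ZMod 2) M] [AddCommGroup N]
  [Module (ZMod 2) N] [AddCommGroup M'] [Module (ZMod 2) M'] [AddCommGroup N']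
  [Module (ZMod 2) N'] {S : Type*} [CommRing S] [Algebra (ZMod 2) S]

/-- The canonical isomorphism `S ⊗ (M ⊗ N) ≃ (S ⊗ M) ⊗_S (S ⊗ N)`. -/
def distrib (S : Type*) [CommRing S] [Algebra (ZMod 2) S] (M N : Type*) [AddCommGroup M]
    [Module (ZMod 2) M] [AddCommGroup N] [Module (ZMod 2) N] :
    S ⊗[ZMod 2] (M ⊗[ZMod 2] N) ≃ₗ[S] (S ⊗[ZMod 2] M) ⊗[S] (S ⊗[ZMod 2] N) :=
  TensorProduct.AlgebraTensorModule.distribBaseChange (ZMod 2) S M N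

theorem distrib_tmul (s : S) (m : M) (n : N) :
    distrib S M N (s ⊗ₜ (m ⊗ₜ n)) = (s ⊗ₜ m) ⊗ₜ (1 ⊗ₜ n) := rfl

theorem distrib_symm_tmul (s t : S) (m : M) (n : N) :
    (distrib S M N).symm ((s ⊗ₜ m) ⊗ₜ (t ⊗ₜ n)) = (t * s) ⊗ₜ (m ⊗ₜ n) := by
  rw [LinearEquiv.symm_apply_eq, distrib_tmul, ← smul_eq_mul, ← TensorProduct.smul_tmul',
    TensorProduct.smul_tmul, TensorProduct.smul_tmul', smul_eq_mul, mul_one]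

/-- The map `S ⊗ (M ⊗ N) → S ⊗ (M' ⊗ N')` attached to `S ⊗ M → S ⊗ M'` and `S ⊗ N → S ⊗ N'`. -/
def tensorMap (φ : S ⊗[ZMod 2] M →ₗ[S] S ⊗[ZMod 2] M') (ψ : S ⊗[ZMod 2] N →ₗ[S] S ⊗[ZMod 2] N') :
    S ⊗[ZMod 2] (M ⊗[ZMod 2] N) →ₗ[S] S ⊗[ZMod 2] (M' ⊗[ZMod 2] N') :=
  (distrib S M' N').symm.toLinearMap ∘ₗ TensorProduct.map φ ψ ∘ₗ (distrib S M N).toLinearMap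

theorem distrib_tensorMap (φ : S ⊗[ZMod 2] M →ₗ[S] S ⊗[ZMod 2] M')
    (ψ : S ⊗[ZMod 2] N →ₗ[S] S ⊗[ZMod 2] N') (x : S ⊗[ZMod 2] (M ⊗[ZMod 2] N)) :
    distrib S M' N' (tensorMap φ ψ x) = TensorProduct.map φ ψ (distrib S M N x) :=
  LinearEquiv.apply_symm_apply _ _

theorem distrib_baseChange_map (f : M →ₗ[ZMod 2] M') (g : N →ₗ[ZMod 2] N')
    (x : S ⊗[ZMod 2] (M ⊗[ZMod 2] N)) :
    distrib S M' N' ((TensorProduct.map f g).baseChange S x) =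
      TensorProduct.map (f.baseChange S) (g.baseChange S) (distrib S M N x) := by
  induction x using TensorProduct.induction_on with
  | zero => simp
  | add x y hx hy => simp only [_root_.map_add, hx, hy]
  | tmul s x =>
    induction x using TensorProduct.induction_on with
    | zero => simp
    | add x y hx hy => simp only [TensorProduct.tmul_add, _root_.map_add, hx, hy]
    | tmul m n => simp [distrib_tmul]

/-- Extension of scalars along `σ : S → T` on `S ⊗ M ⊗ N`, in terms of pure tensors. -/
theorem rTensor_distrib_symm {T : Type*} [CommRing T] [Algebra (ZMod 2) T] (σ : S →ₐ[ZMod 2] T)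
    (x : S ⊗[ZMod 2] M) (y : S ⊗[ZMod 2] N) :
    σ.toLinearMap.rTensor (M ⊗[ZMod 2] N) ((distrib S M N).symm (x ⊗ₜ y)) =
      (distrib T M N).symm (σ.toLinearMap.rTensor M x ⊗ₜ σ.toLinearMap.rTensor N y) := by
  induction x using TensorProduct.induction_on with
  | zero => simp
  | add x x' hx hx' => simp only [TensorProduct.add_tmul, _root_.map_add, hx, hx']
  | tmul s m =>
    induction y using TensorProduct.induction_on with
    | zero => simp
    | add y y' hy hy' => simp only [TensorProduct.tmul_add, _root_.map_add, hy, hy']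
    | tmul t n =>
      rw [distrib_symm_tmul, LinearMap.rTensor_tmul, LinearMap.rTensor_tmul, LinearMap.rTensor_tmul,
        distrib_symm_tmul]
      simp

/-- The tensor product of strict polynomial functors. -/
abbrev tensor (F G : PolyFunctor.{u}) : PolyFunctor.{u} where
  obj V := F.obj V ⊗[ZMod 2] G.obj V
  map φ := tensorMap (F.map φ) (G.map φ)
  map_id V S _ _ := by
    refine LinearMap.ext fun x => (distrib S _ _).injective ?_
    rw [distrib_tensorMap, F.map_id, G.map_id, TensorProduct.map_id]
    rfl
  map_comp ψ φ := by
    refine LinearMap.ext fun x => (distrib _ _ _).injective ?_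
    rw [distrib_tensorMap, F.map_comp, G.map_comp, LinearMap.comp_apply, distrib_tensorMap,
      distrib_tensorMap, TensorProduct.map_comp]
    rfl
  map_scalars {V W S T} _ _ _ _ σ φ φ' h y := by
    obtain ⟨z, rfl⟩ := (distrib S _ _).symm.surjective y
    induction z using TensorProduct.induction_on with
    | zero => simp
    | add x y hx hy => simp only [_root_.map_add, hx, hy]
    | tmul a b =>
      refine (distrib T _ _).injective ?_
      rw [distrib_tensorMap, rTensor_distrib_symm, LinearEquiv.apply_symm_apply,
        TensorProduct.map_tmul, F.map_scalars σ φ φ' h, G.map_scalars σ φ φ' h, tensorMap]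
      simp only [LinearMap.comp_apply, LinearEquiv.coe_coe, LinearEquiv.apply_symm_apply,
        TensorProduct.map_tmul]
      rw [rTensor_distrib_symm, LinearEquiv.apply_symm_apply]

theorem tensorMap_naturality (f : M →ₗ[ZMod 2] M') (g : N →ₗ[ZMod 2] N')
    {M₁ N₁ M₁' N₁' : Type*} [AddCommGroup M₁] [Module (ZMod 2) M₁] [AddCommGroup N₁]
    [Module (ZMod 2) N₁] [AddCommGroup M₁'] [Module (ZMod 2) M₁'] [AddCommGroup N₁']
    [Module (ZMod 2) N₁'] (f₁ : M₁ →ₗ[ZMod 2] M₁') (g₁ : N₁ →ₗ[ZMod 2] N₁')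
    (φ : S ⊗[ZMod 2] M →ₗ[S] S ⊗[ZMod 2] M₁) (ψ : S ⊗[ZMod 2] N →ₗ[S] S ⊗[ZMod 2] N₁)
    (φ' : S ⊗[ZMod 2] M' →ₗ[S] S ⊗[ZMod 2] M₁') (ψ' : S ⊗[ZMod 2] N' →ₗ[S] S ⊗[ZMod 2] N₁')
    (hφ : ∀ x, f₁.baseChange S (φ x) = φ' (f.baseChange S x))
    (hψ : ∀ x, g₁.baseChange S (ψ x) = ψ' (g.baseChange S x))
    (x : S ⊗[ZMod 2] (M ⊗[ZMod 2] N)) :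
    (TensorProduct.map f₁ g₁).baseChange S (tensorMap φ ψ x) =
      tensorMap φ' ψ' ((TensorProduct.map f g).baseChange S x) := by
  refine (distrib S _ _).injective ?_
  rw [distrib_baseChange_map, distrib_tensorMap, distrib_tensorMap, distrib_baseChange_map]
  generalize distrib S M N x = z
  induction z using TensorProduct.induction_on with
  | zero => simp
  | add x y hx hy => simp only [_root_.map_add, hx, hy]
  | tmul a b => simp only [TensorProduct.map_tmul, hφ, hψ]

/-- The tensor product of morphisms. -/
def Hom.tensor {F G F' G' : PolyFunctor.{u}} (f : Hom F F') (g : Hom G G') :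
    Hom (F.tensor G) (F'.tensor G') where
  app V := TensorProduct.map (f.app V) (g.app V)
  naturality φ x := tensorMap_naturality (f.app _) (g.app _) (f.app _) (g.app _) (F.map φ)
    (G.map φ) (F'.map φ) (G'.map φ) (f.naturality φ) (g.naturality φ) x

end Tensor

end PolyFunctor

section Twist

variable {M N P : Type*} [AddCommGroup M] [Module (ZMod 2) M] [AddCommGroup N]
  [Module (ZMod 2) N] [AddCommGroup P] [Module (ZMod 2) P]

/-- The `r`-th power of the Frobenius of a commutative `𝔽₂`-algebra: `s ↦ s ^ (2 ^ r)`. -/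
def frob (S : Type*) [CommRing S] [Algebra (ZMod 2) S] : ℕ → (S →ₐ[ZMod 2] S)
  | 0 => AlgHom.id (ZMod 2) S
  | r + 1 => (FiniteField.frobeniusAlgHom (ZMod 2) S).comp (frob S r)

variable {S : Type*} [CommRing S] [Algebra (ZMod 2) S]

theorem frob_apply (r : ℕ) (s : S) : frob S r s = s ^ 2 ^ r := by
  induction r with
  | zero => simp [frob]
  | succ r ih =>
    change FiniteField.frobeniusAlgHom (ZMod 2) S (frob S r s) = _
    rw [ih, FiniteField.coe_frobeniusAlgHom, ZMod.card, pow_succ, pow_mul]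

/-- The map `s ⊗ m ↦ s ^ (2 ^ r) ⊗ m`. -/
def frobT (S : Type*) [CommRing S] [Algebra (ZMod 2) S] (M : Type*) [AddCommGroup M]
    [Module (ZMod 2) M] (r : ℕ) : S ⊗[ZMod 2] M →ₗ[ZMod 2] S ⊗[ZMod 2] M := (frob S r).toLinearMap.rTensor M

theorem frobT_tmul (r : ℕ) (s : S) (m : M) : frobT S M r (s ⊗ₜ m) = (s ^ 2 ^ r) ⊗ₜ m := by
  rw [frobT, LinearMap.rTensor_tmul, AlgHom.toLinearMap_apply, frob_apply]

theorem frobT_smul (r : ℕ) (s : S) (x : S ⊗[ZMod 2] M) :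
    frobT S M r (s • x) = (s ^ 2 ^ r) • frobT S M r x := by
  induction x using TensorProduct.induction_on with
  | zero => simp
  | add x y hx hy => simp only [smul_add, map_add, hx, hy]
  | tmul t m =>
    rw [TensorProduct.smul_tmul', frobT_tmul, frobT_tmul, TensorProduct.smul_tmul', smul_eq_mul,
      smul_eq_mul, mul_pow]

theorem frobT_succ (r : ℕ) (x : S ⊗[ZMod 2] M) :
    frobT S M (r + 1) x = frobT S M 1 (frobT S M r x) := by
  induction x using TensorProduct.induction_on with
  | zero => simp
  | add x y hx hy => simp only [map_add, hx, hy]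
  | tmul t m => rw [frobT_tmul, frobT_tmul, frobT_tmul, pow_succ, pow_mul, pow_one]

/-- The `r`-th Frobenius twist of an `S`-linear map `φ : S ⊗ M → S ⊗ N`: in coordinates, the
entries of the matrix of `φ` are raised to the power `2 ^ r`. -/
def twistMap (r : ℕ) (φ : S ⊗[ZMod 2] M →ₗ[S] S ⊗[ZMod 2] N) :
    S ⊗[ZMod 2] M →ₗ[S] S ⊗[ZMod 2] N :=
  LinearMap.liftBaseChange S
    (frobT S N r ∘ₗ φ.restrictScalars (ZMod 2) ∘ₗ TensorProduct.mk (ZMod 2) S M 1)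

theorem twistMap_one_tmul (r : ℕ) (φ : S ⊗[ZMod 2] M →ₗ[S] S ⊗[ZMod 2] N) (m : M) :
    twistMap r φ (1 ⊗ₜ m) = frobT S N r (φ (1 ⊗ₜ m)) := by
  rw [twistMap, LinearMap.liftBaseChange_tmul, one_smul]
  rfl

theorem tmul_eq_smul (s : S) (m : M) : s ⊗ₜ[ZMod 2] m = s • ((1 : S) ⊗ₜ[ZMod 2] m) := by
  rw [TensorProduct.smul_tmul', smul_eq_mul, mul_one]

theorem twistMap_frobT (r : ℕ) (φ : S ⊗[ZMod 2] M →ₗ[S] S ⊗[ZMod 2] N) (x : S ⊗[ZMod 2] M) :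
    twistMap r φ (frobT S M r x) = frobT S N r (φ x) := by
  induction x using TensorProduct.induction_on with
  | zero => simp
  | add x y hx hy => simp only [map_add, hx, hy]
  | tmul t m =>
    rw [frobT_tmul, tmul_eq_smul, tmul_eq_smul t, map_smul, map_smul, frobT_smul,
      twistMap_one_tmul]

/-- Two `S`-linear maps out of `S ⊗ M` agree if they agree on the `1 ⊗ m`. -/
theorem linearMap_ext {Q : Type*} [AddCommGroup Q] [Module S Q]
    {f g : S ⊗[ZMod 2] M →ₗ[S] Q} (h : ∀ m, f (1 ⊗ₜ m) = g (1 ⊗ₜ m)) : f = g := by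
  refine LinearMap.ext fun x => ?_
  induction x using TensorProduct.induction_on with
  | zero => simp
  | add x y hx hy => simp only [map_add, hx, hy]
  | tmul t m => rw [tmul_eq_smul, map_smul, map_smul, h]

theorem twistMap_id (r : ℕ) :
    twistMap r (LinearMap.id : S ⊗[ZMod 2] M →ₗ[S] S ⊗[ZMod 2] M) = LinearMap.id := by
  refine linearMap_ext fun m => ?_
  rw [twistMap_one_tmul, LinearMap.id_apply, frobT_tmul, one_pow]

theorem twistMap_comp (r : ℕ) (ψ : S ⊗[ZMod 2] N →ₗ[S] S ⊗[ZMod 2] P)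
    (φ : S ⊗[ZMod 2] M →ₗ[S] S ⊗[ZMod 2] N) :
    twistMap r (ψ ∘ₗ φ) = twistMap r ψ ∘ₗ twistMap r φ := by
  refine linearMap_ext fun m => ?_
  rw [twistMap_one_tmul, LinearMap.comp_apply, LinearMap.comp_apply, twistMap_one_tmul,
    twistMap_frobT]

variable {T : Type*} [CommRing T] [Algebra (ZMod 2) T]

theorem rTensor_smul (σ : S →ₐ[ZMod 2] T) (s : S) (x : S ⊗[ZMod 2] M) :
    σ.toLinearMap.rTensor M (s • x) = σ s • σ.toLinearMap.rTensor M x := by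
  induction x using TensorProduct.induction_on with
  | zero => simp
  | add x y hx hy => simp only [smul_add, map_add, hx, hy]
  | tmul t m => simp [TensorProduct.smul_tmul']

theorem rTensor_frobT (σ : S →ₐ[ZMod 2] T) (r : ℕ) (x : S ⊗[ZMod 2] M) :
    σ.toLinearMap.rTensor M (frobT S M r x) = frobT T M r (σ.toLinearMap.rTensor M x) := by
  induction x using TensorProduct.induction_on with
  | zero => simp
  | add x y hx hy => simp only [map_add, hx, hy]
  | tmul t m => simp [frobT_tmul]

/-- To check compatibility with extension of scalars, it is enough to look at the `1 ⊗ m`. -/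
theorem scalars_of_one_tmul (σ : S →ₐ[ZMod 2] T) (φ : S ⊗[ZMod 2] M →ₗ[S] S ⊗[ZMod 2] N)
    (φ' : T ⊗[ZMod 2] M →ₗ[T] T ⊗[ZMod 2] N)
    (h : ∀ m, φ' (1 ⊗ₜ m) = σ.toLinearMap.rTensor N (φ (1 ⊗ₜ m))) (x : S ⊗[ZMod 2] M) :
    φ' (σ.toLinearMap.rTensor M x) = σ.toLinearMap.rTensor N (φ x) := by
  induction x using TensorProduct.induction_on with
  | zero => simp
  | add x y hx hy => simp only [map_add, hx, hy]
  | tmul t m =>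
    rw [tmul_eq_smul, rTensor_smul, map_smul, map_smul, rTensor_smul, ← h,
      LinearMap.rTensor_tmul, AlgHom.toLinearMap_apply, map_one]

theorem twistMap_scalars (r : ℕ) (σ : S →ₐ[ZMod 2] T) (φ : S ⊗[ZMod 2] M →ₗ[S] S ⊗[ZMod 2] N)
    (φ' : T ⊗[ZMod 2] M →ₗ[T] T ⊗[ZMod 2] N)
    (h : ∀ x, φ' (σ.toLinearMap.rTensor M x) = σ.toLinearMap.rTensor N (φ x))
    (x : S ⊗[ZMod 2] M) :
    twistMap r φ' (σ.toLinearMap.rTensor M x) = σ.toLinearMap.rTensor N (twistMap r φ x) := by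
  refine scalars_of_one_tmul σ _ _ (fun m => ?_) x
  rw [twistMap_one_tmul, twistMap_one_tmul, rTensor_frobT, ← h, LinearMap.rTensor_tmul,
    AlgHom.toLinearMap_apply, map_one]

/-- The action of `φ : S ⊗ M → S ⊗ N` on `S ⊗ ⨁_r M^{(r)}`: the direct sum of the Frobenius twists
of `φ`. -/
def sumMap (φ : S ⊗[ZMod 2] M →ₗ[S] S ⊗[ZMod 2] N) :
    S ⊗[ZMod 2] (ℕ →₀ M) →ₗ[S] S ⊗[ZMod 2] (ℕ →₀ N) :=
  LinearMap.liftBaseChange S (Finsupp.lsum (ZMod 2) fun r : ℕ =>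
    ((Finsupp.lsingle r : N →ₗ[ZMod 2] ℕ →₀ N).baseChange S ∘ₗ twistMap r φ).restrictScalars
      (ZMod 2) ∘ₗ TensorProduct.mk (ZMod 2) S M 1)

theorem sumMap_one_tmul (φ : S ⊗[ZMod 2] M →ₗ[S] S ⊗[ZMod 2] N) (r : ℕ) (m : M) :
    sumMap φ (1 ⊗ₜ Finsupp.single r m) =
      (Finsupp.lsingle r : N →ₗ[ZMod 2] ℕ →₀ N).baseChange S (twistMap r φ (1 ⊗ₜ m)) := by
  rw [sumMap, LinearMap.liftBaseChange_tmul, one_smul, Finsupp.lsum_single]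
  rfl

theorem sumMap_single (φ : S ⊗[ZMod 2] M →ₗ[S] S ⊗[ZMod 2] N) (r : ℕ) (x : S ⊗[ZMod 2] M) :
    sumMap φ ((Finsupp.lsingle r : M →ₗ[ZMod 2] ℕ →₀ M).baseChange S x) =
      (Finsupp.lsingle r : N →ₗ[ZMod 2] ℕ →₀ N).baseChange S (twistMap r φ x) := by
  rw [← LinearMap.comp_apply, ← LinearMap.comp_apply]
  refine LinearMap.congr_fun (linearMap_ext fun m => ?_) x
  rw [LinearMap.comp_apply, LinearMap.baseChange_tmul, LinearMap.comp_apply]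
  exact sumMap_one_tmul φ r m

theorem sum_linearMap_ext {Q : Type*} [AddCommGroup Q] [Module S Q]
    {f g : S ⊗[ZMod 2] (ℕ →₀ M) →ₗ[S] Q}
    (h : ∀ r m, f (1 ⊗ₜ Finsupp.single r m) = g (1 ⊗ₜ Finsupp.single r m)) : f = g := by
  refine linearMap_ext fun x => ?_
  induction x using Finsupp.induction_linear with
  | zero => simp
  | add x y hx hy => simp only [TensorProduct.tmul_add, map_add, hx, hy]
  | single r m => exact h r m

theorem sumMap_id :
    sumMap (LinearMap.id : S ⊗[ZMod 2] M →ₗ[S] S ⊗[ZMod 2] M) = LinearMap.id := by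
  refine sum_linearMap_ext fun r m => ?_
  rw [sumMap_one_tmul, twistMap_id]
  rfl

theorem sumMap_comp (ψ : S ⊗[ZMod 2] N →ₗ[S] S ⊗[ZMod 2] P)
    (φ : S ⊗[ZMod 2] M →ₗ[S] S ⊗[ZMod 2] N) : sumMap (ψ ∘ₗ φ) = sumMap ψ ∘ₗ sumMap φ := by
  refine sum_linearMap_ext fun r m => ?_
  rw [sumMap_one_tmul, twistMap_comp, LinearMap.comp_apply, LinearMap.comp_apply, sumMap_one_tmul,
    sumMap_single]

theorem sumMap_scalars (σ : S →ₐ[ZMod 2] T) (φ : S ⊗[ZMod 2] M →ₗ[S] S ⊗[ZMod 2] N)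
    (φ' : T ⊗[ZMod 2] M →ₗ[T] T ⊗[ZMod 2] N)
    (h : ∀ x, φ' (σ.toLinearMap.rTensor M x) = σ.toLinearMap.rTensor N (φ x))
    (x : S ⊗[ZMod 2] (ℕ →₀ M)) :
    sumMap φ' (σ.toLinearMap.rTensor _ x) = σ.toLinearMap.rTensor _ (sumMap φ x) := by
  refine scalars_of_one_tmul σ _ _ (fun m => ?_) x
  induction m using Finsupp.induction_linear with
  | zero => simp
  | add x y hx hy => simp only [TensorProduct.tmul_add, map_add, hx, hy]
  | single r m =>
    rw [sumMap_one_tmul, sumMap_one_tmul, rTensor_baseChange, ← twistMap_scalars r σ φ φ' h,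
      LinearMap.rTensor_tmul, AlgHom.toLinearMap_apply, map_one]

variable (M) in
/-- The shift `⨁_r M^{(r)} → ⨁_r M^{(r)}` that sends the summand `M^{(r)}` to `M^{(r+1)}`. -/
def shiftLin : (ℕ →₀ M) →ₗ[ZMod 2] (ℕ →₀ M) := Finsupp.lmapDomain M (ZMod 2) Nat.succ

theorem shiftLin_single (r : ℕ) (m : M) :
    shiftLin M (Finsupp.single r m) = Finsupp.single (r + 1) m := by
  rw [shiftLin, Finsupp.lmapDomain_apply, Finsupp.mapDomain_single]

theorem shiftLin_naturality (φ : S ⊗[ZMod 2] M →ₗ[S] S ⊗[ZMod 2] N) (x : S ⊗[ZMod 2] (ℕ →₀ M)) :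
    (shiftLin N).baseChange S (twistMap 1 (sumMap φ) x) =
      sumMap φ ((shiftLin M).baseChange S x) := by
  rw [← LinearMap.comp_apply, ← LinearMap.comp_apply]
  refine LinearMap.congr_fun (sum_linearMap_ext fun r m => ?_) x
  rw [LinearMap.comp_apply, LinearMap.comp_apply, LinearMap.baseChange_tmul, shiftLin_single,
    twistMap_one_tmul, sumMap_one_tmul, sumMap_one_tmul, twistMap_one_tmul, twistMap_one_tmul,
    frobT_succ r]
  generalize frobT S N r (φ (1 ⊗ₜ m)) = y
  induction y using TensorProduct.induction_on with
  | zero => simp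
  | add x y hx hy => simp only [map_add, hx, hy]
  | tmul s n =>
    simp only [LinearMap.baseChange_tmul, frobT_tmul, Finsupp.lsingle_apply, shiftLin_single]

end Twist

section GammaNaturality

variable {M N : Type*} [AddCommGroup M] [Module (ZMod 2) M] [AddCommGroup N]
  [Module (ZMod 2) N] {S : Type*} [CommRing S] [Algebra (ZMod 2) S]

theorem emb_naturality (φ : S ⊗[ZMod 2] M →ₗ[S] S ⊗[ZMod 2] N) (x : S ⊗[ZMod 2] M) :
    (emb (ZMod 2) N).baseChange S (φ x) = gammaMap φ ((emb (ZMod 2) M).baseChange S x) := by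
  have h1 : ∀ y : S ⊗[ZMod 2] N,
      (emb (ZMod 2) N).baseChange S y = PowerSeries.coeff 1 (extSeries S y) := by
    intro y
    induction y using TensorProduct.induction_on with
    | zero => simp [extSeries_zero, PowerSeries.coeff_one]
    | add x y hx hy =>
      rw [map_add, hx, hy, extSeries_add, PowerSeries.coeff_mul,
        Finset.Nat.sum_antidiagonal_succ, Finset.Nat.antidiagonal_zero, Finset.sum_singleton,
        (isExp_extSeries x).1, (isExp_extSeries y).1, one_mul, mul_one, add_comm]
    | tmul s n => rw [extSeries_tmul, coeff_extSeriesAux, pow_one]; rfl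
  have : (emb (ZMod 2) N).baseChange S ∘ₗ φ =
      (gammaMap φ).toLinearMap ∘ₗ (emb (ZMod 2) M).baseChange S := by
    refine linearMap_ext fun m => ?_
    rw [LinearMap.comp_apply, h1, LinearMap.comp_apply, LinearMap.baseChange_tmul, emb_apply]
    exact (gammaMap_tmul_dp φ 1 m).symm
  exact LinearMap.congr_fun this x

/-- The extension of the counit to `S ⊗ Γ(M) → S`. -/
def counitS (S : Type*) [CommRing S] [Algebra (ZMod 2) S] (M : Type*) [AddCommGroup M]
    [Module (ZMod 2) M] : S ⊗[ZMod 2] Gam (ZMod 2) M →ₐ[S] S :=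
  Algebra.TensorProduct.lift (AlgHom.id S S) ((Algebra.ofId (ZMod 2) S).comp counit)
    (fun _ _ => Commute.all _ _)

theorem counitS_tmul (s : S) (x : Gam (ZMod 2) M) :
    counitS S M (s ⊗ₜ x) = s * algebraMap (ZMod 2) S (counit x) := by
  rw [counitS, Algebra.TensorProduct.lift_tmul]
  rfl

theorem versch_baseChange_mul (u v : S ⊗[ZMod 2] Gam (ZMod 2) M) :
    versch.baseChange S (u * v) =
      counitS S M u • versch.baseChange S v + counitS S M v • versch.baseChange S u := by
  induction u using TensorProduct.induction_on with
  | zero => simp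
  | add u u' hu hu' =>
    simp only [add_mul, map_add, hu, hu', add_smul, smul_add]
    abel
  | tmul s x =>
    induction v using TensorProduct.induction_on with
    | zero => simp
    | add v v' hv hv' =>
      simp only [mul_add, map_add, hv, hv', add_smul, smul_add]
      abel
    | tmul t y =>
      simp only [Algebra.TensorProduct.tmul_mul_tmul, LinearMap.baseChange_tmul, versch_mul,
        counitS_tmul, TensorProduct.tmul_add, TensorProduct.tmul_smul, TensorProduct.smul_tmul',
        smul_eq_mul]
      congr 1
      · rw [Algebra.smul_def]; congr 1; ring
      · rw [Algebra.smul_def]; congr 1; ring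

theorem counitS_extSeries (x : S ⊗[ZMod 2] M) :
    PowerSeries.map (counitS S M).toRingHom (extSeries S x) = 1 := by
  induction x using TensorProduct.induction_on with
  | zero => rw [extSeries_zero, map_one]
  | add x y hx hy => rw [extSeries_add, map_mul, hx, hy, one_mul]
  | tmul s m =>
    ext n
    rw [PowerSeries.coeff_map, extSeries_tmul, coeff_extSeriesAux, PowerSeries.coeff_one]
    refine (counitS_tmul _ _).trans ?_
    rw [counit_dp]
    split_ifs with h
    · rw [h, pow_zero, map_one, one_mul]
    · rw [map_zero, mul_zero]

theorem versch_baseChange_one :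
    versch.baseChange S (1 : S ⊗[ZMod 2] Gam (ZMod 2) M) = 0 := by
  have h : versch (1 : Gam (ZMod 2) M) = 0 := by
    have := versch_algebraMap (M := M) 1
    rwa [map_one] at this
  rw [Algebra.TensorProduct.one_def, LinearMap.baseChange_tmul, h, TensorProduct.tmul_zero]

theorem versch_extSeries (n : ℕ) (x : S ⊗[ZMod 2] M) :
    versch.baseChange S (PowerSeries.coeff n (extSeries S x)) =
      if n = 2 then frobT S M 1 x else 0 := by
  have hc : ∀ (i : ℕ) (y : S ⊗[ZMod 2] M), counitS S M (PowerSeries.coeff i (extSeries S y)) =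
      if i = 0 then 1 else 0 := by
    intro i y
    have := congrArg (PowerSeries.coeff i) (counitS_extSeries y)
    rw [PowerSeries.coeff_map, PowerSeries.coeff_one] at this
    exact this
  induction x using TensorProduct.induction_on generalizing n with
  | zero =>
    rw [extSeries_zero, PowerSeries.coeff_one, map_zero]
    split_ifs with h
    · omega
    · exact versch_baseChange_one
    · exact map_zero _
    · exact map_zero _
  | tmul s m =>
    rw [extSeries_tmul, coeff_extSeriesAux, LinearMap.baseChange_tmul, versch_dp, frobT_tmul]
    split_ifs with h
    · rw [h, pow_one]
    · rw [TensorProduct.tmul_zero]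
  | add x y hx hy =>
    rw [extSeries_add, PowerSeries.coeff_mul, map_sum]
    simp only [versch_baseChange_mul, hx, hy, hc, ite_smul, one_smul, zero_smul]
    rw [Finset.sum_add_distrib, Finset.sum_eq_single (0, n), Finset.sum_eq_single (n, 0)]
    · simp only [if_true, map_add]
      split_ifs
      · rw [add_comm]
      · rw [add_zero]
    · rintro ⟨a, b⟩ hab hne
      have := Finset.HasAntidiagonal.mem_antidiagonal.mp hab
      simp only at this
      rw [if_neg]
      rintro rfl
      exact hne (by rw [Prod.mk.injEq]; omega)
    · intro hn
      exact absurd (Finset.HasAntidiagonal.mem_antidiagonal.mpr (Nat.add_zero n)) hn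
    · rintro ⟨a, b⟩ hab hne
      have := Finset.HasAntidiagonal.mem_antidiagonal.mp hab
      simp only at this
      rw [if_neg]
      rintro rfl
      exact hne (by rw [Prod.mk.injEq]; omega)
    · intro hn
      exact absurd (Finset.HasAntidiagonal.mem_antidiagonal.mpr (Nat.zero_add n)) hn

theorem counitS_gammaMap (φ : S ⊗[ZMod 2] M →ₗ[S] S ⊗[ZMod 2] N)
    (x : S ⊗[ZMod 2] Gam (ZMod 2) M) : counitS S N (gammaMap φ x) = counitS S M x := by
  have : (counitS S N).comp (gammaMap φ) = counitS S M := by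
    refine baseChange_gamma_ext fun n m => ?_
    have := congrArg (PowerSeries.coeff n) (counitS_extSeries (φ (1 ⊗ₜ m)))
    rw [PowerSeries.coeff_map, PowerSeries.coeff_one] at this
    rw [AlgHom.comp_apply, gammaMap_tmul_dp, counitS_tmul, counit_dp, one_mul]
    refine this.trans ?_
    split_ifs
    · rw [map_one]
    · rw [map_zero]
  exact DFunLike.congr_fun this x

theorem versch_naturality (φ : S ⊗[ZMod 2] M →ₗ[S] S ⊗[ZMod 2] N)
    (x : S ⊗[ZMod 2] Gam (ZMod 2) M) :
    versch.baseChange S (gammaMap φ x) = twistMap 1 φ (versch.baseChange S x) := by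
  have : versch.baseChange S ∘ₗ (gammaMap φ).toLinearMap = twistMap 1 φ ∘ₗ versch.baseChange S := by
    refine linearMap_ext fun x => ?_
    simp only [LinearMap.comp_apply, AlgHom.toLinearMap_apply]
    induction x using Gam.induction_on with
    | C a =>
      have h : (1 : S) ⊗ₜ[ZMod 2] algebraMap (ZMod 2) (Gam (ZMod 2) M) a =
          algebraMap (ZMod 2) S a • 1 := by
        rw [Algebra.algebraMap_eq_smul_one, TensorProduct.tmul_smul, algebraMap_smul]
        rfl
      rw [h, map_smul, map_smul, map_smul, map_smul, map_one, versch_baseChange_one,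
        versch_baseChange_one, map_zero]
    | add x y hx hy => simp only [TensorProduct.tmul_add, map_add, hx, hy]
    | dp x n m hx =>
      have : (1 : S) ⊗ₜ[ZMod 2] (x * dp (ZMod 2) n m) = (1 ⊗ₜ x) * (1 ⊗ₜ dp (ZMod 2) n m) := by
        rw [Algebra.TensorProduct.tmul_mul_tmul, one_mul]
      rw [this, map_mul, versch_baseChange_mul, versch_baseChange_mul, counitS_gammaMap,
        counitS_gammaMap, hx, map_add, map_smul, map_smul]
      congr 2
      rw [gammaMap_tmul_dp, versch_extSeries, LinearMap.baseChange_tmul, versch_dp]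
      split_ifs
      · rw [twistMap_one_tmul]
      · rw [TensorProduct.tmul_zero, map_zero]
  exact LinearMap.congr_fun this x

section Distrib

variable {C D : Type*} [CommRing C] [Algebra (ZMod 2) C] [CommRing D] [Algebra (ZMod 2) D]

theorem distrib_one : PolyFunctor.distrib S C D 1 = 1 := rfl

theorem distrib_mul (x y : S ⊗[ZMod 2] (C ⊗[ZMod 2] D)) :
    PolyFunctor.distrib S C D (x * y) =
      PolyFunctor.distrib S C D x * PolyFunctor.distrib S C D y := by
  induction x using TensorProduct.induction_on with
  | zero => rw [zero_mul, LinearEquiv.map_zero]; exact (zero_mul _).symm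
  | add u u' hu hu' => rw [add_mul, LinearEquiv.map_add, LinearEquiv.map_add, hu, hu']; exact (add_mul _ _ _).symm
  | tmul s x =>
    induction y using TensorProduct.induction_on with
    | zero => rw [mul_zero, LinearEquiv.map_zero]; exact (mul_zero _).symm
    | add u u' hu hu' => rw [mul_add, LinearEquiv.map_add, LinearEquiv.map_add, hu, hu']; exact (mul_add _ _ _).symm
    | tmul t y =>
      rw [Algebra.TensorProduct.tmul_mul_tmul]
      induction x using TensorProduct.induction_on with
      | zero =>
        rw [zero_mul, TensorProduct.tmul_zero, TensorProduct.tmul_zero, LinearEquiv.map_zero]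
        exact (zero_mul _).symm
      | add u u' hu hu' =>
        rw [add_mul, TensorProduct.tmul_add, TensorProduct.tmul_add, LinearEquiv.map_add, LinearEquiv.map_add, hu, hu']
        exact (add_mul _ _ _).symm
      | tmul a b =>
        induction y using TensorProduct.induction_on with
        | zero =>
          rw [mul_zero, TensorProduct.tmul_zero, TensorProduct.tmul_zero, LinearEquiv.map_zero]
          exact (mul_zero _).symm
        | add u u' hu hu' =>
          rw [mul_add, TensorProduct.tmul_add, TensorProduct.tmul_add, LinearEquiv.map_add, LinearEquiv.map_add, hu, hu']
          exact (mul_add _ _ _).symm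
        | tmul c d =>
          rw [Algebra.TensorProduct.tmul_mul_tmul, PolyFunctor.distrib_tmul,
            PolyFunctor.distrib_tmul, PolyFunctor.distrib_tmul]
          refine Eq.trans ?_ (Algebra.TensorProduct.tmul_mul_tmul _ _ _ _).symm
          rw [Algebra.TensorProduct.tmul_mul_tmul, Algebra.TensorProduct.tmul_mul_tmul, mul_one]

end Distrib

/-- The comultiplication over `S`, as a map `S ⊗ Γ(M) → (S ⊗ Γ(M)) ⊗_S (S ⊗ Γ(M))`. -/
def comulS (S : Type*) [CommRing S] [Algebra (ZMod 2) S] (M : Type*) [AddCommGroup M]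
    [Module (ZMod 2) M] : S ⊗[ZMod 2] Gam (ZMod 2) M →ₐ[S]
      (S ⊗[ZMod 2] Gam (ZMod 2) M) ⊗[S] (S ⊗[ZMod 2] Gam (ZMod 2) M) :=
  (AlgHom.ofLinearMap (PolyFunctor.distrib S (Gam (ZMod 2) M) (Gam (ZMod 2) M)).toLinearMap
    distrib_one distrib_mul).comp (Algebra.TensorProduct.map (AlgHom.id S S) comul)

theorem comulS_apply (x : S ⊗[ZMod 2] Gam (ZMod 2) M) :
    comulS S M x = PolyFunctor.distrib S _ _ (comul.toLinearMap.baseChange S x) := by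
  rfl

theorem comulS_extSeries (x : S ⊗[ZMod 2] M) :
    PowerSeries.map (comulS S M).toRingHom (extSeries S x) =
      PowerSeries.map (Algebra.TensorProduct.includeLeft : S ⊗[ZMod 2] Gam (ZMod 2) M →ₐ[S]
        (S ⊗[ZMod 2] Gam (ZMod 2) M) ⊗[S] (S ⊗[ZMod 2] Gam (ZMod 2) M)).toRingHom (extSeries S x) *
      PowerSeries.map (Algebra.TensorProduct.includeRight : S ⊗[ZMod 2] Gam (ZMod 2) M →ₐ[S]
        (S ⊗[ZMod 2] Gam (ZMod 2) M) ⊗[S] (S ⊗[ZMod 2] Gam (ZMod 2) M)).toRingHom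
          (extSeries S x) := by
  induction x using TensorProduct.induction_on with
  | zero => simp only [extSeries_zero, map_one, one_mul]
  | add x y hx hy => simp only [extSeries_add, map_mul, hx, hy]; ring
  | tmul s m =>
    ext n
    rw [PowerSeries.coeff_map, extSeries_tmul, coeff_extSeriesAux, PowerSeries.coeff_mul]
    change comulS S M _ = _
    rw [comulS_apply, LinearMap.baseChange_tmul, AlgHom.toLinearMap_apply, comul_dp,
      TensorProduct.tmul_sum, map_sum]
    refine Finset.sum_congr rfl fun p hp => ?_
    rw [PowerSeries.coeff_map, PowerSeries.coeff_map, coeff_extSeriesAux, coeff_extSeriesAux,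
      PolyFunctor.distrib_tmul, ← Finset.HasAntidiagonal.mem_antidiagonal.mp hp]
    refine Eq.trans ?_ (Algebra.TensorProduct.tmul_mul_tmul _ _ _ _).symm
    rw [mul_one, one_mul, tmul_eq_smul, tmul_eq_smul (s ^ p.1), tmul_eq_smul (s ^ p.2),
      TensorProduct.tmul_smul, ← TensorProduct.smul_tmul', ← TensorProduct.smul_tmul',
      smul_smul, pow_add, mul_comm]

theorem comul_naturality (φ : S ⊗[ZMod 2] M →ₗ[S] S ⊗[ZMod 2] N)
    (x : S ⊗[ZMod 2] Gam (ZMod 2) M) :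
    comul.toLinearMap.baseChange S (gammaMap φ x) =
      PolyFunctor.tensorMap (gammaMap φ).toLinearMap (gammaMap φ).toLinearMap
        (comul.toLinearMap.baseChange S x) := by
  refine (PolyFunctor.distrib S _ _).injective ?_
  rw [PolyFunctor.distrib_tensorMap, ← comulS_apply, ← comulS_apply]
  have : (comulS S N).comp (gammaMap φ) =
      (Algebra.TensorProduct.map (gammaMap φ) (gammaMap φ)).comp (comulS S M) := by
    refine baseChange_gamma_ext fun n m => ?_
    rw [AlgHom.comp_apply, gammaMap_tmul_dp, AlgHom.comp_apply]
    have h1 := congrArg (PowerSeries.coeff n) (comulS_extSeries (φ (1 ⊗ₜ m)))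
    have h2 := congrArg (PowerSeries.coeff n) (comulS_extSeries ((1 : S) ⊗ₜ[ZMod 2] m))
    rw [PowerSeries.coeff_map, PowerSeries.coeff_mul] at h1 h2
    rw [extSeries_tmul, coeff_extSeriesAux, one_pow] at h2
    refine h1.trans (Eq.trans ?_ (congrArg _ h2).symm)
    rw [map_sum]
    refine Finset.sum_congr rfl fun p _ => ?_
    simp only [PowerSeries.coeff_map, coeff_extSeriesAux, one_pow, map_mul]
    congr 1
    · refine Eq.trans ?_ (Algebra.TensorProduct.map_tmul _ _ _ _).symm
      rw [gammaMap_tmul_dp, map_one]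
      rfl
    · refine Eq.trans ?_ (Algebra.TensorProduct.map_tmul _ _ _ _).symm
      rw [gammaMap_tmul_dp, map_one]
      rfl
  exact DFunLike.congr_fun this x

theorem mul_distrib_symm (a b : S ⊗[ZMod 2] Gam (ZMod 2) M) :
    (LinearMap.mul' (ZMod 2) (Gam (ZMod 2) M)).baseChange S
      ((PolyFunctor.distrib S (Gam (ZMod 2) M) (Gam (ZMod 2) M)).symm (a ⊗ₜ b)) = a * b := by
  induction a using TensorProduct.induction_on with
  | zero => rw [TensorProduct.zero_tmul, LinearEquiv.map_zero, LinearMap.map_zero, zero_mul]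
  | add x y hx hy =>
    rw [TensorProduct.add_tmul, LinearEquiv.map_add, LinearMap.map_add, hx, hy, add_mul]
  | tmul s x =>
    induction b using TensorProduct.induction_on with
    | zero => rw [TensorProduct.tmul_zero, LinearEquiv.map_zero, LinearMap.map_zero, mul_zero]
    | add x y hx hy =>
      rw [TensorProduct.tmul_add, LinearEquiv.map_add, LinearMap.map_add, hx, hy, mul_add]
    | tmul t y =>
      rw [PolyFunctor.distrib_symm_tmul, LinearMap.baseChange_tmul, LinearMap.mul'_apply,
        Algebra.TensorProduct.tmul_mul_tmul, mul_comm t s]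

theorem mul_naturality (φ : S ⊗[ZMod 2] M →ₗ[S] S ⊗[ZMod 2] N)
    (x : S ⊗[ZMod 2] (Gam (ZMod 2) M ⊗[ZMod 2] Gam (ZMod 2) M)) :
    (LinearMap.mul' (ZMod 2) (Gam (ZMod 2) N)).baseChange S
      (PolyFunctor.tensorMap (gammaMap φ).toLinearMap (gammaMap φ).toLinearMap x) =
      gammaMap φ ((LinearMap.mul' (ZMod 2) (Gam (ZMod 2) M)).baseChange S x) := by
  obtain ⟨z, rfl⟩ := (PolyFunctor.distrib S (Gam (ZMod 2) M) (Gam (ZMod 2) M)).symm.surjective x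
  induction z using TensorProduct.induction_on with
  | zero => rw [LinearEquiv.map_zero, LinearMap.map_zero, LinearMap.map_zero, LinearMap.map_zero,
      map_zero]
  | add x y hx hy => rw [LinearEquiv.map_add, LinearMap.map_add, LinearMap.map_add,
      LinearMap.map_add, map_add, hx, hy]
  | tmul a b =>
    have h : PolyFunctor.tensorMap (gammaMap φ).toLinearMap (gammaMap φ).toLinearMap
        ((PolyFunctor.distrib S _ _).symm (a ⊗ₜ b)) =
        (PolyFunctor.distrib S _ _).symm (gammaMap φ a ⊗ₜ gammaMap φ b) := by
      rw [LinearEquiv.eq_symm_apply, PolyFunctor.distrib_tensorMap,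
        LinearEquiv.apply_symm_apply, TensorProduct.map_tmul]
      rfl
    rw [h, mul_distrib_symm, mul_distrib_symm, map_mul]

end GammaNaturality

section ProjNaturality

variable {M N : Type*} [AddCommGroup M] [Module (ZMod 2) M] [AddCommGroup N]
  [Module (ZMod 2) N] {S : Type*} [CommRing S] [Algebra (ZMod 2) S]

variable (M) in
/-- The projection of `Γ(M)` onto `Γⁿ(M)`, as an endomorphism of `Γ(M)`. -/
def gamEnd (n : ℕ) : Gam (ZMod 2) M →ₗ[ZMod 2] Gam (ZMod 2) M :=
  (gamPiece (ZMod 2) M n).subtype ∘ₗ gamProj (ZMod 2) M n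

theorem gamEnd_apply (n : ℕ) (x : Gam (ZMod 2) M) :
    gamEnd M n x = (degHom (ZMod 2) M x).coeff n := rfl

theorem gamEnd_mem (n : ℕ) (x : Gam (ZMod 2) M) : gamEnd M n x ∈ gamPiece (ZMod 2) M n :=
  (gamProj (ZMod 2) M n x).2

theorem gamEnd_mul (n : ℕ) (x y : Gam (ZMod 2) M) : gamEnd M n (x * y) =
    ∑ p ∈ Finset.HasAntidiagonal.antidiagonal n, gamEnd M p.1 x * gamEnd M p.2 y := by
  simp only [gamEnd_apply, map_mul, Polynomial.coeff_mul]

theorem gamEnd_dp (n i : ℕ) (m : M) :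
    gamEnd M n (dp (ZMod 2) i m) = if i = n then dp (ZMod 2) i m else 0 := by
  rw [gamEnd_apply, degHom_dp, Polynomial.coeff_monomial]

theorem gamEnd_one (n : ℕ) : gamEnd M n 1 = if n = 0 then 1 else 0 := by
  rw [gamEnd_apply, map_one, Polynomial.coeff_one]

theorem gamEnd_baseChange_mul (n : ℕ) (x y : S ⊗[ZMod 2] Gam (ZMod 2) M) :
    (gamEnd M n).baseChange S (x * y) = ∑ p ∈ Finset.HasAntidiagonal.antidiagonal n,
      (gamEnd M p.1).baseChange S x * (gamEnd M p.2).baseChange S y := by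
  induction x using TensorProduct.induction_on with
  | zero => simp
  | add x x' hx hx' => simp only [add_mul, map_add, hx, hx', Finset.sum_add_distrib]
  | tmul s x =>
    induction y using TensorProduct.induction_on with
    | zero => simp
    | add y y' hy hy' => simp only [mul_add, map_add, hy, hy', Finset.sum_add_distrib]
    | tmul t y =>
      simp only [Algebra.TensorProduct.tmul_mul_tmul, LinearMap.baseChange_tmul, gamEnd_mul,
        TensorProduct.tmul_sum]

theorem gamEnd_baseChange_one (n : ℕ) :
    (gamEnd M n).baseChange S 1 = if n = 0 then 1 else 0 := by
  rw [Algebra.TensorProduct.one_def, LinearMap.baseChange_tmul, gamEnd_one]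
  split_ifs
  · rfl
  · rw [TensorProduct.tmul_zero]

theorem gamEnd_extSeries (n i : ℕ) (x : S ⊗[ZMod 2] M) :
    (gamEnd M n).baseChange S (PowerSeries.coeff i (extSeries S x)) =
      if i = n then PowerSeries.coeff i (extSeries S x) else 0 := by
  induction x using TensorProduct.induction_on generalizing n i with
  | zero =>
    rw [extSeries_zero, PowerSeries.coeff_one]
    by_cases hi : i = 0
    · subst hi
      rw [if_pos rfl, gamEnd_baseChange_one]
      simp only [eq_comm]
    · rw [if_neg hi, map_zero, ite_self]
  | tmul s m =>
    rw [extSeries_tmul, coeff_extSeriesAux, LinearMap.baseChange_tmul, gamEnd_dp]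
    split_ifs
    · rfl
    · rw [TensorProduct.tmul_zero]
  | add x y hx hy =>
    rw [extSeries_add, PowerSeries.coeff_mul, map_sum]
    simp only [gamEnd_baseChange_mul, hx, hy]
    split_ifs with h
    · subst h
      refine Finset.sum_congr rfl fun p hp => ?_
      rw [Finset.sum_eq_single p]
      · rw [if_pos rfl, if_pos rfl]
      · intro q _ hq
        by_cases h1 : p.1 = q.1
        · rw [if_neg (fun h2 : p.2 = q.2 => hq (Prod.ext h1.symm h2.symm)), mul_zero]
        · rw [if_neg h1, zero_mul]
      · exact fun h => absurd hp h
    · refine Finset.sum_eq_zero fun p hp => Finset.sum_eq_zero fun q hq => ?_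
      have hp := Finset.HasAntidiagonal.mem_antidiagonal.mp hp
      have hq := Finset.HasAntidiagonal.mem_antidiagonal.mp hq
      by_cases h1 : p.1 = q.1
      · rw [if_neg (fun h2 : p.2 = q.2 => h (by omega)), mul_zero]
      · rw [if_neg h1, zero_mul]

theorem gamEnd_naturality (n : ℕ) (φ : S ⊗[ZMod 2] M →ₗ[S] S ⊗[ZMod 2] N)
    (x : S ⊗[ZMod 2] Gam (ZMod 2) M) :
    (gamEnd N n).baseChange S (gammaMap φ x) = gammaMap φ ((gamEnd M n).baseChange S x) := by
  have : (gamEnd N n).baseChange S ∘ₗ (gammaMap φ).toLinearMap =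
      (gammaMap φ).toLinearMap ∘ₗ (gamEnd M n).baseChange S := by
    refine linearMap_ext fun x => ?_
    simp only [LinearMap.comp_apply, AlgHom.toLinearMap_apply]
    induction x using Gam.induction_on generalizing n with
    | C a =>
      have h : (1 : S) ⊗ₜ[ZMod 2] algebraMap (ZMod 2) (Gam (ZMod 2) M) a =
          algebraMap (ZMod 2) S a • 1 := by
        rw [Algebra.algebraMap_eq_smul_one, TensorProduct.tmul_smul, algebraMap_smul]
        rfl
      rw [h, map_smul, map_smul, map_smul, map_smul, map_one, gamEnd_baseChange_one,
        gamEnd_baseChange_one]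
      split_ifs
      · rw [map_one]
      · rw [map_zero]
    | add x y hx hy => simp only [TensorProduct.tmul_add, map_add, hx, hy]
    | dp x i m hx =>
      have : (1 : S) ⊗ₜ[ZMod 2] (x * dp (ZMod 2) i m) = (1 ⊗ₜ x) * (1 ⊗ₜ dp (ZMod 2) i m) := by
        rw [Algebra.TensorProduct.tmul_mul_tmul, one_mul]
      rw [this, map_mul, gamEnd_baseChange_mul, gamEnd_baseChange_mul, map_sum]
      refine Finset.sum_congr rfl fun p _ => ?_
      rw [hx, map_mul]
      congr 1
      rw [gammaMap_tmul_dp, gamEnd_extSeries, LinearMap.baseChange_tmul, gamEnd_dp]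
      split_ifs
      · rw [gammaMap_tmul_dp]
      · rw [TensorProduct.tmul_zero, map_zero]
  exact LinearMap.congr_fun this x

end ProjNaturality

section Functoriality

variable {k : Type*} [CommRing k] {M N : Type*} [AddCommGroup M] [Module k M] [AddCommGroup N]
  [Module k N]

/-- The morphism of algebras `Γ(f) : Γ(M) → Γ(N)`, `γₙ(m) ↦ γₙ(f m)`. -/
def gamFunc (f : M →ₗ[k] N) : Gam k M →ₐ[k] Gam k N :=
  liftExp (fun m => dpSeries k (f m)) (fun _ => isExp_dpSeries _)
    (fun m m' => by rw [map_add, dpSeries_add]) (fun r m => by rw [map_smul, dpSeries_smul])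

theorem gamFunc_dp (f : M →ₗ[k] N) (n : ℕ) (m : M) :
    gamFunc f (dp k n m) = dp k n (f m) := by
  rw [gamFunc, liftExp_dp, dpSeries, PowerSeries.coeff_mk]

theorem gamFunc_baseChange {S : Type*} [CommRing S] [Algebra k S] (f : M →ₗ[k] N)
    (x : S ⊗[k] Gam k M) :
    (gamFunc f).toLinearMap.baseChange S x = gammaMap (f.baseChange S) x := by
  have : Algebra.TensorProduct.map (AlgHom.id S S) (gamFunc f) = gammaMap (f.baseChange S) := by
    refine baseChange_gamma_ext fun n m => ?_
    rw [Algebra.TensorProduct.map_tmul, gamFunc_dp, gammaMap_tmul_dp, LinearMap.baseChange_tmul,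
      extSeries_tmul, coeff_extSeriesAux, one_pow]
    rfl
  exact DFunLike.congr_fun this x

end Functoriality

section TensorLemmas

variable {M N P M' N' P' S : Type*} [AddCommGroup M] [Module (ZMod 2) M]
    [AddCommGroup N] [Module (ZMod 2) N] [AddCommGroup P] [Module (ZMod 2) P]
    [AddCommGroup M'] [Module (ZMod 2) M']
    [AddCommGroup N'] [Module (ZMod 2) N'] [AddCommGroup P'] [Module (ZMod 2) P'] [CommRing S]
    [Algebra (ZMod 2) S]

open PolyFunctor

theorem assoc_distrib_symm (a : S ⊗[ZMod 2] M) (b : S ⊗[ZMod 2] N) (c : S ⊗[ZMod 2] P) :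
    (TensorProduct.assoc (ZMod 2) M N P).toLinearMap.baseChange S
      ((distrib S _ _).symm ((distrib S _ _).symm (a ⊗ₜ b) ⊗ₜ c)) =
      (distrib S _ _).symm (a ⊗ₜ (distrib S _ _).symm (b ⊗ₜ c)) := by
  induction a using TensorProduct.induction_on with
  | zero => simp only [TensorProduct.zero_tmul, LinearEquiv.map_zero, LinearMap.map_zero]
  | add x y hx hy =>
    simp only [TensorProduct.add_tmul, LinearEquiv.map_add, LinearMap.map_add, hx, hy]
  | tmul r m =>
    induction b using TensorProduct.induction_on with
    | zero => simp only [TensorProduct.zero_tmul, TensorProduct.tmul_zero, LinearEquiv.map_zero,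
        LinearMap.map_zero]
    | add x y hx hy => simp only [TensorProduct.add_tmul, TensorProduct.tmul_add,
        LinearEquiv.map_add, LinearMap.map_add, hx, hy]
    | tmul s n =>
      induction c using TensorProduct.induction_on with
      | zero => simp only [TensorProduct.tmul_zero, LinearEquiv.map_zero, LinearMap.map_zero]
      | add x y hx hy => simp only [TensorProduct.tmul_add,
          LinearEquiv.map_add, LinearMap.map_add, hx, hy]
      | tmul t p =>
        rw [distrib_symm_tmul, distrib_symm_tmul, distrib_symm_tmul, distrib_symm_tmul,
          LinearMap.baseChange_tmul, mul_assoc]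
        rfl

theorem tensorMap_distrib_symm
    (φ : S ⊗[ZMod 2] M →ₗ[S] S ⊗[ZMod 2] M') (ψ : S ⊗[ZMod 2] N →ₗ[S] S ⊗[ZMod 2] N')
    (a : S ⊗[ZMod 2] M) (b : S ⊗[ZMod 2] N) :
    tensorMap φ ψ ((distrib S M N).symm (a ⊗ₜ b)) = (distrib S M' N').symm (φ a ⊗ₜ ψ b) := by
  rw [LinearEquiv.eq_symm_apply, distrib_tensorMap, LinearEquiv.apply_symm_apply,
    TensorProduct.map_tmul]

theorem assoc_naturality (f : S ⊗[ZMod 2] M →ₗ[S] S ⊗[ZMod 2] M')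
    (g : S ⊗[ZMod 2] N →ₗ[S] S ⊗[ZMod 2] N') (h : S ⊗[ZMod 2] P →ₗ[S] S ⊗[ZMod 2] P')
    (x : S ⊗[ZMod 2] ((M ⊗[ZMod 2] N) ⊗[ZMod 2] P)) :
    (TensorProduct.assoc (ZMod 2) M' N' P').toLinearMap.baseChange S
      (tensorMap (tensorMap f g) h x) =
      tensorMap f (tensorMap g h)
        ((TensorProduct.assoc (ZMod 2) M N P).toLinearMap.baseChange S x) := by
  obtain ⟨z, rfl⟩ := (distrib S (M ⊗[ZMod 2] N) P).symm.surjective x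
  induction z using TensorProduct.induction_on with
  | zero => simp only [LinearEquiv.map_zero, LinearMap.map_zero]
  | add x y hx hy => simp only [LinearEquiv.map_add, LinearMap.map_add, hx, hy]
  | tmul z c =>
    obtain ⟨y, rfl⟩ := (distrib S M N).symm.surjective z
    induction y using TensorProduct.induction_on with
    | zero => simp only [LinearEquiv.map_zero, LinearMap.map_zero, TensorProduct.zero_tmul]
    | add x y hx hy =>
      simp only [LinearEquiv.map_add, LinearMap.map_add, TensorProduct.add_tmul, hx, hy]
    | tmul a b =>
      rw [assoc_distrib_symm, tensorMap_distrib_symm, tensorMap_distrib_symm,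
        tensorMap_distrib_symm, tensorMap_distrib_symm, assoc_distrib_symm]

theorem mul_emb_mem (x : M ⊗[ZMod 2] M) :
    (LinearMap.mul' (ZMod 2) (Gam (ZMod 2) M) ∘ₗ
      TensorProduct.map (emb (ZMod 2) M) (emb (ZMod 2) M)) x ∈ gamPiece (ZMod 2) M 2 := by
  induction x using TensorProduct.induction_on with
  | zero => rw [LinearMap.map_zero]; exact zero_mem _
  | add x y hx hy => rw [LinearMap.map_add]; exact add_mem hx hy
  | tmul a b =>
    have h : ∀ c : M, emb (ZMod 2) M c ∈ gamPiece (ZMod 2) M 1 := fun c => by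
      have := dp_mem_gradedPiece (k := ZMod 2) (w := fun _ : Unit => 1)
        (j := fun _ (m : M) => m) () 1 c
      rwa [smul_eq_mul, mul_one] at this
    have := mul_mem_gradedPiece (h a) (h b)
    rw [LinearMap.comp_apply, TensorProduct.map_tmul, LinearMap.mul'_apply]
    exact this

theorem gamFunc_naturality (f : M →ₗ[ZMod 2] N) (f' : M' →ₗ[ZMod 2] N')
    (φ : S ⊗[ZMod 2] M →ₗ[S] S ⊗[ZMod 2] M') (ψ : S ⊗[ZMod 2] N →ₗ[S] S ⊗[ZMod 2] N')
    (h : ∀ x, f'.baseChange S (φ x) = ψ (f.baseChange S x)) (x : S ⊗[ZMod 2] Gam (ZMod 2) M) :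
    (gamFunc f').toLinearMap.baseChange S (gammaMap φ x) =
      gammaMap ψ ((gamFunc f).toLinearMap.baseChange S x) := by
  rw [gamFunc_baseChange, gamFunc_baseChange, ← AlgHom.comp_apply, ← AlgHom.comp_apply,
    ← gammaMap_comp, ← gammaMap_comp]
  congr 2
  exact LinearMap.ext h

end TensorLemmas

namespace PolyFunctor

/-- The identity functor `I`. -/
abbrev idF : PolyFunctor.{u} where
  obj V := V
  map φ := φ
  map_id _ _ := rfl
  map_comp _ _ := rfl
  map_scalars _ _ _ h y := h y

/-- The Frobenius twist `F^{(r)}`. -/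
abbrev twist (F : PolyFunctor.{u}) (r : ℕ) : PolyFunctor.{u} where
  obj V := F.obj V
  map φ := twistMap r (F.map φ)
  map_id V S _ _ := by rw [F.map_id, twistMap_id]
  map_comp ψ φ := by rw [F.map_comp, twistMap_comp]
  map_scalars σ φ φ' h y := twistMap_scalars r σ _ _ (F.map_scalars σ φ φ' h) y

/-- The functor `V ↦ ⨁_r V^{(r)}`, the sum of all Frobenius twists of the identity. -/
abbrev sumTwist : PolyFunctor.{u} where
  obj V := ℕ →₀ V
  map φ := sumMap φ
  map_id _ _ := sumMap_id
  map_comp ψ φ := sumMap_comp ψ φ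
  map_scalars σ φ φ' h y := sumMap_scalars σ φ φ' h y

/-- The divided power algebra `V ↦ Γ(F(V))`. -/
abbrev gamma (F : PolyFunctor.{u}) : PolyFunctor.{u} where
  obj V := Gam (ZMod 2) (F.obj V)
  map φ := (gammaMap (F.map φ)).toLinearMap
  map_id V S _ _ := by rw [F.map_id, gammaMap_id]; rfl
  map_comp ψ φ := by rw [F.map_comp, gammaMap_comp]; rfl
  map_scalars σ φ φ' h y := gammaMap_baseChange σ _ _ (F.map_scalars σ φ φ' h) y

theorem isStable_gamPiece (F : PolyFunctor.{u}) (n : ℕ) :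
    (gamma F).IsStable fun V => gamPiece (ZMod 2) (F.obj V) n := by
  intro V W S _ _ φ x hx
  refine gradedPiece_stable (w := fun _ : Unit => 1) (gammaMap (F.map φ)) (fun i n v => ?_) hx
  rw [gammaMap_tmul_dp]
  have := extSeries_mem_gradedPiece (w := fun _ : Unit => (1 : ℕ))
    (fun _ => (LinearMap.id : F.obj W →ₗ[ZMod 2] F.obj W)) i n (F.map φ (1 ⊗ₜ v))
  rwa [LinearMap.baseChange_id, LinearMap.id_apply] at this

/-- The divided power `V ↦ Γⁿ(F(V))`. -/
abbrev gammaPow (n : ℕ) (F : PolyFunctor.{u}) : PolyFunctor.{u} :=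
  (gamma F).sub (fun V => gamPiece (ZMod 2) (F.obj V) n) (isStable_gamPiece F n)

/-- The inclusion `Γⁿ ∘ F → Γ ∘ F`. -/
def gammaPowι (n : ℕ) (F : PolyFunctor.{u}) : Hom (gammaPow n F) (gamma F) :=
  (gamma F).subι _ (isStable_gamPiece F n)

/-- The exterior algebra `V ↦ Λ(V)`. -/
abbrev extAlg : PolyFunctor.{u} where
  obj V := ExteriorAlgebra (ZMod 2) V
  map φ := (extMap φ).toLinearMap
  map_id V S _ _ := by rw [extMap_id]; rfl
  map_comp ψ φ := by rw [extMap_comp]; rfl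
  map_scalars σ φ φ' h y := extMap_baseChange σ φ φ' h y

/-- The exterior power `V ↦ Λᵈ(V)`. -/
abbrev Lam (d : ℕ) : PolyFunctor.{u} :=
  extAlg.sub (fun V => ⋀[ZMod 2]^d V) fun φ _ hx => extMap_mem φ d hx

namespace Hom

variable {F G H : PolyFunctor.{u}}

/-- The comultiplication `Γ(F(V)) → Γ(F(V)) ⊗ Γ(F(V))`. -/
def comulΓ (F : PolyFunctor.{u}) : Hom (gamma F) ((gamma F).tensor (gamma F)) where
  app _ := comul.toLinearMap
  naturality φ x := comul_naturality (F.map φ) x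

/-- The multiplication `Γ(F(V)) ⊗ Γ(F(V)) → Γ(F(V))`. -/
def mulΓ (F : PolyFunctor.{u}) : Hom ((gamma F).tensor (gamma F)) (gamma F) where
  app V := LinearMap.mul' (ZMod 2) (Gam (ZMod 2) (F.obj V))
  naturality φ x := mul_naturality (F.map φ) x

/-- The Verschiebung `Γ(F(V)) → F(V)^{(1)}`, extended by zero from `Γ²(F(V))` to `Γ(F(V))`. -/
def verschΓ (F : PolyFunctor.{u}) : Hom (gamma F) (F.twist 1) where
  app _ := versch
  naturality φ x := versch_naturality (F.map φ) x

/-- The inclusion `γ₁ : F(V) → Γ(F(V))`. -/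
def embΓ (F : PolyFunctor.{u}) : Hom F (gamma F) where
  app V := emb (ZMod 2) (F.obj V)
  naturality φ x := emb_naturality (F.map φ) x

/-- The projection onto `Γⁿ(F(V))`, as an endomorphism of `Γ(F(V))`. -/
def endΓ (n : ℕ) (F : PolyFunctor.{u}) : Hom (gamma F) (gamma F) where
  app V := gamEnd (F.obj V) n
  naturality φ x := gamEnd_naturality n (F.map φ) x

/-- The projection `Γ(F(V)) → Γⁿ(F(V))`. -/
def projΓ (n : ℕ) (F : PolyFunctor.{u}) : Hom (gamma F) (gammaPow n F) :=
  (endΓ n F).codRestrict (isStable_gamPiece F n) (fun _ x => gamEnd_mem n x)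

/-- The morphism `Γ(F(V)) → Γ(G(V))` induced by a morphism `F → G`. -/
def mapΓ (f : Hom F G) : Hom (gamma F) (gamma G) where
  app V := (gamFunc (f.app V)).toLinearMap
  naturality φ x := gamFunc_naturality (f.app _) (f.app _) (F.map φ) (G.map φ) (f.naturality φ) x

/-- The morphism `⨁_r V^{(r+1)} → ⨁_r V^{(r)}` that sends the summand `V^{(r+1)}`, the Frobenius
twist of the `r`-th summand, identically to the `(r+1)`-st summand. -/
def shift : Hom (sumTwist.twist 1) sumTwist where
  app V := shiftLin V
  naturality φ x := shiftLin_naturality φ x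

/-- The inclusion of the `r`-th summand into `⨁_r V^{(r)}`. -/
def single (r : ℕ) : Hom (idF.twist r) sumTwist where
  app _ := Finsupp.lsingle r
  naturality φ x := (sumMap_single φ r x).symm

/-- The inclusion of the summand of index zero into `⨁_r V^{(r)}`. -/
def singleZero : Hom idF sumTwist where
  app _ := Finsupp.lsingle 0
  naturality {V W S} _ _ φ x := by
    refine Eq.trans ?_ (sumMap_single φ 0 x).symm
    have : twistMap 0 φ = φ := by
      refine linearMap_ext fun m => ?_
      rw [twistMap_one_tmul]
      exact LinearMap.congr_fun (LinearMap.rTensor_id _ _) _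
    rw [this]

/-- The associativity isomorphism of the tensor product. -/
def assoc (F G H : PolyFunctor.{u}) :
    Hom ((F.tensor G).tensor H) (F.tensor (G.tensor H)) where
  app V := (TensorProduct.assoc (ZMod 2) (F.obj V) (G.obj V) (H.obj V)).toLinearMap
  naturality φ x := assoc_naturality (F.map φ) (G.map φ) (H.map φ) x

/-- The multiplication `F(V) ⊗ F(V) → Γ²(F(V))`, `x ⊗ y ↦ γ₁(x) γ₁(y)`. -/
def mulTwo (F : PolyFunctor.{u}) : Hom (F.tensor F) (gammaPow 2 F) :=
  codRestrict (F := gamma F) ((mulΓ F).comp ((embΓ F).tensor (embΓ F))) (isStable_gamPiece F 2)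
    (fun _ x => mul_emb_mem x)

end Hom

end PolyFunctor

section Bigrading

variable {V : Type*} [AddCommGroup V] [Module (ZMod 2) V]

/-- The weight and the degree of the generators of `Γ(⨁_r V^{(r)})`: the elements of `V^{(r)}` have
weight `2 ^ r` and degree `1`. -/
def bideg (r : ℕ) : ℕ × ℤ := (2 ^ r, 1)

variable (V) in
/-- The component of weight `d` and degree `i` of `Γ(⨁_r V^{(r)})`, spanned by the products
`∏ γ_{n_t}(v_t^{(r_t)})` with `∑ n_t 2 ^ r_t = d` and `∑ n_t = i`, where `v^{(r)}` stands for `v`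
seen in the summand `V^{(r)}`. -/
def bipiece (d : ℕ) (i : ℤ) : Submodule (ZMod 2) (Gam (ZMod 2) (ℕ →₀ V)) :=
  gradedPiece bideg (fun r (v : V) => Finsupp.single r v) (d, i)

theorem skewDiff_mem (a : ℕ × ℤ) (x : Gam (ZMod 2) (ℕ →₀ V))
    (hx : x ∈ gradedPiece (k := ZMod 2) bideg (fun r (v : V) => Finsupp.single r v) a) :
    skewDiff (shiftLin V) x ∈ gradedPiece (k := ZMod 2) bideg
      (fun r (v : V) => Finsupp.single r v) (a + (0, -1)) := by
  induction hx using Submodule.span_induction with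
  | zero => rw [map_zero]; exact zero_mem _
  | add x y _ _ hx hy => rw [map_add]; exact add_mem hx hy
  | smul r x _ hx => rw [map_smul]; exact Submodule.smul_mem _ _ hx
  | mem x hx =>
    obtain ⟨l, rfl, rfl⟩ := hx
    induction l with
    | nil =>
      have h := skewDiff_algebraMap (shiftLin V) 1
      rw [map_one] at h
      simp only [List.map_nil, List.prod_nil]
      rw [h]
      exact zero_mem _
    | cons p l ih =>
      obtain ⟨r, n, v⟩ := p
      simp only [List.map_cons, List.sum_cons, List.prod_cons]
      rw [skewDiff_mul]
      refine add_mem ?_ ?_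
      · rw [add_assoc]
        exact mul_mem_gradedPiece
          (dp_mem_gradedPiece (j := fun r (v : V) => Finsupp.single r v) r n v) ih
      · rw [add_right_comm, skewDiff_dp, shiftLin_single]
        refine mul_mem_gradedPiece ?_ (Submodule.subset_span ⟨l, rfl, rfl⟩)
        split_ifs with h
        · have e : n • bideg r + (0, -1) = (n - 2) • bideg r + 1 • bideg (r + 1) := by
            obtain ⟨m, rfl⟩ := Nat.exists_eq_add_of_le' h
            simp only [bideg, Nat.add_sub_cancel, Prod.smul_mk, Prod.mk_add_mk, smul_eq_mul,
              Prod.mk.injEq, nsmul_eq_mul, mul_one, one_mul, add_zero]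
            constructor
            · ring
            · push_cast; ring
          rw [e]
          exact mul_mem_gradedPiece
            (dp_mem_gradedPiece (j := fun r (v : V) => Finsupp.single r v) r (n - 2) v)
            (dp_mem_gradedPiece (j := fun r (v : V) => Finsupp.single r v) (r + 1) 1 v)
        · exact zero_mem _

theorem skewDiff_mem_bipiece (d : ℕ) (i j : ℤ) (h : j + 1 = i) (x : Gam (ZMod 2) (ℕ →₀ V))
    (hx : x ∈ bipiece V d i) : skewDiff (shiftLin V) x ∈ bipiece V d j := by
  have := skewDiff_mem _ x hx
  have e : ((d, i) : ℕ × ℤ) + (0, -1) = (d, j) := by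
    rw [Prod.mk_add_mk, Prod.mk.injEq]
    constructor
    · rfl
    · omega
  rwa [e] at this

/-- `Γ(⨁_r V^{(r)})` is the tensor product (the coproduct in commutative algebras) of the algebras
`Γ(V^{(r)})`. -/
theorem gamma_sum_universal {B : Type*} [CommRing B] [Algebra (ZMod 2) B]
    (g : ℕ → (Gam (ZMod 2) V →ₐ[ZMod 2] B)) :
    ∃! h : Gam (ZMod 2) (ℕ →₀ V) →ₐ[ZMod 2] B,
      ∀ r, h.comp (gamFunc (Finsupp.lsingle r)) = g r := by
  let ε : (ℕ →₀ V) →+ Additive (B⟦X⟧) := Finsupp.liftAddHom fun r =>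
    { toFun := fun v => Additive.ofMul (PowerSeries.map (g r).toRingHom (dpSeries (ZMod 2) v))
      map_zero' := by
        have : dpSeries (ZMod 2) (0 : V) = 1 := by
          ext n
          rw [dpSeries, PowerSeries.coeff_mk, dp_null, PowerSeries.coeff_one]
        rw [this, map_one]
        rfl
      map_add' := fun v w => by rw [dpSeries_add, map_mul]; rfl }
  have hs : ∀ r v, (ε (Finsupp.single r v)).toMul =
      PowerSeries.map (g r).toRingHom (dpSeries (ZMod 2) v) := fun r v =>
    congrArg Additive.toMul (Finsupp.liftAddHom_apply_single _ r v)
  have he : ∀ x, IsExp (ε x).toMul := by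
    intro x
    induction x using Finsupp.induction_linear with
    | zero => rw [map_zero]; exact isExp_one
    | add x y hx hy => rw [map_add]; exact hx.mul hy
    | single r v => rw [hs]; exact (isExp_dpSeries v).map _
  have hsm : ∀ (a : ZMod 2) x,
      (ε (a • x)).toMul = PowerSeries.rescale (algebraMap (ZMod 2) B a) (ε x).toMul := by
    intro a x
    induction x using Finsupp.induction_linear with
    | zero => rw [smul_zero, map_zero]; exact (map_one _).symm
    | add x y hx hy =>
      rw [smul_add, map_add ε, map_add ε, toMul_add, toMul_add, hx, hy, map_mul]
    | single r v =>
      rw [Finsupp.smul_single, hs, hs, dpSeries_smul]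
      ext n
      rw [PowerSeries.coeff_map, PowerSeries.coeff_rescale, PowerSeries.coeff_rescale,
        PowerSeries.coeff_map, map_mul, map_pow]
      congr 2
      exact (g r).commutes a
  refine ⟨liftExp (fun x => (ε x).toMul) he (fun x y => by rw [map_add, toMul_add]) hsm,
    fun r => ?_, fun h hh => ?_⟩
  · refine Gam.algHom_ext fun n v => ?_
    rw [AlgHom.comp_apply, gamFunc_dp, liftExp_dp, Finsupp.lsingle_apply, hs,
      PowerSeries.coeff_map, dpSeries, PowerSeries.coeff_mk]
    rfl
  · refine Gam.algHom_ext fun n x => ?_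
    rw [liftExp_dp]
    induction x using Finsupp.induction_linear generalizing n with
    | zero =>
      rw [dp_null, map_zero, toMul_zero, PowerSeries.coeff_one]
      split_ifs
      · rw [map_one]
      · rw [map_zero]
    | add x y hx hy =>
      rw [dp_add, map_sum, map_add, toMul_add, PowerSeries.coeff_mul]
      exact Finset.sum_congr rfl fun p _ => by rw [map_mul, hx, hy]
    | single r v =>
      have := DFunLike.congr_fun (hh r) (dp (ZMod 2) n v)
      rw [AlgHom.comp_apply, gamFunc_dp, Finsupp.lsingle_apply] at this
      rw [this, hs, PowerSeries.coeff_map, dpSeries, PowerSeries.coeff_mk]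
      rfl

end Bigrading

open PolyFunctor PolyFunctor.Hom

/-- The skew Koszul algebra `L(V) = Γ(⨁_r V^{(r)}) = ⨂_r Γ(V^{(r)})`. -/
abbrev L : PolyFunctor.{u} := gamma sumTwist

theorem isStable_bipiece (d : ℕ) (i : ℤ) : L.{u}.IsStable fun V => bipiece V d i := by
  intro V W S _ _ φ x hx
  refine gradedPiece_stable (w := bideg) (gammaMap (sumMap φ)) (fun r n v => ?_) hx
  rw [gammaMap_tmul_dp, sumMap_one_tmul]
  exact extSeries_mem_gradedPiece (w := bideg)
    (fun r => (Finsupp.lsingle r : W →ₗ[ZMod 2] ℕ →₀ W)) r n (twistMap r φ (1 ⊗ₜ v))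

/-- The component `L^d_i` of weight `d` and degree `i` of the skew Koszul algebra. -/
abbrev Lpiece (d : ℕ) (i : ℤ) : PolyFunctor.{u} :=
  L.sub (fun V => bipiece V d i) (isStable_bipiece d i)

/-- The inclusion of `L^d_i` into `L`. -/
def Lpieceι (d : ℕ) (i : ℤ) : Hom (Lpiece.{u} d i) L := L.subι _ (isStable_bipiece d i)

/-- The skew Koszul differential on `L`: the composite
`L(V) → L(V) ⊗ L(V) → L(V) ⊗ ⨁_r V^{(r+1)} → L(V)` of the comultiplication, the Verschiebung and
the multiplication. It is the derivation with
`γₙ(v^{(r)}) ↦ γₙ₋₂(v^{(r)}) γ₁(v^{(r+1)})`. -/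
def totalDiff : Hom L.{u} L :=
  (mulΓ sumTwist).comp
    (((Hom.id L).tensor ((embΓ sumTwist).comp (shift.comp (verschΓ sumTwist)))).comp
      (comulΓ sumTwist))

theorem totalDiff_app (V : FGModuleCat.{u} (ZMod 2)) :
    totalDiff.app V = skewDiff (shiftLin V) := rfl

/-- The skew Koszul differential `∂ : L^d_i → L^d_j`, where `i = j + 1`. -/
def diff (d : ℕ) {i j : ℤ} (h : j + 1 = i) : Hom (Lpiece.{u} d i) (Lpiece d j) :=
  (totalDiff.comp (Lpieceι d i)).codRestrict (isStable_bipiece d j)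
    (fun _ x => skewDiff_mem_bipiece d i j h x.1 x.2)

/-- The component `SK^d_i` of the skew Koszul kernel algebra: the kernel of
`∂ : L^d_i → L^d_{i-1}`. -/
abbrev SK (d : ℕ) (i : ℤ) : PolyFunctor.{u} := (diff d (sub_add_cancel i 1)).ker

/-- The inclusion `SK^d_i → L^d_i`. -/
def SKι (d : ℕ) (i : ℤ) : Hom (SK.{u} d i) (Lpiece d i) := (diff d (sub_add_cancel i 1)).kerι

/-- The inclusion `SK^d_i → L`. -/
def SKtoL (d : ℕ) (i : ℤ) : Hom (SK.{u} d i) L := (Lpieceι d i).comp (SKι d i)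

/-- The morphism `Γᵈ(V) → Γᵈ⁻²(V) ⊗ Γ²(V) → Γᵈ⁻²(V) ⊗ V^{(1)}` given by the comultiplication and
the Verschiebung. -/
def fMap (d : ℕ) : Hom (gammaPow.{u} d idF) ((gammaPow (d - 2) idF).tensor (idF.twist 1)) :=
  (((projΓ (d - 2) idF).tensor (verschΓ idF)).comp (comulΓ idF)).comp (gammaPowι d idF)

/-- The morphism `Γᵈ⁻²(V) ⊗ V^{(1)} → Γᵈ⁻⁴(V) ⊗ V^{(1)} ⊗ V^{(1)} → Γᵈ⁻⁴(V) ⊗ Γ²(V^{(1)})` given by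
the comultiplication and the Verschiebung, followed by the multiplication. -/
def gMap (d : ℕ) : Hom ((gammaPow.{u} (d - 2) idF).tensor (idF.twist 1))
    ((gammaPow (d - 4) idF).tensor (gammaPow 2 (idF.twist 1))) :=
  ((Hom.id (gammaPow (d - 4) idF)).tensor (mulTwo (idF.twist 1))).comp
    ((Hom.assoc (gammaPow (d - 4) idF) (idF.twist 1) (idF.twist 1)).comp
      (((((projΓ (d - 4) idF).tensor (verschΓ idF)).comp (comulΓ idF)).comp
        (gammaPowι (d - 2) idF)).tensor (Hom.id (idF.twist 1))))

/-- The canonical morphism `Γⁿ(V) ⊗ V^{(1)} → L(V)`, `x ⊗ w ↦ x · γ₁(w^{(1)})`. -/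
def multL (n : ℕ) : Hom ((gammaPow.{u} n idF).tensor (idF.twist 1)) L :=
  (mulΓ sumTwist).comp (((mapΓ singleZero).comp (gammaPowι n idF)).tensor
    ((embΓ sumTwist).comp (Hom.single 1)))

/-- The element `γ₁(v)` of `L(V)`, for `v` in the summand `V^{(r)}`. -/
def gen (r : ℕ) {V : FGModuleCat.{u} (ZMod 2)} (v : V) : Gam (ZMod 2) (ℕ →₀ V) :=
  dp (ZMod 2) 1 (Finsupp.single r v)

end SkewKoszul

end

open SkewKoszul

noncomputable section

namespace SkewKoszul

/-! ### Contraction of divided powers with a linear form -/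

section Contraction

variable {k : Type*} [CommRing k] {M : Type*} [AddCommGroup M] [Module k M]

/-! Choose a basis of `V`. The divided power monomials in the induced basis of `⨁_r V^{(r)}` form a
basis of `L(V)` (`linearIndependent_mono`). Write `σ` for the shift from `V^{(r)}` to `V^{(r+1)}`.
Modulo 2 the rule `γ₁ γₘ = (m + 1) γₘ₊₁` makes `∂` explicit on this basis: a monomial goes to the
sum, over the variables `q` of exponent at least 2 for which `σ q` has even exponent, of the
monomials in which `γ₂(q)` is traded for `σ q`.

Since `γ₂ₘ₊₁ = γ₂ₘ γ₁` modulo 2, the complex `L(V)` is a tensor product of small complexes, one for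
each variable `q`, with basis `γ₂ₘ(q) (σ q)^ε`, `ε ∈ {0, 1}`, and differential `γ₂ₘ(q) ↦ γ₂ₘ₋₂(q) σ
q`, and of the exterior algebra on the variables of `V^{(0)}`, the only ones that are not shifts.
Each small complex has homology `𝔽₂`, spanned by 1, with contraction `γ₂ₘ(q) σ q ↦ γ₂ₘ₊₂(q)`. Hence
the homology of `L(V)` is `Λ(V)`, concentrated where the degree equals the weight.
`homotopy_formula` carries out the contraction in one chosen small factor of each monomial. It
yields exactness in weight `d` and degree other than `d` (`exists_skewDiff_eq`) and the cycles of
degree `d` (`mem_span_of_skewDiff_eq_zero`). Bases serve only to prove exactness for each `V`; the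
morphisms themselves are natural. This gives (0) and (2).

For (1), the weight minus the degree of `γₙ(v^{(r)})` is `n (2 ^ r - 1)`, so `L^d_d` is `Γᵈ(V)` and
`L^d_{d-1}` is `Γᵈ⁻²(V) ⊗ V^{(1)}` (`prod_dp_mem`). Through the injections `multL` and `multTwo`
into `L(V)`, the morphisms `f` and `g` are restrictions of `∂`, and exactness does the rest
(`exists_SK_lift`, `isCokernel_gammaToSK`).

Uniqueness of `f` and `g` rests on generators: a morphism is determined by its value on one element
whose images under the linear maps over all `S` have coefficients spanning the functor. For `Γᵈ`
this is `γ_d(x)` on a line, where the target of `f` is one-dimensional. For `Γᵈ⁻² ⊗ I^{(1)}` it is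
`γ_{d-2}(x) ⊗ y`. Its value under a morphism is a weight vector for diagonal maps, hence a
combination of two monomials, and one of these is excluded because the source is additive in `y`. -/

theorem isExp_one_add_monomial {B : Type*} [CommRing B] {e : B} (he : e * e = 0) :
    IsExp (1 + PowerSeries.monomial 1 e) := by
  have h : ∀ n, PowerSeries.coeff n (1 + PowerSeries.monomial 1 e) =
      if n = 0 then 1 else if n = 1 then e else 0 := by
    intro n
    rw [map_add, PowerSeries.coeff_one, PowerSeries.coeff_monomial]
    rcases n with _ | _ | n <;> simp
  refine ⟨by rw [h, if_pos rfl], fun m n => ?_⟩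
  rw [h, h, h]
  -- The only equation with content is `a₁ a₁ = 2 a₂`; as `a₂ = 0`, it is the hypothesis on `e`.
  rcases m with _ | _ | m <;> rcases n with _ | _ | n <;> simp [he]
  omega

/-- The algebra morphism `Γ(M) → Γ(M)[ε]`, `γₙ(m) ↦ γₙ(m) + ε l(m) γₙ₋₁(m)`, attached to a linear
form `l`. -/
def contractHom (l : M →ₗ[k] k) : Gam k M →ₐ[k] DualNumber (Gam k M) :=
  liftExp (fun m => PowerSeries.map (TrivSqZeroExt.inlHom (Gam k M) (Gam k M)) (dpSeries k m) *
      (1 + PowerSeries.monomial 1 (TrivSqZeroExt.inr (algebraMap k (Gam k M) (l m)))))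
    (fun m => ((isExp_dpSeries m).map _).mul (isExp_one_add_monomial (TrivSqZeroExt.inr_mul_inr _ _ _)))
    -- The mixed term of `(1 + ε l(m) X) (1 + ε l(m') X)` carries `ε² = 0`, so the second factor
    -- turns sums into products.
    (fun m m' => by
      rw [dpSeries_add, map_mul, mul_mul_mul_comm]
      congr 1
      rw [mul_add, add_mul, add_mul, PowerSeries.monomial_mul_monomial, TrivSqZeroExt.inr_mul_inr]
      simp only [map_add, map_zero, one_mul, mul_one, add_zero, TrivSqZeroExt.inr_add]
      ring)
    (fun r m => by
      rw [map_mul, dpSeries_smul]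
      congr 1
      · ext1 n
        simp only [PowerSeries.coeff_map, PowerSeries.coeff_rescale, map_mul, map_pow]
        rfl
      · rw [map_add, map_one, map_smul, smul_eq_mul, map_mul]
        congr 1
        ext1 n
        rw [PowerSeries.coeff_rescale, PowerSeries.coeff_monomial, PowerSeries.coeff_monomial,
          TrivSqZeroExt.algebraMap_eq_inl']
        split_ifs with h
        · rw [h, pow_one, TrivSqZeroExt.inl_mul_inr, smul_eq_mul]
        · rw [mul_zero])

theorem contractHom_dp (l : M →ₗ[k] k) (n : ℕ) (m : M) :
    contractHom l (dp k n m) = TrivSqZeroExt.inl (dp k n m) +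
      if n = 0 then 0 else TrivSqZeroExt.inr (l m • dp k (n - 1) m) := by
  rw [contractHom, liftExp_dp, mul_add, mul_one, map_add, PowerSeries.coeff_map, dpSeries,
    PowerSeries.coeff_mk]
  congr 1
  rcases n with _ | n
  · simp [PowerSeries.coeff_mul, PowerSeries.coeff_monomial]
  · rw [PowerSeries.coeff_mul, Finset.sum_eq_single (n, 1)]
    · rw [PowerSeries.coeff_monomial, if_pos rfl, if_neg n.succ_ne_zero, PowerSeries.coeff_map,
        PowerSeries.coeff_mk]
      refine (TrivSqZeroExt.inl_mul_inr _ _).trans ?_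
      rw [smul_eq_mul, Algebra.smul_def, mul_comm]
      rfl
    · rintro ⟨a, b⟩ hab hne
      have := Finset.HasAntidiagonal.mem_antidiagonal.mp hab
      rw [PowerSeries.coeff_monomial, if_neg, mul_zero]
      rintro rfl
      exact hne (by simp only at this; rw [Prod.mk.injEq]; omega)
    · exact fun h => absurd (Finset.HasAntidiagonal.mem_antidiagonal.mpr rfl :
        (n, 1) ∈ Finset.HasAntidiagonal.antidiagonal (n + 1)) h

/-- The contraction with a linear form `l`: the derivation of `Γ(M)` with
`γₙ(m) ↦ l(m) γₙ₋₁(m)`. -/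
def contract (l : M →ₗ[k] k) : Gam k M →ₗ[k] Gam k M :=
  (TrivSqZeroExt.sndHom (Gam k M) (Gam k M)).restrictScalars k ∘ₗ (contractHom l).toLinearMap

/-- An algebra morphism to the dual numbers that lifts the identity has a derivation as its
`ε`-component; this is what makes `contract l` a derivation. -/
theorem fst_contractHom (l : M →ₗ[k] k) (x : Gam k M) : (contractHom l x).fst = x := by
  have : (TrivSqZeroExt.fstHom k (Gam k M) (Gam k M)).comp (contractHom l) = AlgHom.id k _ := by
    refine Gam.algHom_ext fun n m => ?_
    rw [AlgHom.comp_apply, contractHom_dp]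
    split_ifs <;> simp
  exact DFunLike.congr_fun this x

theorem contract_mul (l : M →ₗ[k] k) (x y : Gam k M) :
    contract l (x * y) = x * contract l y + contract l x * y := by
  change (contractHom l (x * y)).snd = x * (contractHom l y).snd + (contractHom l x).snd * y
  rw [map_mul, TrivSqZeroExt.snd_mul, fst_contractHom, fst_contractHom]
  simp [mul_comm]

theorem contract_dp_zero (l : M →ₗ[k] k) (m : M) : contract l (dp k 0 m) = 0 := by
  change (contractHom l _).snd = _
  rw [contractHom_dp]
  simp

theorem contract_dp_succ (l : M →ₗ[k] k) (n : ℕ) (m : M) :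
    contract l (dp k (n + 1) m) = l m • dp k n m := by
  change (contractHom l _).snd = _
  rw [contractHom_dp]
  simp

theorem contract_one (l : M →ₗ[k] k) : contract l (1 : Gam k M) = 0 := by
  rw [← dp_zero (0 : M), contract_dp_zero]

theorem contract_dp_eq_zero (l : M →ₗ[k] k) (n : ℕ) {m : M} (h : l m = 0) :
    contract l (dp k n m) = 0 := by
  rcases n with _ | n
  · exact contract_dp_zero l m
  · rw [contract_dp_succ, h, zero_smul]

end Contraction

/-! ### The monomial basis of the divided power algebra -/

section Monomials

variable {k : Type*} [CommRing k] {M : Type*} [AddCommGroup M] [Module k M] {I : Type*}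

variable (k) in
/-- The divided power monomial `∏ γ_{n i}(v i)`. -/
def mono (v : I → M) (n : I →₀ ℕ) : Gam k M := n.prod fun i a => dp k a (v i)

theorem mono_eq_prod (v : I → M) (n : I →₀ ℕ) (s : Finset I) (hs : n.support ⊆ s) :
    mono k v n = ∏ i ∈ s, dp k (n i) (v i) :=
  Finsupp.prod_of_support_subset n hs _ fun i _ => dp_zero (v i)

theorem mono_zero (v : I → M) : mono k v 0 = 1 := Finsupp.prod_zero_index

theorem mono_single (v : I → M) (i : I) (a : ℕ) :
    mono k v (Finsupp.single i a) = dp k a (v i) := Finsupp.prod_single_index (dp_zero _)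

/-- Split off the factor of index `i` from a monomial. -/
theorem mono_eq_dp_mul_erase (v : I → M) (n : I →₀ ℕ) (i : I) :
    mono k v n = dp k (n i) (v i) * mono k v (n.erase i) :=
  (Finsupp.mul_prod_erase' n i _ fun i => dp_zero (v i)).symm

theorem dp_mul_mono (v : I → M) (n : I →₀ ℕ) (i : I) (a : ℕ) :
    dp k a (v i) * mono k v n = (a + n i).choose a • mono k v (n + Finsupp.single i a) := by
  classical
  rw [mono_eq_dp_mul_erase v n i, ← mul_assoc, dp_mul,
    mono_eq_dp_mul_erase v (n + Finsupp.single i a) i, smul_mul_assoc]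
  have h : (n + Finsupp.single i a).erase i = n.erase i := by
    ext j
    by_cases h : j = i
    · rw [h, Finsupp.erase_same, Finsupp.erase_same]
    · simp [Finsupp.erase_ne h]
  rw [h, Finsupp.add_apply, Finsupp.single_eq_same, add_comm (n i)]

theorem span_mono {v : I → M} (hv : Submodule.span k (Set.range v) = ⊤) :
    Submodule.span k (Set.range (mono k v)) = ⊤ :=
  DividedPowerAlgebra.submodule_span_prod_dp_eq_top hv

theorem contract_mono_eq_zero (v : I → M) (l : M →ₗ[k] k) (n : I →₀ ℕ)
    (h : ∀ i ∈ n.support, l (v i) = 0) : contract l (mono k v n) = 0 := by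
  classical
  rw [mono, Finsupp.prod]
  refine Finset.prod_induction _ (fun x => contract l x = 0) (fun x y hx hy => ?_)
    (contract_one l) fun i hi => contract_dp_eq_zero l _ (h i hi)
  rw [contract_mul, hx, hy, mul_zero, zero_mul, add_zero]

/-- The factors of index other than `i` are constants for this derivation. On divided powers a
contraction produces no multiplicities, so it is a pure shift of exponents in any characteristic. -/
theorem contract_mono (b : Module.Basis I k M) (n : I →₀ ℕ) (i : I) :
    contract (b.coord i) (mono k b n) =
      if n i = 0 then 0 else mono k b (n - Finsupp.single i 1) := by
  classical
  have h0 : contract (b.coord i) (mono k b (n.erase i)) = 0 := by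
    refine contract_mono_eq_zero _ _ _ fun j hj => ?_
    rw [Finsupp.support_erase, Finset.mem_erase] at hj
    rw [Module.Basis.coord_apply, Module.Basis.repr_self, Finsupp.single_eq_of_ne hj.1.symm]
  rw [mono_eq_dp_mul_erase, contract_mul, h0, mul_zero, zero_add]
  split_ifs with h
  · rw [h, contract_dp_zero, zero_mul]
  · obtain ⟨a, ha⟩ := Nat.exists_eq_succ_of_ne_zero h
    rw [ha, Nat.succ_eq_add_one, contract_dp_succ, Module.Basis.coord_apply,
      Module.Basis.repr_self, Finsupp.single_eq_same, one_smul,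
      mono_eq_dp_mul_erase b (n - Finsupp.single i 1) i]
    congr 2
    · simp [ha]
    · ext j
      by_cases h : j = i
      · simp [h]
      · simp [Finsupp.erase_ne h, Finsupp.single_eq_of_ne h]

open Classical in
theorem counit_mono (v : I → M) (n : I →₀ ℕ) :
    counit (mono k v n) = if n = 0 then 1 else 0 := by
  split_ifs with h
  · rw [h, mono_zero, map_one]
  · obtain ⟨i, hi⟩ := Finsupp.ne_iff.mp h
    rw [Finsupp.zero_apply] at hi
    rw [mono_eq_dp_mul_erase v n i, map_mul, counit_dp, if_neg hi, zero_mul]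

/-- The coefficients of a relation vanish by induction on the degree of the exponent. The counit
sees only the constant monomial. If `n i ≠ 0`, contraction with the `i`-th coordinate form kills the
monomials without `b i` and lowers the others injectively, so it produces a relation in which the
coefficient of `n` appears at an exponent of smaller degree. -/
theorem linearIndependent_mono (b : Module.Basis I k M) : LinearIndependent k (mono k b) := by
  classical
  rw [linearIndependent_iff]
  suffices h : ∀ (N : ℕ) (n : I →₀ ℕ), n.degree = N → ∀ f : (I →₀ ℕ) →₀ k,
      Finsupp.linearCombination k (mono k b) f = 0 → f n = 0 from
    fun f hf => Finsupp.ext fun n => h _ n rfl f hf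
  intro N
  induction N with
  | zero =>
    intro n hn f hf
    rw [Finsupp.degree_eq_zero_iff] at hn
    subst hn
    have h : counit.toLinearMap ∘ₗ Finsupp.linearCombination k (mono k b) =
        Finsupp.lapply 0 := by
      ext n
      simp [counit_mono, Finsupp.single_apply]
    have := LinearMap.congr_fun h f
    rw [LinearMap.comp_apply, hf, map_zero] at this
    exact this.symm
  | succ N ih =>
    intro n hn f hf
    obtain ⟨i, hi⟩ : ∃ i, n i ≠ 0 := by
      by_contra! h
      have : n = 0 := Finsupp.ext h
      simp [this] at hn
    have hinj : Function.Injective fun n : I →₀ ℕ => n + Finsupp.single i 1 :=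
      add_left_injective _
    have hn' : n - Finsupp.single i 1 + Finsupp.single i 1 = n :=
      tsub_add_cancel_of_le (by
        rw [Finsupp.single_le_iff]; omega)
    have := ih (n - Finsupp.single i 1) (by
      have := congrArg Finsupp.degree hn'
      rw [map_add, Finsupp.degree_single] at this
      omega) (f.comapDomain _ hinj.injOn) ?_
    · rwa [Finsupp.comapDomain_apply, hn'] at this
    -- On coefficients, the contraction is the pullback along `n ↦ n + single i 1`.
    · have h : contract (b.coord i) ∘ₗ Finsupp.linearCombination k (mono k b) =
          Finsupp.linearCombination k (mono k b) ∘ₗ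
            Finsupp.lcomapDomain (fun n : I →₀ ℕ => n + Finsupp.single i 1) hinj := by
        ext m
        simp only [LinearMap.comp_apply, Finsupp.lsingle_apply,
          Finsupp.linearCombination_single, one_smul, contract_mono]
        change _ = Finsupp.linearCombination k (mono k b) (Finsupp.comapDomain _ _ _)
        -- If `b i` does not occur in `m`, then `m` is not of the form `n + single i 1`, and the
        -- pullback is zero.
        split_ifs with hm
        · rw [eq_comm]
          convert map_zero (Finsupp.linearCombination k (mono k b))
          ext n
          rw [Finsupp.comapDomain_apply, Finsupp.single_eq_of_ne]
          · rfl
          · intro h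
            rw [← h] at hm
            simp at hm
        · have hm' : m - Finsupp.single i 1 + Finsupp.single i 1 = m :=
            tsub_add_cancel_of_le (by rw [Finsupp.single_le_iff]; omega)
          have := Finsupp.comapDomain_single (f := fun n : I →₀ ℕ => n + Finsupp.single i 1)
            (m - Finsupp.single i 1) (1 : k) hinj.injOn
          simp only [hm'] at this
          rw [this, Finsupp.linearCombination_single, one_smul]
      have := LinearMap.congr_fun h f
      rw [LinearMap.comp_apply, hf, map_zero] at this
      exact this.symm

/-- The basis of `Γ(M)` by the divided power monomials in the elements of a basis of `M`. -/
def monoBasis (b : Module.Basis I k M) : Module.Basis (I →₀ ℕ) k (Gam k M) :=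
  Module.Basis.mk (linearIndependent_mono b) (span_mono b.span_eq).ge

theorem monoBasis_apply (b : Module.Basis I k M) (n : I →₀ ℕ) :
    monoBasis b n = mono k b n := Module.Basis.mk_apply _ _ _

end Monomials

/-! ### The differential and a contracting homotopy on monomials -/

section Homotopy

open Classical

variable {I : Type*} (σ : I → I)

/-- The exponent obtained from `n` by replacing `γ₂(q)` by `σ q`. -/
def move (n : I →₀ ℕ) (q : I) : I →₀ ℕ := n - Finsupp.single q 2 + Finsupp.single (σ q) 1

/-- The exponent obtained from `n` by replacing `σ p` by `γ₂(p)`. -/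
def back (n : I →₀ ℕ) (p : I) : I →₀ ℕ := n + Finsupp.single p 2 - Finsupp.single (σ p) 1

/-- The indices `q` for which the factor in the variables `q` and `σ q` of the monomial of
exponent `n`, of the form `γ_{2m}(q) (σ q)^ε`, is not `1`. -/
def activeSet (n : I →₀ ℕ) : Set I := {q | 2 ≤ n q ∨ ¬ Even (n (σ q))}

variable {σ}

theorem move_apply (n : I →₀ ℕ) (q j : I) :
    move σ n q j = n j - (if j = q then 2 else 0) + (if j = σ q then 1 else 0) := by
  simp [move, Finsupp.single_apply, eq_comm]

theorem back_apply (n : I →₀ ℕ) (p j : I) :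
    back σ n p j = n j + (if j = p then 2 else 0) - (if j = σ p then 1 else 0) := by
  simp [back, Finsupp.single_apply, eq_comm]

/-- The index `q` is active before the move, and after it because `σ q` has acquired an odd
exponent. The exponent of `σ q` itself passes from an even number to the next odd one, which does
not change whether it is at least 2. The exponent of `q` drops by 2, which does not change its
parity. Thus any choice that depends only on the active set is constant along the differential. -/
theorem activeSet_move (hσ : Function.Injective σ) (hσ' : ∀ i, σ i ≠ i)
    {n : I →₀ ℕ} {q : I} (h2 : 2 ≤ n q) (he : Even (n (σ q))) :
    activeSet σ (move σ n q) = activeSet σ n := by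
  ext j
  simp only [activeSet, Set.mem_ofPred_eq, move_apply, hσ.eq_iff]
  have := hσ' q
  have := hσ' j
  by_cases h1 : j = q
  · subst h1
    grind
  · by_cases h3 : j = σ q
    · subst h3
      grind
    · grind

/-- Both operations are translations of the exponent as long as no subtraction truncates; `2 ≤ n q`
and the oddness of `n (σ p)` ensure this. -/
theorem back_move (hσ : Function.Injective σ) (hσ' : ∀ i, σ i ≠ i)
    {n : I →₀ ℕ} {p q : I} (hpq : q ≠ p) (_ : 2 ≤ n q) (_ : Even (n (σ q)))
    (_ : ¬ Even (n (σ p))) : back σ (move σ n q) p = move σ (back σ n p) q := by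
  ext j
  simp only [back_apply, move_apply]
  have := hσ' q
  have := hσ' p
  have := hσ.ne hpq
  grind

theorem back_move_self (hσ' : ∀ i, σ i ≠ i) {n : I →₀ ℕ} {p : I} (h2 : 2 ≤ n p) :
    back σ (move σ n p) p = n := by
  ext j
  simp only [back_apply, move_apply]
  have := hσ' p
  grind

theorem move_back_self (hσ' : ∀ i, σ i ≠ i) {n : I →₀ ℕ} {p : I} (ho : ¬ Even (n (σ p))) :
    move σ (back σ n p) p = n := by
  ext j
  simp only [back_apply, move_apply]
  have := hσ' p
  grind

variable {M : Type*} [AddCommGroup M] [Module (ZMod 2) M] (b : Module.Basis I (ZMod 2) M)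

theorem nsmul_eq_ite_even (m : ℕ) (x : Gam (ZMod 2) M) : (1 + m) • x = if Even m then x else 0 := by
  rw [← Nat.cast_smul_eq_nsmul (ZMod 2)]
  split_ifs with h
  · have : ((1 + m : ℕ) : ZMod 2) = 1 := by
      rw [Nat.cast_add, (ZMod.natCast_eq_zero_iff_even).mpr h, Nat.cast_one, add_zero]
    rw [this, one_smul]
  · have : ((1 + m : ℕ) : ZMod 2) = 0 := by
      rw [ZMod.natCast_eq_zero_iff_even]; grind
    rw [this, zero_smul]

theorem skewDiff_prod (s : M →ₗ[ZMod 2] M) {J : Type*} (Q : Finset J)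
    (f : J → Gam (ZMod 2) M) :
    skewDiff s (∏ i ∈ Q, f i) = ∑ q ∈ Q, skewDiff s (f q) * ∏ i ∈ Q.erase q, f i := by
  induction Q using Finset.induction_on with
  | empty =>
    have := skewDiff_algebraMap s 1
    rw [map_one] at this
    rw [Finset.prod_empty, Finset.sum_empty, this]
  | insert a Q ha ih =>
    rw [Finset.prod_insert ha, skewDiff_mul, ih, Finset.sum_insert ha, Finset.erase_insert ha,
      add_comm, Finset.mul_sum]
    congr 1
    refine Finset.sum_congr rfl fun q hq => ?_
    have hqa : a ≠ q := by rintro rfl; exact ha hq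
    rw [Finset.erase_insert_of_ne hqa, Finset.prod_insert (by simp [ha])]
    ring

/-- In the Leibniz rule, the term of index `q` multiplies by `γ₁(σ q)` a monomial that already
contains `σ q` with exponent `n (σ q)`. This gives the coefficient `1 + n (σ q)`, which is odd
exactly when `n (σ q)` is even. A set `Q` larger than the support is allowed so that the
differentials of two monomials can be compared term by term. -/
theorem skewDiff_mono {s : M →ₗ[ZMod 2] M} (hs : ∀ i, s (b i) = b (σ i)) (hσ' : ∀ i, σ i ≠ i)
    (n : I →₀ ℕ) (Q : Finset I) (hQ : n.support ⊆ Q) :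
    skewDiff s (mono (ZMod 2) b n) = ∑ q ∈ Q,
      if 2 ≤ n q ∧ Even (n (σ q)) then mono (ZMod 2) b (move σ n q) else 0 := by
  rw [mono_eq_prod b n Q hQ, skewDiff_prod]
  refine Finset.sum_congr rfl fun q hq => ?_
  rw [skewDiff_dp, hs]
  by_cases h2 : 2 ≤ n q
  · have h1 : dp (ZMod 2) (n q - 2) (b q) * ∏ i ∈ Q.erase q, dp (ZMod 2) (n i) (b i) =
        mono (ZMod 2) b (n - Finsupp.single q 2) := by
      rw [mono_eq_prod b (n - Finsupp.single q 2) Q, ← Finset.mul_prod_erase Q _ hq]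
      · congr 1
        · simp
        · refine Finset.prod_congr rfl fun i hi => ?_
          rw [Finsupp.tsub_apply, Finsupp.single_eq_of_ne (Finset.ne_of_mem_erase hi), tsub_zero]
      · exact (Finsupp.support_mono tsub_le_self).trans hQ
    rw [if_pos h2, mul_right_comm, h1, mul_comm, dp_mul_mono, Nat.choose_one_right,
      nsmul_eq_ite_even, Finsupp.tsub_apply, Finsupp.single_eq_of_ne (hσ' q), tsub_zero]
    simp only [h2, true_and]
    rfl
  · rw [if_neg h2, zero_mul, if_neg (fun h => h2 h.1)]

variable (σ) in
/-- The homotopy on monomials: in the first factor `γ_{2m}(p) (σ p)^ε` which is not `1`, for some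
choice of such a factor, it replaces `γ_{2m}(p) (σ p)` by `γ_{2m+2}(p)`. -/
def homotopyFun (n : I →₀ ℕ) : Gam (ZMod 2) M :=
  if h : (activeSet σ n).Nonempty then
    if Even (n (σ h.some)) then 0 else mono (ZMod 2) b (back σ n h.some)
  else 0

variable (σ) in
/-- The contracting homotopy of the skew Koszul complex. -/
def homotopy : Gam (ZMod 2) M →ₗ[ZMod 2] Gam (ZMod 2) M :=
  (monoBasis b).constr (ZMod 2) (homotopyFun σ b)

theorem homotopy_mono (n : I →₀ ℕ) : homotopy σ b (mono (ZMod 2) b n) = homotopyFun σ b n := by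
  rw [homotopy, ← monoBasis_apply, Module.Basis.constr_basis]

theorem homotopyFun_of_some {n : I →₀ ℕ} {p : I} (h : (activeSet σ n).Nonempty) (hp : h.some = p) :
    homotopyFun σ b n = if Even (n (σ p)) then 0 else mono (ZMod 2) b (back σ n p) := by
  rw [homotopyFun, dif_pos h, hp]

/-- In the factor `γ₂ₘ(p) (σ p)^ε` of the chosen index `p`, the differential and the homotopy
exchange `γ₂ₘ(p)` and `γ₂ₘ₋₂(p) σ p`, so one of the two composites is the identity and the other
vanishes. The moves at other indices commute with `back` at `p` and cancel in pairs modulo 2. This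
needs the same `p` for the monomial and for all its moves, which `activeSet_move` provides. -/
theorem homotopy_formula {s : M →ₗ[ZMod 2] M} (hs : ∀ i, s (b i) = b (σ i))
    (hσ : Function.Injective σ) (hσ' : ∀ i, σ i ≠ i) (n : I →₀ ℕ)
    (h : (activeSet σ n).Nonempty) :
    skewDiff s (homotopy σ b (mono (ZMod 2) b n)) + homotopy σ b (skewDiff s (mono (ZMod 2) b n)) =
      mono (ZMod 2) b n := by
  obtain ⟨p, hp⟩ : ∃ p, h.some = p := ⟨_, rfl⟩
  have hpm : 2 ≤ n p ∨ ¬ Even (n (σ p)) := hp ▸ h.some_mem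
  -- This set contains the supports of `n` and of `back σ n p`, so both differentials are sums over
  -- it.
  let Q := n.support ∪ {p} ∪ {σ p}
  have hpQ : p ∈ Q := by simp [Q]
  have hQ : n.support ⊆ Q := fun j hj => by simp only [Q, Finset.mem_union]; tauto
  have hH : ∀ q, 2 ≤ n q → Even (n (σ q)) → homotopyFun σ b (move σ n q) =
      if Even (move σ n q (σ p)) then 0 else mono (ZMod 2) b (back σ (move σ n q) p) := by
    intro q h2 he
    -- `Set.Nonempty.some` depends on the set only, so equal active sets yield the same `p`.
    have e := activeSet_move hσ hσ' h2 he
    refine homotopyFun_of_some b (by rw [e]; exact h) ?_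
    rw [← hp]
    congr 1
  rw [homotopy_mono, homotopyFun_of_some b h hp, skewDiff_mono b hs hσ' n Q hQ, map_sum]
  simp only [apply_ite (homotopy σ b), homotopy_mono, map_zero]
  rw [← Finset.add_sum_erase Q _ hpQ]
  -- Even case: the homotopy kills the monomial, and only the move at `p` makes the exponent of `σ
  -- p` odd, hence survives the homotopy. Odd case: `p` cannot be moved, and each term of index `q ≠
  -- p` occurs once in `∂h` and once in `h∂`.
  by_cases ho : Even (n (σ p))
  · have h2 : 2 ≤ n p := by tauto
    rw [if_pos ho, map_zero, zero_add, if_pos ⟨h2, ho⟩, hH p h2 ho, back_move_self hσ' h2, if_neg,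
      Finset.sum_eq_zero, add_zero]
    · intro q hq
      split_ifs with hc
      · rw [hH q hc.1 hc.2, if_pos]
        rw [move_apply]
        have := hσ.ne (Finset.ne_of_mem_erase hq)
        grind
      · rfl
    · rw [move_apply, if_neg (hσ' p), if_pos rfl]
      grind
  · rw [if_neg ho, if_neg (fun h => ho h.2), zero_add,
      skewDiff_mono b hs hσ' (back σ n p) Q, ← Finset.add_sum_erase Q _ hpQ, if_pos,
      move_back_self hσ' ho, add_assoc, ← Finset.sum_add_distrib, Finset.sum_eq_zero, add_zero]
    · intro q hq
      have hqp := Finset.ne_of_mem_erase hq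
      have hc : (2 ≤ back σ n p q ∧ Even (back σ n p (σ q))) ↔ (2 ≤ n q ∧ Even (n (σ q))) := by
        rw [back_apply, back_apply, if_neg hqp, if_neg (hσ.ne hqp)]
        grind
      simp only [hc]
      split_ifs with hc
      · have : ¬ Even (move σ n q (σ p)) := by
          rw [move_apply]
          have := hσ.ne hqp
          grind
        rw [hH q hc.1 hc.2, if_neg this, back_move hσ hσ' hqp hc.1 hc.2 ho, ← two_smul (ZMod 2)]
        exact zero_smul _ _
      · rw [add_zero]
    · rw [back_apply, back_apply, if_pos rfl, if_neg (hσ' p), if_pos rfl]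
      have := hσ' p
      grind
    · intro j hj
      simp only [Q, Finset.mem_union, Finset.mem_singleton, Finsupp.mem_support_iff] at hj ⊢
      rw [back_apply] at hj
      grind

theorem skewDiff_mono_of_empty {s : M →ₗ[ZMod 2] M} (hs : ∀ i, s (b i) = b (σ i))
    (hσ' : ∀ i, σ i ≠ i) (n : I →₀ ℕ) (h : ¬ (activeSet σ n).Nonempty) :
    skewDiff s (mono (ZMod 2) b n) = 0 := by
  rw [skewDiff_mono b hs hσ' n _ subset_rfl, Finset.sum_eq_zero]
  intro q _
  rw [if_neg]
  exact fun hc => h ⟨q, Or.inl hc.1⟩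

end Homotopy

/-! ### Graded pieces as spans of monomials -/

section GradedMonomials

variable {k : Type*} [CommRing k] {M : Type*} [AddCommGroup M] [Module k M] {I : Type*}

/-- The integer is a product of binomial coefficients; only its existence matters for the grading.
-/
theorem mono_mul_mono (v : I → M) (n m : I →₀ ℕ) :
    ∃ c : ℕ, mono k v n * mono k v m = c • mono k v (n + m) := by
  classical
  induction n using Finsupp.induction generalizing m with
  | zero => exact ⟨1, by rw [mono_zero, one_mul, zero_add, one_smul]⟩
  | single_add i a f hi _ ih =>
    have h : mono k v (Finsupp.single i a + f) = dp k a (v i) * mono k v f := by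
      rw [dp_mul_mono, Finsupp.notMem_support_iff.mp hi, add_zero, Nat.choose_self, one_smul,
        add_comm]
    obtain ⟨c, hc⟩ := ih m
    rw [h, mul_assoc, hc, mul_smul_comm, dp_mul_mono, smul_smul, add_assoc (Finsupp.single i a),
      add_comm (Finsupp.single i a)]
    exact ⟨_, rfl⟩

variable {A : Type*} [AddCommMonoid A]

variable (k) in
/-- The span of the monomials of degree `a`, where the variable of index `i` has degree `w i`. -/
def monoSpan (w : I → A) (v : I → M) (a : A) : Submodule k (Gam k M) :=
  Submodule.span k (mono k v '' {n | Finsupp.linearCombination ℕ w n = a})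

theorem mono_mem_monoSpan {w : I → A} {v : I → M} {a : A} {n : I →₀ ℕ}
    (h : Finsupp.linearCombination ℕ w n = a) : mono k v n ∈ monoSpan k w v a :=
  Submodule.subset_span ⟨n, h, rfl⟩

theorem one_mem_monoSpan {w : I → A} {v : I → M} : (1 : Gam k M) ∈ monoSpan k w v 0 := by
  rw [← mono_zero v]
  exact mono_mem_monoSpan (map_zero _)

theorem mul_mem_monoSpan {w : I → A} {v : I → M} {a b : A} {x y : Gam k M}
    (hx : x ∈ monoSpan k w v a) (hy : y ∈ monoSpan k w v b) : x * y ∈ monoSpan k w v (a + b) := by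
  have h := Submodule.mul_mem_mul hx hy
  rw [monoSpan, monoSpan, Submodule.span_mul_span] at h
  refine Submodule.span_le.mpr ?_ h
  rintro _ ⟨_, ⟨n, rfl, rfl⟩, _, ⟨m, rfl, rfl⟩, rfl⟩
  obtain ⟨c, hc⟩ := mono_mul_mono (k := k) v n m
  change mono k v n * mono k v m ∈ _
  rw [hc, ← Nat.cast_smul_eq_nsmul k]
  exact Submodule.smul_mem _ _ (mono_mem_monoSpan (map_add _ _ _))

variable {ι β V : Type*} [AddCommGroup V] [Module k V]

/-- `gradedPiece` admits divided powers of arbitrary vectors. Expanding `γₙ` of a linear combination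
by the rules for sums and multiples preserves the degree, so the vectors of a spanning family
suffice. When the vectors `j i (e c)` form a basis of `M`, the piece becomes a coordinate subspace
for the monomial basis. -/
theorem gradedPiece_eq_monoSpan (w : ι → A) (j : ι → V →ₗ[k] M) {e : β → V}
    (he : Submodule.span k (Set.range e) = ⊤) (a : A) :
    gradedPiece (k := k) w (fun i => j i) a =
      monoSpan k (fun p : ι × β => w p.1) (fun p => j p.1 (e p.2)) a := by
  classical
  refine le_antisymm (Submodule.span_le.mpr ?_) (Submodule.span_le.mpr ?_)
  · rintro _ ⟨l, rfl, rfl⟩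
    induction l with
    | nil => exact one_mem_monoSpan
    | cons p l ih =>
      obtain ⟨i, n, v⟩ := p
      simp only [List.map_cons, List.sum_cons, List.prod_cons]
      refine mul_mem_monoSpan ?_ ih
      clear ih
      have hv : v ∈ Submodule.span k (Set.range e) := he ▸ Submodule.mem_top
      induction hv using Submodule.span_induction generalizing n with
      | zero =>
        rw [map_zero, dp_null]
        split_ifs with h
        · rw [h, zero_smul]
          exact one_mem_monoSpan
        · exact zero_mem _
      | add x y _ _ hx hy =>
        rw [map_add, dp_add]
        refine sum_mem fun p hp => ?_
        rw [← Finset.HasAntidiagonal.mem_antidiagonal.mp hp, add_smul]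
        exact mul_mem_monoSpan (hx _) (hy _)
      | smul r x _ hx =>
        rw [map_smul, dp_smul]
        exact Submodule.smul_mem _ _ (hx _)
      | mem x hx =>
        obtain ⟨c, rfl⟩ := hx
        have := mono_mem_monoSpan (k := k) (w := fun p : ι × β => w p.1)
          (v := fun p => j p.1 (e p.2)) (n := Finsupp.single (i, c) n) rfl
        rwa [mono_single, Finsupp.linearCombination_single] at this
  · rintro _ ⟨n, rfl, rfl⟩
    rw [SetLike.mem_coe]
    induction n using Finsupp.induction with
    | zero => rw [mono_zero, map_zero]; exact one_mem_gradedPiece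
    | single_add i a f hi _ ih =>
      have h : mono k (fun p : ι × β => j p.1 (e p.2)) (Finsupp.single i a + f) =
          dp k a (j i.1 (e i.2)) * mono k (fun p => j p.1 (e p.2)) f := by
        have := dp_mul_mono (k := k) (fun p : ι × β => j p.1 (e p.2)) f i a
        rw [this, Finsupp.notMem_support_iff.mp hi, add_zero, Nat.choose_self, one_smul,
          add_comm]
      rw [h, map_add, Finsupp.linearCombination_single]
      exact mul_mem_gradedPiece (dp_mem_gradedPiece (j := fun i => j i) i.1 a _) ih

end GradedMonomials

/-! ### Homology of the skew Koszul complex -/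

section Exactness

/-- In characteristic 2 the square of a derivation is a derivation, since the cross terms `∂x ∂y`
appear twice. On `γₙ(m)` it gives a multiple of `γ₁(s m)² = 2 γ₂(s m) = 0`. -/
theorem skewDiff_skewDiff {M : Type*} [AddCommGroup M] [Module (ZMod 2) M] (s : M →ₗ[ZMod 2] M)
    (x : Gam (ZMod 2) M) : skewDiff s (skewDiff s x) = 0 := by
  have h2 : ∀ y : Gam (ZMod 2) M, y + y = 0 := fun y => by
    rw [← two_smul (ZMod 2)]; exact zero_smul _ _
  induction x using Gam.induction_on with
  | C a => rw [skewDiff_algebraMap, map_zero]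
  | add x y hx hy => rw [map_add, map_add, hx, hy, add_zero]
  | dp x n m hx =>
    have hd : skewDiff s (skewDiff s (dp (ZMod 2) n m)) = 0 := by
      rw [skewDiff_dp]
      split_ifs with h
      · rw [skewDiff_mul, skewDiff_dp, skewDiff_dp, if_neg (by omega), mul_zero, zero_add]
        split_ifs
        · rw [mul_assoc, dp_mul]
          rw [← Nat.cast_smul_eq_nsmul (ZMod 2)]
          have : (((1 + 1).choose 1 : ℕ) : ZMod 2) = 0 := rfl
          rw [this, zero_smul, mul_zero]
        · rw [zero_mul]
      · rw [map_zero]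
    rw [skewDiff_mul, map_add, skewDiff_mul, skewDiff_mul, hx, hd, mul_zero, zero_mul, zero_add,
      add_zero, h2]

variable {V : Type*} [AddCommGroup V] [Module (ZMod 2) V] {β : Type*}
  (e : Module.Basis β (ZMod 2) V)

/-- The basis of `⨁_r V^{(r)}` given by a basis of `V`. -/
def sumBasis : Module.Basis (ℕ × β) (ZMod 2) (ℕ →₀ V) :=
  (Finsupp.basis fun _ : ℕ => e).reindex (Equiv.sigmaEquivProd ℕ β)

theorem sumBasis_apply (p : ℕ × β) : sumBasis e p = Finsupp.single p.1 (e p.2) := by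
  rw [sumBasis, Module.Basis.reindex_apply, Finsupp.coe_basis]
  rfl

/-- The shift of the index of the Frobenius twist. -/
def shiftIdx (p : ℕ × β) : ℕ × β := (p.1 + 1, p.2)

theorem shiftIdx_injective : Function.Injective (shiftIdx (β := β)) := by
  rintro ⟨r, j⟩ ⟨r', j'⟩ h
  simpa [shiftIdx] using h

theorem shiftIdx_ne (p : ℕ × β) : shiftIdx p ≠ p := fun h => by
  have := congrArg Prod.fst h
  simp [shiftIdx] at this

theorem shiftLin_sumBasis (p : ℕ × β) : shiftLin V (sumBasis e p) = sumBasis e (shiftIdx p) := by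
  rw [sumBasis_apply, sumBasis_apply, shiftLin_single, shiftIdx]

/-- The weight and the degree of a monomial in the elements of a basis of `⨁_r V^{(r)}`. -/
def bidegree : ((ℕ × β) →₀ ℕ) →ₗ[ℕ] ℕ × ℤ :=
  Finsupp.linearCombination ℕ fun p : ℕ × β => bideg p.1

theorem bipiece_eq (d : ℕ) (i : ℤ) : bipiece V d i =
    Submodule.span (ZMod 2) (mono (ZMod 2) (sumBasis e) '' {n | bidegree n = (d, i)}) := by
  have := gradedPiece_eq_monoSpan (k := ZMod 2) bideg
    (fun r => (Finsupp.lsingle r : V →ₗ[ZMod 2] ℕ →₀ V)) e.span_eq (d, i)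
  refine this.trans ?_
  rw [monoSpan]
  have h : (fun p : ℕ × β => (Finsupp.lsingle p.1 : V →ₗ[ZMod 2] ℕ →₀ V) (e p.2)) = sumBasis e :=
    funext fun p => (sumBasis_apply e p).symm
  rw [h]
  rfl

theorem mono_mem_bipiece {d : ℕ} {i : ℤ} {n : (ℕ × β) →₀ ℕ} (h : bidegree n = (d, i)) :
    mono (ZMod 2) (sumBasis e) n ∈ bipiece V d i := by
  rw [bipiece_eq e]
  exact Submodule.subset_span ⟨n, h, rfl⟩

/-- A variable of `V^{(r)}` has degree 1 and weight `2 ^ r ≥ 1`. -/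
theorem bidegree_snd_le (n : (ℕ × β) →₀ ℕ) : (bidegree n).2 ≤ (bidegree n).1 := by
  induction n using Finsupp.induction_linear with
  | zero => simp
  | add f g hf hg => rw [map_add, Prod.fst_add, Prod.snd_add]; push_cast; omega
  | single p a =>
    rw [bidegree, Finsupp.linearCombination_single]
    have : 0 < 2 ^ p.1 := by positivity
    simp only [bideg, Prod.smul_mk, smul_eq_mul, nsmul_eq_mul, mul_one]
    exact_mod_cast Nat.le_mul_of_pos_right a this

theorem bipiece_eq_bot {d : ℕ} {i : ℤ} (h : d < i) : bipiece V d i = ⊥ := by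
  rw [bipiece_eq (Module.Basis.ofVectorSpace (ZMod 2) V), Submodule.span_eq_bot]
  rintro _ ⟨n, hn, rfl⟩
  have := bidegree_snd_le n
  rw [Set.mem_ofPred_eq] at hn
  rw [hn] at this
  exact absurd this (by simp only; omega)

/-- A variable of `V^{(r+1)}` and `γ₂` of a variable of `V^{(r)}` have the same weight `2 ^ (r +
1)`, but degrees 1 and 2. The comparison is made after adding the removed variable back, which
avoids truncated subtraction. -/
theorem bidegree_back {n : (ℕ × β) →₀ ℕ} {p : ℕ × β} (ho : ¬ Even (n (shiftIdx p))) :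
    bidegree (back shiftIdx n p) = bidegree n + (0, 1) := by
  have h : back shiftIdx n p + Finsupp.single (shiftIdx p) 1 = n + Finsupp.single p 2 := by
    refine tsub_add_cancel_of_le (Finsupp.single_le_iff.mpr ?_)
    rw [Finsupp.add_apply]
    grind
  have h1 := congrArg bidegree h
  rw [map_add, map_add, bidegree, Finsupp.linearCombination_single,
    Finsupp.linearCombination_single] at h1
  have h2 : (2 : ℕ) • bideg p.1 = (0, 1) + (1 : ℕ) • bideg (shiftIdx p).1 := by
    simp only [bideg, shiftIdx, Prod.smul_mk, Prod.mk_add_mk, smul_eq_mul, nsmul_eq_mul]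
    simp only [Prod.mk.injEq]
    constructor
    · ring
    · norm_num
  rw [h2, ← add_assoc] at h1
  exact add_right_cancel h1

/-- A shifted variable of exponent 1 makes its predecessor active by parity, and one of exponent at
least 2 is itself active. So a monomial without active indices involves only `V^{(0)}`. -/
theorem eq_zero_of_activeSet_empty {n : (ℕ × β) →₀ ℕ} (h : ¬ (activeSet shiftIdx n).Nonempty)
    (r : ℕ) (j : β) : n (r + 1, j) = 0 := by
  by_contra hn
  rcases Nat.lt_or_ge (n (r + 1, j)) 2 with h2 | h2
  · refine h ⟨(r, j), Or.inr ?_⟩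
    have : n (r + 1, j) = 1 := by omega
    simp [shiftIdx, this]
  · exact h ⟨(r + 1, j), Or.inl h2⟩

theorem bidegree_of_activeSet_empty {n : (ℕ × β) →₀ ℕ} (h : ¬ (activeSet shiftIdx n).Nonempty) :
    (bidegree n).2 = (bidegree n).1 := by
  rw [bidegree, Finsupp.linearCombination_apply, Finsupp.sum, Prod.snd_sum, Prod.fst_sum,
    Nat.cast_sum]
  refine Finset.sum_congr rfl ?_
  rintro ⟨_ | r, j⟩ hp
  · simp [bideg]
  · rw [Finsupp.mem_support_iff] at hp
    exact absurd (eq_zero_of_activeSet_empty h r j) hp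

theorem homotopy_mem_bipiece {d : ℕ} {i : ℤ} {z : Gam (ZMod 2) (ℕ →₀ V)}
    (hz : z ∈ bipiece V d i) : homotopy shiftIdx (sumBasis e) z ∈ bipiece V d (i + 1) := by
  rw [bipiece_eq e] at hz
  induction hz using Submodule.span_induction with
  | zero => rw [map_zero]; exact zero_mem _
  | add x y _ _ hx hy => rw [map_add]; exact add_mem hx hy
  | smul r x _ hx => rw [map_smul]; exact Submodule.smul_mem _ _ hx
  | mem x hx =>
    obtain ⟨n, hn, rfl⟩ := hx
    rw [homotopy_mono, homotopyFun]
    split_ifs with h ho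
    · exact zero_mem _
    · refine mono_mem_bipiece e ?_
      rw [bidegree_back ho, hn, Prod.mk_add_mk, add_zero]
    · exact zero_mem _

/-- The skew Koszul complex of weight `d` is exact in degrees different from `d`. -/
theorem exists_skewDiff_eq {d : ℕ} {i : ℤ} (hi : i ≠ d) {z : Gam (ZMod 2) (ℕ →₀ V)}
    (hz : z ∈ bipiece V d i) (h0 : skewDiff (shiftLin V) z = 0) :
    ∃ y ∈ bipiece V d (i + 1), skewDiff (shiftLin V) y = z := by
  let e := Module.Basis.ofVectorSpace (ZMod 2) V
  refine ⟨homotopy shiftIdx (sumBasis e) z, homotopy_mem_bipiece e hz, ?_⟩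
  -- A monomial whose degree differs from its weight has an active index, so `∂h + h∂` is the
  -- identity on the whole component.
  have key : skewDiff (shiftLin V) (homotopy shiftIdx (sumBasis e) z) +
      homotopy shiftIdx (sumBasis e) (skewDiff (shiftLin V) z) = z := by
    clear h0
    rw [bipiece_eq e] at hz
    induction hz using Submodule.span_induction with
    | zero => simp
    | add x y _ _ hx hy =>
      conv_rhs => rw [← hx, ← hy]
      simp only [map_add]
      abel
    | smul r x _ hx =>
      conv_rhs => rw [← hx]
      simp only [map_smul, smul_add]
    | mem x hx =>
      obtain ⟨n, hn, rfl⟩ := hx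
      refine homotopy_formula (sumBasis e) (shiftLin_sumBasis e) shiftIdx_injective shiftIdx_ne n ?_
      by_contra h
      have := bidegree_of_activeSet_empty h
      rw [Set.mem_ofPred_eq] at hn
      rw [hn] at this
      exact hi this
  rwa [h0, map_zero, add_zero] at key

/-- The cycles of weight and degree `d` are spanned by the monomials without repeated factors. -/
theorem mem_span_of_skewDiff_eq_zero {d : ℕ} {z : Gam (ZMod 2) (ℕ →₀ V)}
    (hz : z ∈ bipiece V d d) (h0 : skewDiff (shiftLin V) z = 0) :
    z ∈ Submodule.span (ZMod 2) (mono (ZMod 2) (sumBasis e) ''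
      {n | bidegree n = (d, (d : ℤ)) ∧ ¬ (activeSet shiftIdx n).Nonempty}) := by
  -- Here `u` collects the monomials without active index, which are cycles, and `w` those to which
  -- the homotopy formula applies; it remains to see that `w = 0`.
  obtain ⟨u, hu, w, hw, rfl⟩ : ∃ u ∈ Submodule.span (ZMod 2) (mono (ZMod 2) (sumBasis e) ''
      {n | bidegree n = (d, (d : ℤ)) ∧ ¬ (activeSet shiftIdx n).Nonempty}),
      ∃ w ∈ Submodule.span (ZMod 2) (mono (ZMod 2) (sumBasis e) ''
      {n | bidegree n = (d, (d : ℤ)) ∧ (activeSet shiftIdx n).Nonempty}), u + w = z := by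
    rw [← Submodule.mem_sup, ← Submodule.span_union, ← Set.image_union]
    rw [bipiece_eq e] at hz
    refine Submodule.span_mono (Set.image_mono fun n hn => ?_) hz
    by_cases h : (activeSet shiftIdx n).Nonempty
    · exact Or.inr ⟨hn, h⟩
    · exact Or.inl ⟨hn, h⟩
  have hu0 : skewDiff (shiftLin V) u = 0 := by
    clear h0 hz
    induction hu using Submodule.span_induction with
    | zero => exact map_zero _
    | add x y _ _ hx hy => rw [map_add, hx, hy, add_zero]
    | smul r x _ hx => rw [map_smul, hx, smul_zero]
    | mem x hx =>
      obtain ⟨n, hn, rfl⟩ := hx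
      exact skewDiff_mono_of_empty (sumBasis e) (shiftLin_sumBasis e) shiftIdx_ne n hn.2
  rw [map_add, hu0, zero_add] at h0
  have key : homotopy shiftIdx (sumBasis e) (skewDiff (shiftLin V) w) = w := by
    clear h0 hz
    induction hw using Submodule.span_induction with
    | zero => simp
    | add x y _ _ hx hy => simp only [map_add, hx, hy]
    | smul r x _ hx => simp only [map_smul, hx]
    | mem x hx =>
      obtain ⟨n, hn, rfl⟩ := hx
      -- The homotopy lands in degree `d + 1`, above the weight, where the component is zero. Only
      -- `h∂` remains in the homotopy formula, and `∂w = 0` then gives `w = 0`.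
      have h1 := homotopy_mem_bipiece e (mono_mem_bipiece e hn.1)
      rw [bipiece_eq_bot (by omega), Submodule.mem_bot] at h1
      have := homotopy_formula (sumBasis e) (shiftLin_sumBasis e) shiftIdx_injective shiftIdx_ne n
        hn.2
      rwa [h1, map_zero, zero_add] at this
  rw [← key, h0, map_zero, add_zero]
  exact hu

end Exactness

/-! ### The comultiplication followed by the Verschiebung -/

section Polarization

variable {M N : Type*} [AddCommGroup M] [Module (ZMod 2) M] [AddCommGroup N] [Module (ZMod 2) N]

variable (M) in
/-- The map `Γ(M) → Γ(M) ⊗ M` given by the comultiplication and the Verschiebung. -/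
def coversch : Gam (ZMod 2) M →ₗ[ZMod 2] Gam (ZMod 2) M ⊗[ZMod 2] M :=
  versch.lTensor (Gam (ZMod 2) M) ∘ₗ comul.toLinearMap

/-- The Verschiebung is a derivation over the counit (`versch_mul`), so `id ⊗ versch` is a
derivation over `id ⊗ counit`. After the comultiplication, `id ⊗ counit` becomes the identity. -/
theorem coversch_mul (x y : Gam (ZMod 2) M) :
    coversch M (x * y) = x • coversch M y + y • coversch M x := by
  let η := Algebra.TensorProduct.lift (AlgHom.id (ZMod 2) (Gam (ZMod 2) M))
      ((Algebra.ofId (ZMod 2) (Gam (ZMod 2) M)).comp (counit (k := ZMod 2) (M := M)))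
      (fun _ _ => Commute.all _ _)
  have key : ∀ u v : Gam (ZMod 2) M ⊗[ZMod 2] Gam (ZMod 2) M,
      versch.lTensor (Gam (ZMod 2) M) (u * v) =
        η u • versch.lTensor (Gam (ZMod 2) M) v + η v • versch.lTensor (Gam (ZMod 2) M) u := by
    intro u v
    induction u using TensorProduct.induction_on with
    | zero => simp
    | add u u' hu hu' => simp only [add_mul, map_add, hu, hu', add_smul, smul_add]; abel
    | tmul a b =>
      induction v using TensorProduct.induction_on with
      | zero => simp
      | add v v' hv hv' => simp only [mul_add, map_add, hv, hv', add_smul, smul_add]; abel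
      | tmul c d =>
        have hη : ∀ x y : Gam (ZMod 2) M, η (x ⊗ₜ y) = counit y • x := fun x y => by
          rw [Algebra.TensorProduct.lift_tmul, AlgHom.id_apply, AlgHom.comp_apply,
            Algebra.ofId_apply, Algebra.smul_def, mul_comm]
        rw [Algebra.TensorProduct.tmul_mul_tmul, LinearMap.lTensor_tmul, LinearMap.lTensor_tmul,
          LinearMap.lTensor_tmul, versch_mul, hη, hη, TensorProduct.tmul_add,
          TensorProduct.tmul_smul, TensorProduct.tmul_smul, TensorProduct.smul_tmul',
          TensorProduct.smul_tmul', TensorProduct.smul_tmul', TensorProduct.smul_tmul',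
          smul_eq_mul, smul_eq_mul, smul_mul_assoc, smul_mul_assoc, mul_comm c a]
  have h : ∀ z, coversch M z = versch.lTensor (Gam (ZMod 2) M) (comul z) := fun _ => rfl
  rw [h, h, h, map_mul, key]
  congr 2 <;> exact comul_counit _

theorem coversch_dp (n : ℕ) (m : M) : coversch M (dp (ZMod 2) n m) =
    if 2 ≤ n then dp (ZMod 2) (n - 2) m ⊗ₜ m else 0 := by
  change versch.lTensor _ (comul (dp (ZMod 2) n m)) = _
  simp only [comul_dp, map_sum, LinearMap.lTensor_tmul, versch_dp]
  split_ifs with h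
  · rw [Finset.sum_eq_single (n - 2, 2)]
    · simp
    · rintro ⟨a, b⟩ hab hne
      have := Finset.HasAntidiagonal.mem_antidiagonal.mp hab
      rw [if_neg, TensorProduct.tmul_zero]
      rintro rfl
      simp only at this hne
      exact hne (by rw [Prod.mk.injEq]; omega)
    · intro hn
      exact absurd (Finset.HasAntidiagonal.mem_antidiagonal.mpr (Nat.sub_add_cancel h)) hn
  · refine Finset.sum_eq_zero ?_
    rintro ⟨a, b⟩ hab
    have := Finset.HasAntidiagonal.mem_antidiagonal.mp hab
    simp only at this
    rw [if_neg (by omega), TensorProduct.tmul_zero]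

theorem coversch_algebraMap (r : ZMod 2) : coversch M (algebraMap (ZMod 2) _ r) = 0 := by
  have h : coversch M (1 : Gam (ZMod 2) M) = 0 := by
    rw [← dp_zero (k := ZMod 2) (0 : M), coversch_dp, if_neg (by omega)]
  rw [Algebra.algebraMap_eq_smul_one, map_smul, h, smul_zero]

variable (M) in
/-- The image in `Γ(M) ⊗ M` of the `Γᵃ(M) ⊗ M` with `a + 2 = D`. -/
def tensorPiece (D : ℕ) : Submodule (ZMod 2) (Gam (ZMod 2) M ⊗[ZMod 2] M) :=
  Submodule.span (ZMod 2) {t | ∃ a x m, a + 2 = D ∧ x ∈ gamPiece (ZMod 2) M a ∧ t = x ⊗ₜ m}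

theorem dp_mem_gamPiece (n : ℕ) (m : M) : dp (ZMod 2) n m ∈ gamPiece (ZMod 2) M n := by
  have := dp_mem_gradedPiece (k := ZMod 2) (w := fun _ : Unit => 1) (j := fun _ (m : M) => m) () n m
  rwa [smul_eq_mul, mul_one] at this

theorem mul_mem_gamPiece {a b : ℕ} {x y : Gam (ZMod 2) M} (hx : x ∈ gamPiece (ZMod 2) M a)
    (hy : y ∈ gamPiece (ZMod 2) M b) : x * y ∈ gamPiece (ZMod 2) M (a + b) :=
  mul_mem_gradedPiece hx hy

theorem one_mem_gamPiece : (1 : Gam (ZMod 2) M) ∈ gamPiece (ZMod 2) M 0 := one_mem_gradedPiece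

/-- Induction on products of divided powers. -/
theorem gamPiece_induction {P : ℕ → Gam (ZMod 2) M → Prop} (one : P 0 1)
    (zero : ∀ d, P d 0) (add : ∀ d x y, P d x → P d y → P d (x + y))
    (mul : ∀ d n x m, x ∈ gamPiece (ZMod 2) M d → P d x → P (n + d) (dp (ZMod 2) n m * x))
    {d : ℕ} {x : Gam (ZMod 2) M} (hx : x ∈ gamPiece (ZMod 2) M d) : P d x := by
  induction hx using Submodule.span_induction with
  | zero => exact zero d
  | add x y _ _ hx hy => exact add d x y hx hy
  | smul r x _ hx =>
    -- The only scalars are 0 and 1, so no stability of `P` under scalars has to be assumed.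
    obtain rfl | rfl : r = 0 ∨ r = 1 := by revert r; decide
    · rw [zero_smul]; exact zero d
    · rwa [one_smul]
  | mem x hx =>
    obtain ⟨l, rfl, rfl⟩ := hx
    induction l with
    | nil => exact one
    | cons p l ih =>
      simp only [List.map_cons, List.sum_cons, List.prod_cons, smul_eq_mul, mul_one]
      refine mul _ _ _ _ ?_ (by simpa using ih)
      exact Submodule.subset_span ⟨l, by simp, rfl⟩

theorem smul_mem_tensorPiece {n D : ℕ} {x : Gam (ZMod 2) M} (hx : x ∈ gamPiece (ZMod 2) M n)
    {t : Gam (ZMod 2) M ⊗[ZMod 2] M} (ht : t ∈ tensorPiece M D) :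
    x • t ∈ tensorPiece M (n + D) := by
  induction ht using Submodule.span_induction with
  | zero => rw [smul_zero]; exact zero_mem _
  | add t t' _ _ ht ht' => rw [smul_add]; exact add_mem ht ht'
  | smul r t _ ht => rw [smul_comm]; exact Submodule.smul_mem _ _ ht
  | mem t ht =>
    obtain ⟨a, y, m, rfl, hy, rfl⟩ := ht
    rw [TensorProduct.smul_tmul', smul_eq_mul]
    exact Submodule.subset_span ⟨n + a, x * y, m, by omega, mul_mem_gamPiece hx hy, rfl⟩

theorem coversch_mem {d : ℕ} {x : Gam (ZMod 2) M} (hx : x ∈ gamPiece (ZMod 2) M d) :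
    coversch M x ∈ tensorPiece M d := by
  refine gamPiece_induction (P := fun d x => coversch M x ∈ tensorPiece M d) ?_ (fun d => ?_)
    (fun d x y hx hy => ?_) (fun d n x m hxd hx => ?_) hx
  · have := coversch_algebraMap (M := M) 1
    rw [map_one] at this
    rw [this]
    exact zero_mem _
  · rw [map_zero]; exact zero_mem _
  · rw [map_add]; exact add_mem hx hy
  · rw [coversch_mul]
    refine add_mem (smul_mem_tensorPiece (dp_mem_gamPiece n m) hx) ?_
    rw [add_comm]
    refine smul_mem_tensorPiece hxd ?_
    rw [coversch_dp]
    split_ifs with h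
    · exact Submodule.subset_span ⟨n - 2, _, m, by omega, dp_mem_gamPiece _ _, rfl⟩
    · exact zero_mem _

theorem gamProj_of_mem {n : ℕ} {x : Gam (ZMod 2) M} (hx : x ∈ gamPiece (ZMod 2) M n) :
    (gamProj (ZMod 2) M n x : Gam (ZMod 2) M) = x := by
  have : degHom (ZMod 2) M x = Polynomial.monomial n x := by
    refine gamPiece_induction (P := fun d x => degHom (ZMod 2) M x = Polynomial.monomial d x) ?_
      (fun d => ?_) (fun d x y hx hy => ?_) (fun d n x m _ hx => ?_) hx
    · rw [map_one]; rfl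
    · rw [map_zero, map_zero]
    · rw [map_add, map_add, hx, hy]
    · rw [map_mul, degHom_dp, hx, Polynomial.monomial_mul_monomial]
  rw [coe_gamProj, this, Polynomial.coeff_monomial, if_pos rfl]

/-- This lifts an element of `Γ(M) ⊗ M` that lies in the right piece to `Γⁿ(M) ⊗ M`, where the
functor `Γⁿ ⊗ I^{(1)}` takes its values. -/
theorem subtype_gamProj_of_mem {n : ℕ} {t : Gam (ZMod 2) M ⊗[ZMod 2] M}
    (ht : t ∈ tensorPiece M (n + 2)) :
    (gamPiece (ZMod 2) M n).subtype.rTensor M ((gamProj (ZMod 2) M n).rTensor M t) = t := by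
  induction ht using Submodule.span_induction with
  | zero => simp
  | add t t' _ _ ht ht' => simp only [map_add, ht, ht']
  | smul r t _ ht => simp only [map_smul, ht]
  | mem t ht =>
    obtain ⟨a, y, m, ha, hy, rfl⟩ := ht
    obtain rfl : a = n := by omega
    rw [LinearMap.rTensor_tmul, LinearMap.rTensor_tmul, Submodule.subtype_apply,
      gamProj_of_mem hy]

end Polarization

/-! ### The components of degree equal to the weight, and one below it -/

section Pieces

variable {V : Type*} [AddCommGroup V] [Module (ZMod 2) V]

variable (V) in
/-- The inclusion `Γ(V) → Γ(⨁_r V^{(r)})` of the factor of index `r`. -/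
def incl (r : ℕ) : Gam (ZMod 2) V →ₐ[ZMod 2] Gam (ZMod 2) (ℕ →₀ V) := gamFunc (Finsupp.lsingle r)

theorem incl_dp (r n : ℕ) (v : V) :
    incl V r (dp (ZMod 2) n v) = dp (ZMod 2) n (Finsupp.single r v) := gamFunc_dp _ _ _

variable (V) in
/-- The map `Γ(V) ⊗ Γ(V) → Γ(⨁_r V^{(r)})` onto the product of the factors of index `0` and `1`. -/
def inclMul : Gam (ZMod 2) V ⊗[ZMod 2] Gam (ZMod 2) V →ₗ[ZMod 2] Gam (ZMod 2) (ℕ →₀ V) :=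
  LinearMap.mul' (ZMod 2) _ ∘ₗ TensorProduct.map (incl V 0).toLinearMap (incl V 1).toLinearMap

theorem inclMul_tmul (x y : Gam (ZMod 2) V) : inclMul V (x ⊗ₜ y) = incl V 0 x * incl V 1 y := rfl

/-- A left inverse is the comultiplication followed by `Γ` of the projections to the summands of
index 0 and 1. It is an algebra morphism that sends the two copies of `Γ(V)` to the left and right
tensor factors. -/
theorem inclMul_injective : Function.Injective (inclMul V) := by
  let p : Gam (ZMod 2) (ℕ →₀ V) →ₐ[ZMod 2] Gam (ZMod 2) V ⊗[ZMod 2] Gam (ZMod 2) V :=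
    (Algebra.TensorProduct.map (gamFunc (Finsupp.lapply 0)) (gamFunc (Finsupp.lapply 1))).comp comul
  have hdp : ∀ r n (v : V), p (incl V r (dp (ZMod 2) n v)) =
      ∑ q ∈ Finset.HasAntidiagonal.antidiagonal n,
        dp (ZMod 2) q.1 (Finsupp.single r v 0) ⊗ₜ dp (ZMod 2) q.2 (Finsupp.single r v 1) := by
    intro r n v
    rw [incl_dp, AlgHom.comp_apply, comul_dp, map_sum]
    refine Finset.sum_congr rfl fun q _ => ?_
    rw [Algebra.TensorProduct.map_tmul, gamFunc_dp, gamFunc_dp]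
    rfl
  have h0 : p.comp (incl V 0) = Algebra.TensorProduct.includeLeft := by
    refine Gam.algHom_ext fun n v => ?_
    rw [AlgHom.comp_apply, hdp, Finset.sum_eq_single (n, 0)]
    · simp [dp_zero]
    · rintro ⟨a, b⟩ hab hne
      have := Finset.HasAntidiagonal.mem_antidiagonal.mp hab
      rw [Finsupp.single_eq_of_ne (by omega : (1 : ℕ) ≠ 0), dp_null, if_neg,
        TensorProduct.tmul_zero]
      rintro rfl
      exact hne (by simpa using this)
    · exact fun h => absurd (Finset.HasAntidiagonal.mem_antidiagonal.mpr (Nat.add_zero n)) h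
  have h1 : p.comp (incl V 1) = Algebra.TensorProduct.includeRight := by
    refine Gam.algHom_ext fun n v => ?_
    rw [AlgHom.comp_apply, hdp, Finset.sum_eq_single (0, n)]
    · simp [dp_zero]
    · rintro ⟨a, b⟩ hab hne
      have := Finset.HasAntidiagonal.mem_antidiagonal.mp hab
      rw [Finsupp.single_eq_of_ne (by omega : (0 : ℕ) ≠ 1), dp_null, if_neg,
        TensorProduct.zero_tmul]
      rintro rfl
      exact hne (by simpa using this)
    · exact fun h => absurd (Finset.HasAntidiagonal.mem_antidiagonal.mpr (Nat.zero_add n)) h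
  refine Function.LeftInverse.injective (g := p) fun t => ?_
  induction t using TensorProduct.induction_on with
  | zero => rw [map_zero, map_zero]
  | add t t' ht ht' => rw [map_add, map_add, ht, ht']
  | tmul x y =>
    rw [inclMul_tmul, map_mul, ← AlgHom.comp_apply, ← AlgHom.comp_apply, h0, h1]
    simp

theorem incl_injective (r : ℕ) : Function.Injective (incl V r) := by
  refine Function.LeftInverse.injective (g := gamFunc (Finsupp.lapply r)) fun x => ?_
  have : (gamFunc (Finsupp.lapply r)).comp (incl V r) = AlgHom.id (ZMod 2) _ := by
    refine Gam.algHom_ext fun n v => ?_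
    rw [AlgHom.comp_apply, incl_dp, gamFunc_dp]
    simp
  exact DFunLike.congr_fun this x

/-- Contracting `γ₁(m)` with a coordinate form and applying the counit recovers the corresponding
coordinate of `m`. -/
theorem emb_injective (M : Type*) [AddCommGroup M] [Module (ZMod 2) M] :
    Function.Injective (emb (ZMod 2) M) := by
  let b := Module.Basis.ofVectorSpace (ZMod 2) M
  refine (injective_iff_map_eq_zero _).mpr fun m hm => b.ext_elem fun i => ?_
  have := congrArg (fun x => counit (contract (b.coord i) x)) hm
  simp only [emb_apply, map_zero] at this
  rw [contract_dp_succ _ 0, dp_zero, map_smul, map_one, smul_eq_mul, mul_one] at this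
  rw [map_zero]
  exact this

variable (V) in
/-- The map `Γ(V) ⊗ V → Γ(⨁_r V^{(r)})`, `x ⊗ w ↦ x · γ₁(w^{(1)})`. -/
def inclEmb : Gam (ZMod 2) V ⊗[ZMod 2] V →ₗ[ZMod 2] Gam (ZMod 2) (ℕ →₀ V) :=
  inclMul V ∘ₗ (emb (ZMod 2) V).lTensor _

theorem inclEmb_tmul (x : Gam (ZMod 2) V) (w : V) :
    inclEmb V (x ⊗ₜ w) = incl V 0 x * dp (ZMod 2) 1 (Finsupp.single 1 w) := by
  rw [← incl_dp]
  rfl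

theorem inclEmb_smul (x : Gam (ZMod 2) V) (t : Gam (ZMod 2) V ⊗[ZMod 2] V) :
    inclEmb V (x • t) = incl V 0 x * inclEmb V t := by
  induction t using TensorProduct.induction_on with
  | zero => simp
  | add t t' ht ht' => simp only [smul_add, map_add, ht, ht', mul_add]
  | tmul y w =>
    rw [TensorProduct.smul_tmul', inclEmb_tmul, inclEmb_tmul, smul_eq_mul, map_mul, mul_assoc]

theorem inclEmb_injective : Function.Injective (inclEmb V) := by
  rw [inclEmb, LinearMap.coe_comp]
  exact inclMul_injective.comp
    (Module.Flat.lTensor_preserves_injective_linearMap _ (emb_injective V))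

/-- The skew Koszul differential on the factor `Γ(V)`. -/
theorem skewDiff_incl (x : Gam (ZMod 2) V) :
    skewDiff (shiftLin V) (incl V 0 x) = inclEmb V (coversch V x) := by
  induction x using Gam.induction_on with
  | C a => rw [AlgHom.commutes, skewDiff_algebraMap, coversch_algebraMap, map_zero]
  | add x y hx hy => simp only [map_add, hx, hy]
  | dp x n v hx =>
    rw [map_mul, skewDiff_mul, coversch_mul, map_add, inclEmb_smul, inclEmb_smul, hx,
      mul_comm _ (incl V 0 (dp (ZMod 2) n v)), incl_dp, skewDiff_dp, coversch_dp, shiftLin_single]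
    congr 2
    split_ifs
    · rw [inclEmb_tmul, incl_dp]
    · rw [map_zero]

theorem incl_mem_bipiece {d : ℕ} {x : Gam (ZMod 2) V} (hx : x ∈ gamPiece (ZMod 2) V d) :
    incl V 0 x ∈ bipiece V d d := by
  refine gamPiece_induction (P := fun d x => incl V 0 x ∈ bipiece V d d) ?_
      (fun d => ?_) (fun d x y hx hy => ?_) (fun d n x m _ hx => ?_) hx
  · rw [map_one]; exact one_mem_gradedPiece
  · rw [map_zero]; exact zero_mem _
  · rw [map_add]; exact add_mem hx hy
  · rw [map_mul, incl_dp]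
    have h1 := dp_mem_gradedPiece (k := ZMod 2) (w := bideg)
      (j := fun r (v : V) => Finsupp.single r v) 0 n m
    have := mul_mem_gradedPiece h1 hx
    simpa [bideg, bipiece] using this

theorem inclEmb_mem_bipiece {d : ℕ} {t : Gam (ZMod 2) V ⊗[ZMod 2] V} (ht : t ∈ tensorPiece V d) :
    inclEmb V t ∈ bipiece V d (d - 1) := by
  induction ht using Submodule.span_induction with
  | zero => rw [map_zero]; exact zero_mem _
  | add t t' _ _ ht ht' => rw [map_add]; exact add_mem ht ht'
  | smul r t _ ht => rw [map_smul]; exact Submodule.smul_mem _ _ ht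
  | mem t ht =>
    obtain ⟨a, x, w, rfl, hx, rfl⟩ := ht
    rw [inclEmb_tmul]
    have h1 := dp_mem_gradedPiece (k := ZMod 2) (w := bideg)
      (j := fun r (v : V) => Finsupp.single r v) 1 1 w
    have := mul_mem_gradedPiece (incl_mem_bipiece hx) h1
    rw [bipiece]
    convert this using 2
    simp [bideg]
    ring

/-- The components of `L(V)` of weight `d` and degree `d` and `d - 1`. -/
theorem prod_dp_mem (l : List (ℕ × ℕ × V)) (d : ℕ) (i : ℤ)
    (hd : (l.map fun p => p.2.1 • bideg p.1).sum = (d, i)) :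
    (i = d ∧ (l.map fun p => dp (ZMod 2) p.2.1 (Finsupp.single p.1 p.2.2)).prod ∈
      (gamPiece (ZMod 2) V d).map (incl V 0).toLinearMap) ∨
    (i = d - 1 ∧ (l.map fun p => dp (ZMod 2) p.2.1 (Finsupp.single p.1 p.2.2)).prod ∈
      (tensorPiece V d).map (inclEmb V)) ∨ i < d - 1 := by
  induction l generalizing d i with
  | nil =>
    simp only [List.map_nil, List.sum_nil, Prod.zero_eq_mk, Prod.mk.injEq] at hd
    obtain ⟨rfl, rfl⟩ := hd
    exact Or.inl ⟨rfl, 1, one_mem_gamPiece, by simp⟩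
  | cons p l ih =>
    obtain ⟨r, n, v⟩ := p
    obtain ⟨⟨d', i'⟩, h'⟩ : ∃ q, (l.map fun p => p.2.1 • bideg p.1).sum = q := ⟨_, rfl⟩
    rw [List.map_cons, List.sum_cons, h', bideg] at hd
    simp only [Prod.smul_mk, Prod.mk_add_mk, Prod.mk.injEq, smul_eq_mul, nsmul_eq_mul,
      mul_one] at hd
    obtain ⟨rfl, rfl⟩ := hd
    simp only [List.map_cons, List.prod_cons]
    have hle : n ≤ n * 2 ^ r := Nat.le_mul_of_pos_right n (by positivity)
    -- The weight of `γₙ(v^{(r)})` exceeds its degree by `n (2 ^ r - 1)`: this is 0 if `n = 0` or `r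
    -- = 0`, is 1 only if `n = r = 1`, and is at least 2 otherwise. For `n = 0` the factor is 1
    -- whatever `r` is, hence still comes from the copy of index 0.
    have key : (n * 2 ^ r = n ∧ dp (ZMod 2) n (Finsupp.single r v) = incl V 0 (dp (ZMod 2) n v)) ∨
        (n = 1 ∧ r = 1) ∨ n + 2 ≤ n * 2 ^ r := by
      rcases n with _ | n
      · left
        rw [incl_dp, dp_zero, dp_zero]; simp
      rcases r with _ | _ | r
      · left
        rw [incl_dp]; simp
      · rcases n with _ | n
        · right; left; simp
        · right; right; simp; omega
      · right; right
        have : 2 ^ (r + 1 + 1) = 4 * 2 ^ r := by ring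
        have h1 : 0 < 2 ^ r := by positivity
        rw [this]
        nlinarith
    rcases key with ⟨h1, h2⟩ | ⟨rfl, rfl⟩ | h1
    · rw [h2, h1]
      rcases ih d' i' h' with ⟨hi, x, hx, hx'⟩ | ⟨hi, t, ht, ht'⟩ | hi
      · refine Or.inl ⟨by push_cast; omega, dp (ZMod 2) n v * x,
          mul_mem_gamPiece (dp_mem_gamPiece _ _) hx, ?_⟩
        rw [← hx', AlgHom.toLinearMap_apply, AlgHom.toLinearMap_apply, map_mul]
      · refine Or.inr (Or.inl ⟨by push_cast; omega, dp (ZMod 2) n v • t,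
          smul_mem_tensorPiece (dp_mem_gamPiece _ _) ht, ?_⟩)
        rw [← ht', inclEmb_smul]
      · exact Or.inr (Or.inr (by push_cast; omega))
    · rcases ih d' i' h' with ⟨hi, x, hx, hx'⟩ | ⟨hi, t, ht, ht'⟩ | hi
      · refine Or.inr (Or.inl ⟨by push_cast; omega, x ⊗ₜ v,
          Submodule.subset_span ⟨d', x, v, by omega, hx, rfl⟩, ?_⟩)
        rw [← hx', inclEmb_tmul, mul_comm]
        rfl
      · exact Or.inr (Or.inr (by push_cast; omega))
      · exact Or.inr (Or.inr (by push_cast; omega))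
    · refine Or.inr (Or.inr ?_)
      -- The remaining factors cannot compensate an excess of 2: in each case of the induction
      -- hypothesis their degree is at most their weight.
      have : (i' : ℤ) ≤ d' := by
        rcases ih d' i' h' with h | h | h <;> omega
      push_cast at h1 ⊢
      have h3 : ((n + 2 : ℕ) : ℤ) ≤ ((n * 2 ^ r : ℕ) : ℤ) := by exact_mod_cast h1
      push_cast at h3
      omega

theorem exists_incl_eq {d : ℕ} {z : Gam (ZMod 2) (ℕ →₀ V)} (hz : z ∈ bipiece V d d) :
    ∃ x ∈ gamPiece (ZMod 2) V d, incl V 0 x = z := by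
  have : bipiece V d d ≤ (gamPiece (ZMod 2) V d).map (incl V 0).toLinearMap := by
    refine Submodule.span_le.mpr ?_
    rintro _ ⟨l, hl, rfl⟩
    rcases prod_dp_mem l d d hl with h | h | h
    · exact h.2
    · omega
    · omega
  exact this hz

theorem exists_inclEmb_eq {d : ℕ} {z : Gam (ZMod 2) (ℕ →₀ V)} (hz : z ∈ bipiece V d (d - 1)) :
    ∃ t ∈ tensorPiece V d, inclEmb V t = z := by
  have : bipiece V d (d - 1) ≤ (tensorPiece V d).map (inclEmb V) := by
    refine Submodule.span_le.mpr ?_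
    rintro _ ⟨l, hl, rfl⟩
    rcases prod_dp_mem l d _ hl with h | h | h
    · omega
    · exact h.2
    · omega
  exact this hz

end Pieces

/-! ### The exterior power inside the divided power algebra -/

section ExteriorToGamma

variable {M N : Type*} [AddCommGroup M] [Module (ZMod 2) M] [AddCommGroup N] [Module (ZMod 2) N]

theorem emb_mul_self (m : M) : emb (ZMod 2) M m * emb (ZMod 2) M m = 0 := by
  rw [emb_apply, dp_mul, ← Nat.cast_smul_eq_nsmul (ZMod 2)]
  exact zero_smul _ _

variable (M) in
/-- The algebra morphism `Λ(M) → Γ(M)` that extends `γ₁`. -/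
def extToGam : ExteriorAlgebra (ZMod 2) M →ₐ[ZMod 2] Gam (ZMod 2) M :=
  ExteriorAlgebra.lift (ZMod 2) ⟨emb (ZMod 2) M, emb_mul_self⟩

theorem extToGam_ι (m : M) : extToGam M (ExteriorAlgebra.ι (ZMod 2) m) = dp (ZMod 2) 1 m :=
  ExteriorAlgebra.lift_ι_apply _ _ _ _

theorem extToGam_ιMulti (d : ℕ) (v : Fin d → M) :
    extToGam M (ExteriorAlgebra.ιMulti (ZMod 2) d v) = ∏ t, dp (ZMod 2) 1 (v t) := by
  rw [ExteriorAlgebra.ιMulti_apply, map_list_prod, List.map_ofFn, List.prod_ofFn]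
  exact Finset.prod_congr rfl fun t _ => extToGam_ι _

theorem extToGam_mem {d : ℕ} {x : ExteriorAlgebra (ZMod 2) M} (hx : x ∈ ⋀[ZMod 2]^d M) :
    extToGam M x ∈ gamPiece (ZMod 2) M d := by
  induction hx using Submodule.pow_induction_on_left' with
  | algebraMap r =>
    rw [AlgHom.commutes, Algebra.algebraMap_eq_smul_one]
    exact Submodule.smul_mem _ _ one_mem_gamPiece
  | add x y i hx hy hx' hy' => rw [map_add]; exact add_mem hx' hy'
  | mem_mul m hm i x hx ih =>
    obtain ⟨m, rfl⟩ := hm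
    rw [map_mul, extToGam_ι, Nat.succ_eq_one_add]
    exact mul_mem_gamPiece (dp_mem_gamPiece _ _) ih

/-- A derivation that vanishes on all `γ₁(m)` vanishes on the subalgebra they generate. -/
theorem coversch_extToGam {d : ℕ} {x : ExteriorAlgebra (ZMod 2) M} (hx : x ∈ ⋀[ZMod 2]^d M) :
    coversch M (extToGam M x) = 0 := by
  induction hx using Submodule.pow_induction_on_left' with
  | algebraMap r => rw [AlgHom.commutes, coversch_algebraMap]
  | add x y i hx hy hx' hy' => rw [map_add, map_add, hx', hy', add_zero]
  | mem_mul m hm i x hx ih =>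
    obtain ⟨m, rfl⟩ := hm
    rw [map_mul, coversch_mul, ih, extToGam_ι, coversch_dp, if_neg (by omega), smul_zero,
      smul_zero, add_zero]

/-- Both sides are morphisms of `S`-algebras out of `S ⊗ Λ(M)`, so it is enough to compare them on
`M`, where the claim is the naturality of `γ₁`. -/
theorem extToGam_naturality {S : Type*} [CommRing S] [Algebra (ZMod 2) S]
    (φ : S ⊗[ZMod 2] M →ₗ[S] S ⊗[ZMod 2] N) (x : S ⊗[ZMod 2] ExteriorAlgebra (ZMod 2) M) :
    (extToGam N).toLinearMap.baseChange S (extMap φ x) =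
      gammaMap φ ((extToGam M).toLinearMap.baseChange S x) := by
  have hι : ∀ (P : Type _) [AddCommGroup P] [Module (ZMod 2) P] (y : S ⊗[ZMod 2] P),
      (extToGam P).toLinearMap.baseChange S ((ExteriorAlgebra.ι (ZMod 2)).baseChange S y) =
        (emb (ZMod 2) P).baseChange S y := by
    intro P _ _ y
    rw [← LinearMap.comp_apply, ← LinearMap.baseChange_comp]
    congr 2
    exact LinearMap.ext extToGam_ι
  have : (Algebra.TensorProduct.map (AlgHom.id S S) (extToGam N)).comp (extMap φ) =
      (gammaMap φ).comp (Algebra.TensorProduct.map (AlgHom.id S S) (extToGam M)) := by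
    refine Algebra.TensorProduct.ext (by ext) (ExteriorAlgebra.hom_ext (LinearMap.ext fun m => ?_))
    change (extToGam N).toLinearMap.baseChange S (extMap φ (1 ⊗ₜ ExteriorAlgebra.ι (ZMod 2) m)) =
      gammaMap φ (1 ⊗ₜ extToGam M (ExteriorAlgebra.ι (ZMod 2) m))
    have h1 := extMap_ι φ (1 ⊗ₜ m)
    rw [LinearMap.baseChange_tmul] at h1
    have h2 := emb_naturality φ (1 ⊗ₜ m)
    rw [LinearMap.baseChange_tmul] at h2
    rw [h1, hι, h2, extToGam_ι]
    rfl
  exact DFunLike.congr_fun this x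

/-- A wedge product of distinct basis vectors goes to the monomial whose exponent is the indicator
function of their set of indices. So a basis of the exterior power goes to a subfamily of the
monomial basis. -/
theorem extToGam_injOn [Module.Finite (ZMod 2) M] (d : ℕ) :
    Function.Injective ((extToGam M).toLinearMap.domRestrict (⋀[ZMod 2]^d M)) := by
  classical
  let b := Module.finBasis (ZMod 2) M
  let ex : Finset (Fin (Module.finrank (ZMod 2) M)) → (Fin (Module.finrank (ZMod 2) M) →₀ ℕ) :=
    fun s => Finsupp.indicator s fun _ _ => 1
  have hex : Function.Injective ex := by
    intro s t h
    ext i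
    have := DFunLike.congr_fun h i
    simp only [ex, Finsupp.indicator_apply] at this
    by_cases h1 : i ∈ s <;> by_cases h2 : i ∈ t <;> simp_all
  have hval : ∀ s, (extToGam M).toLinearMap.domRestrict (⋀[ZMod 2]^d M) (b.exteriorPower d s) =
      mono (ZMod 2) b (ex s) := by
    intro s
    rw [exteriorPower.basis_apply, LinearMap.domRestrict_apply, AlgHom.toLinearMap_apply]
    refine (extToGam_ιMulti d _).trans ?_
    rw [mono_eq_prod b (ex s) s.1 (Finsupp.support_indicator_subset _ _)]
    have hs : ∀ i ∈ s.1, dp (ZMod 2) (ex s i) (b i) = dp (ZMod 2) 1 (b i) := fun i hi => by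
      simp only [ex, Finsupp.indicator_apply]
      rw [dif_pos hi]
    rw [Finset.prod_congr rfl hs]
    refine (Finset.prod_map Finset.univ (s.1.orderEmbOfFin s.2).toEmbedding
      fun i => dp (ZMod 2) 1 (b i)).symm.trans ?_
    rw [Finset.map_orderEmbOfFin_univ s.1 s.2]
  refine LinearMap.injective_of_linearIndependent (b.exteriorPower d).span_eq ?_
  have : ⇑((extToGam M).toLinearMap.domRestrict (⋀[ZMod 2]^d M)) ∘ ⇑(b.exteriorPower d) =
      mono (ZMod 2) b ∘ fun s => ex s.1 := funext hval
  rw [this]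
  exact (linearIndependent_mono b).comp _ (hex.comp Subtype.val_injective)

/-- A squarefree monomial in the variables of `V^{(0)}` is the image of a wedge product. The finite
set carries no order, and none is needed since only a preimage is asserted. -/
theorem prod_gen_mem {V β : Type*} [AddCommGroup V] [Module (ZMod 2) V]
    (e : Module.Basis β (ZMod 2) V) (s : Finset (ℕ × β)) (hs : ∀ p ∈ s, p.1 = 0) :
    ∏ p ∈ s, dp (ZMod 2) 1 (sumBasis e p) ∈
      (⋀[ZMod 2]^s.card V).map ((incl V 0).comp (extToGam V)).toLinearMap := by
  classical
  induction s using Finset.induction_on with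
  | empty =>
    refine ⟨1, ?_, by simp⟩
    rw [Finset.card_empty, ExteriorAlgebra.exteriorPower, pow_zero]
    exact Submodule.one_le.mp le_rfl
  | insert p s hp ih =>
    obtain ⟨x, hx, hx'⟩ := ih fun q hq => hs q (Finset.mem_insert_of_mem hq)
    refine ⟨ExteriorAlgebra.ι (ZMod 2) (e p.2) * x, ?_, ?_⟩
    · have := Submodule.mul_mem_mul
        (LinearMap.mem_range_self (ExteriorAlgebra.ι (ZMod 2)) (e p.2)) hx
      rw [← pow_succ'] at this
      rwa [Finset.card_insert_of_notMem hp]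
    · rw [Finset.prod_insert hp, ← hx', AlgHom.toLinearMap_apply, map_mul, AlgHom.comp_apply,
        extToGam_ι, incl_dp, sumBasis_apply, hs p (Finset.mem_insert_self _ _)]
      rfl

/-- The cycles of weight and degree `d` come from the exterior power. -/
theorem exists_ext_of_skewDiff_eq_zero {V : Type*} [AddCommGroup V] [Module (ZMod 2) V] {d : ℕ}
    {z : Gam (ZMod 2) (ℕ →₀ V)} (hz : z ∈ bipiece V d d) (h0 : skewDiff (shiftLin V) z = 0) :
    ∃ x ∈ ⋀[ZMod 2]^d V, incl V 0 (extToGam V x) = z := by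
  let e := Module.Basis.ofVectorSpace (ZMod 2) V
  refine (Submodule.span_le (p := (⋀[ZMod 2]^d V).map
    ((incl V 0).comp (extToGam V)).toLinearMap)).mpr ?_ (mem_span_of_skewDiff_eq_zero e hz h0)
  rintro _ ⟨n, ⟨hn, hn'⟩, rfl⟩
  -- Without active indices the monomial is squarefree with variables in `V^{(0)}` only, and its
  -- weight counts its factors.
  have h1 : ∀ p ∈ n.support, n p = 1 := by
    intro p hp
    have h2 : ¬ 2 ≤ n p := fun h => hn' ⟨p, Or.inl h⟩
    rw [Finsupp.mem_support_iff] at hp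
    omega
  have h2 : ∀ p ∈ n.support, p.1 = 0 := by
    rintro ⟨_ | r, j⟩ hp
    · rfl
    · rw [Finsupp.mem_support_iff] at hp
      exact absurd (eq_zero_of_activeSet_empty hn' r j) hp
  have hd : n.support.card = d := by
    have := congrArg Prod.fst hn
    rw [bidegree, Finsupp.linearCombination_apply, Finsupp.sum, Prod.fst_sum] at this
    refine Eq.trans ?_ this
    rw [Finset.card_eq_sum_ones]
    refine Finset.sum_congr rfl fun p hp => ?_
    rw [h1 p hp, h2 p hp]
    rfl
  have := prod_gen_mem e n.support h2
  rw [hd] at this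
  rw [SetLike.mem_coe, mono_eq_prod _ n _ subset_rfl]
  rwa [Finset.prod_congr rfl fun p hp => by rw [h1 p hp]]

end ExteriorToGamma

open PolyFunctor PolyFunctor.Hom

/-! ### Kernels, images and cokernels of the differential -/

section Functors

/-- A morphism whose values lie in the image of an injective morphism lifts. -/
theorem PolyFunctor.Hom.exists_lift {F G K : PolyFunctor.{u}} (j : Hom F G)
    (hj : ∀ V, Function.Injective (j.app V)) (s : Hom K G)
    (hs : ∀ V x, s.app V x ∈ LinearMap.range (j.app V)) : ∃ t : Hom K F, j.comp t = s := by
  let a : ∀ V, K.obj V →ₗ[ZMod 2] F.obj V := fun V =>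
    (LinearEquiv.ofInjective (j.app V) (hj V)).symm.toLinearMap ∘ₗ
      (s.app V).codRestrict _ (hs V)
  have ha : ∀ V, j.app V ∘ₗ a V = s.app V := fun V => LinearMap.ext fun x =>
    congrArg Subtype.val (LinearEquiv.apply_symm_apply (LinearEquiv.ofInjective (j.app V) (hj V))
      ((s.app V).codRestrict _ (hs V) x))
  refine ⟨⟨a, fun {V W S} _ _ φ x => ?_⟩, ?_⟩
  -- The pointwise lift is natural because `j` remains injective over `S`: every `𝔽₂`-algebra is
  -- flat over the field `𝔽₂`.
  · have hinj : Function.Injective ((j.app W).baseChange S) := by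
      rw [LinearMap.baseChange_eq_ltensor]
      exact Module.Flat.lTensor_preserves_injective_linearMap _ (hj W)
    refine hinj ?_
    have hb : ∀ V y, (j.app V).baseChange S ((a V).baseChange S y) = (s.app V).baseChange S y :=
      fun V y => by rw [← LinearMap.comp_apply, ← LinearMap.baseChange_comp, ha]
    rw [j.naturality, hb, hb, s.naturality]
  · exact Hom.ext (funext ha)

/-- The inclusion `Λ(V) → Γ(V)`. -/
def extΓ : Hom extAlg.{u} (gamma idF) where
  app V := (extToGam V).toLinearMap
  naturality φ x := extToGam_naturality φ x

/-- The inclusion `Λᵈ(V) → Γᵈ(V)`. -/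
def lamΓ (d : ℕ) : Hom (Lam.{u} d) (gammaPow d idF) :=
  codRestrict (F := gamma idF) (extΓ.comp (extAlg.subι _ fun φ _ hx => extMap_mem φ d hx))
    (isStable_gamPiece idF d) fun _ x => extToGam_mem x.2

/-- The identification of `Γᵈ(V)` with the component of weight and degree `d` of `L(V)`. -/
def gammaToL (d : ℕ) : Hom (gammaPow.{u} d idF) (Lpiece d d) :=
  codRestrict (F := L) ((mapΓ singleZero).comp (gammaPowι d idF))
    (isStable_bipiece d d) fun _ x => incl_mem_bipiece x.2

/-- A morphism to `L^d_i` with values in the cycles gives a morphism to `SK^d_i`. -/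
def toSK {F : PolyFunctor.{u}} {d : ℕ} {i : ℤ} (f : Hom F (Lpiece d i))
    (hf : ∀ (V : FGModuleCat.{u} (ZMod 2)) (x : F.obj V), skewDiff (shiftLin V) (f.app V x : Gam (ZMod 2) (ℕ →₀ V)) = 0) :
    Hom F (SK d i) :=
  f.codRestrict (diff d (sub_add_cancel i 1)).isStable_ker fun V x => Subtype.ext (hf V x)

theorem skewDiff_SK {d : ℕ} {i : ℤ} {V : FGModuleCat.{u} (ZMod 2)} (x : (SK d i).obj V) :
    skewDiff (shiftLin V) (x.1.1 : Gam (ZMod 2) (ℕ →₀ V)) = 0 := congrArg Subtype.val x.2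

theorem isKernel_SKι (d : ℕ) (i : ℤ) : (SKι.{u} d i).IsKernel (diff d (sub_add_cancel i 1)) :=
  fun _ => ⟨Subtype.val_injective, Submodule.range_subtype _⟩

/-- The differential, as a morphism to the cycles. -/
def diffToSK (d : ℕ) {i j : ℤ} (h : j + 1 = i) : Hom (Lpiece.{u} d i) (SK d j) :=
  toSK (diff d h) fun _ _ => skewDiff_skewDiff _ _

theorem diffToSK_surjective {d : ℕ} {i : ℤ} (hi : i ≠ d) (V : FGModuleCat.{u} (ZMod 2)) :
    Function.Surjective ((diffToSK d (rfl : i + 1 = i + 1)).app V) := by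
  intro z
  obtain ⟨y, hy, hyz⟩ := exists_skewDiff_eq hi z.1.2 (skewDiff_SK z)
  exact ⟨⟨y, hy⟩, Subtype.ext (Subtype.ext hyz)⟩

theorem isImage_SKι {d : ℕ} {i : ℤ} (hi : i ≠ d) :
    (SKι.{u} d i).IsImage (diff d (rfl : i + 1 = i + 1)) := by
  intro V
  refine ⟨Subtype.val_injective, le_antisymm ?_ ?_⟩
  · rintro _ ⟨z, rfl⟩
    obtain ⟨y, hy⟩ := diffToSK_surjective hi V z
    exact ⟨y, congrArg Subtype.val hy⟩
  · rintro _ ⟨y, rfl⟩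
    exact ⟨(diffToSK d rfl).app V y, rfl⟩

/-- Exactness is used twice: in degree `i` for the surjectivity, and in degree `i + 1` for the
kernel. The second use requires `i + 1 ≠ d`, which is why degree `d - 1` is left out. -/
theorem isCokernel_diffToSK {d : ℕ} {i : ℤ} (hi : i < d - 1) :
    (diffToSK.{u} d (rfl : i + 1 = i + 1)).IsCokernel
      (diff d (add_assoc i 1 1 : i + 1 + 1 = i + (1 + 1))) := by
  intro V
  refine ⟨diffToSK_surjective (by omega) V, le_antisymm ?_ ?_⟩
  · intro z hz
    have h0 : skewDiff (shiftLin V) (z.1 : Gam (ZMod 2) (ℕ →₀ V)) = 0 :=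
      congrArg (fun y : (SK d i).obj V => (y.1.1 : Gam (ZMod 2) (ℕ →₀ V))) hz
    obtain ⟨y, hy, hyz⟩ := exists_skewDiff_eq (by omega) z.2 h0
    rw [add_assoc] at hy
    exact ⟨⟨y, hy⟩, Subtype.ext hyz⟩
  · rintro _ ⟨y, rfl⟩
    exact Subtype.ext (Subtype.ext (skewDiff_skewDiff _ _))

/-- The isomorphism of the exterior power with the top piece. -/
def lamToSK (d : ℕ) : Hom (Lam.{u} d) (SK d d) :=
  toSK ((gammaToL d).comp (lamΓ d)) fun V x => by
    change skewDiff (shiftLin V) (incl V 0 (extToGam V x.1)) = 0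
    rw [skewDiff_incl, coversch_extToGam x.2, map_zero]

theorem lamΓ_injective (d : ℕ) (V : FGModuleCat.{u} (ZMod 2)) :
    Function.Injective ((lamΓ d).app V) := fun _ _ h =>
  extToGam_injOn d (congrArg Subtype.val h)

/-- Injectivity is that of `Λᵈ(V) → Γᵈ(V) → L(V)`. Surjectivity holds because the cycles of weight
and degree `d` are spanned by squarefree monomials in the variables of `V^{(0)}`. -/
theorem isIso_lamToSK (d : ℕ) : (lamToSK.{u} d).IsIso := by
  intro V
  refine ⟨fun x y h => ?_, fun z => ?_⟩
  · refine lamΓ_injective d V (Subtype.ext (incl_injective (V := V) 0 ?_))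
    exact congrArg (fun y : (SK d d).obj V => (y.1.1 : Gam (ZMod 2) (ℕ →₀ V))) h
  · obtain ⟨x, hx, hxz⟩ := exists_ext_of_skewDiff_eq_zero z.1.2 (skewDiff_SK z)
    exact ⟨⟨x, hx⟩, Subtype.ext (Subtype.ext hxz)⟩

theorem lamToSK_ιMulti (d : ℕ) (V : FGModuleCat.{u} (ZMod 2)) (v : Fin d → V) :
    (SKtoL d d).app V ((lamToSK d).app V (exteriorPower.ιMulti (ZMod 2) d v)) =
      ∏ t, gen 0 (v t) := by
  change incl V 0 (extToGam V (ExteriorAlgebra.ιMulti (ZMod 2) d v)) = _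
  rw [extToGam_ιMulti, map_prod]
  exact Finset.prod_congr rfl fun t _ => incl_dp 0 1 (v t)

end Functors

/-! ### Divided powers of degree zero and one -/

section SmallDegrees

variable {M : Type*} [AddCommGroup M] [Module (ZMod 2) M]

theorem exists_of_mem_gamPiece_zero {x : Gam (ZMod 2) M} (hx : x ∈ gamPiece (ZMod 2) M 0) :
    ∃ c : ZMod 2, x = c • 1 := by
  -- The equation on the degree is part of `P` because the induction lets the degree vary.
  refine gamPiece_induction (P := fun d x => d = 0 → ∃ c : ZMod 2, x = c • 1)
    (fun _ => ⟨1, (one_smul _ _).symm⟩) (fun d _ => ⟨0, (zero_smul _ _).symm⟩)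
    (fun d x y hx hy hd => ?_) (fun d n x m _ hx hd => ?_) hx rfl
  · obtain ⟨a, rfl⟩ := hx hd
    obtain ⟨b, rfl⟩ := hy hd
    exact ⟨a + b, (add_smul _ _ _).symm⟩
  · obtain ⟨rfl, rfl⟩ : n = 0 ∧ d = 0 := by omega
    rw [dp_zero, one_mul]
    exact hx rfl

theorem exists_of_mem_gamPiece_one {x : Gam (ZMod 2) M} (hx : x ∈ gamPiece (ZMod 2) M 1) :
    ∃ m, x = emb (ZMod 2) M m := by
  refine gamPiece_induction (P := fun d x => d = 1 → ∃ m, x = emb (ZMod 2) M m)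
    (fun h => by omega) (fun d _ => ⟨0, (map_zero _).symm⟩)
    (fun d x y hx hy hd => ?_) (fun d n x m hxd hx hd => ?_) hx rfl
  · obtain ⟨a, rfl⟩ := hx hd
    obtain ⟨b, rfl⟩ := hy hd
    exact ⟨a + b, (map_add _ _ _).symm⟩
  · obtain ⟨rfl, rfl⟩ | ⟨rfl, rfl⟩ : n = 0 ∧ d = 1 ∨ n = 1 ∧ d = 0 := by omega
    · rw [dp_zero, one_mul]
      exact hx rfl
    · obtain ⟨c, rfl⟩ := exists_of_mem_gamPiece_zero hxd
      exact ⟨c • m, by rw [map_smul, mul_smul_comm, mul_one]; rfl⟩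

end SmallDegrees

/-! ### The kernel in degree one below the weight -/

section SecondPiece

theorem projΓ_app (n : ℕ) (F : PolyFunctor.{u}) (V : FGModuleCat.{u} (ZMod 2)) :
    (projΓ n F).app V = gamProj (ZMod 2) (F.obj V) n := LinearMap.ext fun _ => rfl

theorem multL_app (n : ℕ) (V : FGModuleCat.{u} (ZMod 2))
    (t : gamPiece (ZMod 2) V n ⊗[ZMod 2] V) :
    (multL n).app V t = inclEmb V ((gamPiece (ZMod 2) V n).subtype.rTensor V t) := by
  induction t using TensorProduct.induction_on with
  | zero => exact (map_zero ((multL n).app V)).trans (by rw [map_zero, map_zero])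
  | add t t' ht ht' =>
    exact (map_add ((multL n).app V) t t').trans (by rw [map_add, map_add, ht, ht'])
  | tmul x w =>
    rw [LinearMap.rTensor_tmul, inclEmb_tmul]
    rfl

theorem multL_injective (n : ℕ) (V : FGModuleCat.{u} (ZMod 2)) :
    Function.Injective ((multL n).app V) := by
  intro t t' h
  rw [multL_app, multL_app] at h
  exact Module.Flat.rTensor_preserves_injective_linearMap _
    (Submodule.injective_subtype _) (inclEmb_injective h)

/-- Together with `multL_injective`, this identifies the component of weight `n + 2` and degree `n +
1` with `Γⁿ(V) ⊗ V^{(1)}`. -/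
theorem exists_multL_eq {n : ℕ} {V : FGModuleCat.{u} (ZMod 2)} {z : Gam (ZMod 2) (ℕ →₀ V)}
    (hz : z ∈ bipiece V (n + 2) ((n + 2 : ℕ) - 1)) : ∃ t, (multL n).app V t = z := by
  obtain ⟨t, ht, rfl⟩ := exists_inclEmb_eq hz
  refine ⟨(gamProj (ZMod 2) V n).rTensor V t, ?_⟩
  rw [multL_app, subtype_gamProj_of_mem ht]

theorem multL_gamProj_coversch {n : ℕ} {V : FGModuleCat.{u} (ZMod 2)} {x : Gam (ZMod 2) V}
    (hx : x ∈ gamPiece (ZMod 2) V (n + 2)) :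
    (multL n).app V ((gamProj (ZMod 2) V n).rTensor V (coversch V x)) =
      skewDiff (shiftLin V) (incl V 0 x) := by
  rw [multL_app, subtype_gamProj_of_mem (coversch_mem hx), skewDiff_incl]

theorem map_gamProj_versch (n : ℕ) (V : FGModuleCat.{u} (ZMod 2)) (x : Gam (ZMod 2) V) :
    ((projΓ n idF).tensor (verschΓ idF)).app V ((comulΓ idF).app V x) =
      (gamProj (ZMod 2) V n).rTensor V (coversch V x) := by
  change TensorProduct.map ((projΓ n idF).app V) versch (comul x) = _
  rw [projΓ_app]
  change _ = ((gamProj (ZMod 2) V n).rTensor V ∘ₗ versch.lTensor (Gam (ZMod 2) V)) (comul x)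
  rw [LinearMap.rTensor_comp_lTensor]

/-- Once source and target are seen inside `L(V)`, the morphism `f` is the differential. -/
theorem multL_fMap {d : ℕ} (hd : 2 ≤ d) (V : FGModuleCat.{u} (ZMod 2))
    (x : gamPiece (ZMod 2) V d) :
    (multL (d - 2)).app V ((fMap d).app V x) = skewDiff (shiftLin V) (incl V 0 x) := by
  obtain ⟨n, rfl⟩ := Nat.exists_eq_add_of_le' hd
  refine Eq.trans (congrArg ((multL n).app V) (map_gamProj_versch n V x.1)) ?_
  exact multL_gamProj_coversch x.2

/-- The multiplication `Γⁿ(V) ⊗ Γ²(V^{(1)}) → L(V)`. -/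
def multTwo (n : ℕ) : Hom ((gammaPow.{u} n idF).tensor (gammaPow 2 (idF.twist 1))) L :=
  (mulΓ sumTwist).comp (((mapΓ singleZero).comp (gammaPowι n idF)).tensor
    ((mapΓ (Hom.single 1)).comp (gammaPowι 2 (idF.twist 1))))

theorem multTwo_app (n : ℕ) (V : FGModuleCat.{u} (ZMod 2))
    (t : gamPiece (ZMod 2) V n ⊗[ZMod 2] gamPiece (ZMod 2) V 2) :
    (multTwo n).app V t = inclMul V (TensorProduct.map (gamPiece (ZMod 2) V n).subtype
      (gamPiece (ZMod 2) V 2).subtype t) := by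
  induction t using TensorProduct.induction_on with
  | zero => exact (map_zero ((multTwo n).app V)).trans (by rw [map_zero, map_zero])
  | add t t' ht ht' =>
    exact (map_add ((multTwo n).app V) t t').trans (by rw [map_add, map_add, ht, ht'])
  | tmul x w => rfl

theorem multTwo_injective (n : ℕ) (V : FGModuleCat.{u} (ZMod 2)) :
    Function.Injective ((multTwo n).app V) := by
  intro t t' h
  rw [multTwo_app, multTwo_app] at h
  refine TensorProduct.map_injective_of_flat_flat _ _ (Submodule.injective_subtype _)
    (Submodule.injective_subtype _) (inclMul_injective h)

theorem multTwo_mulTwo (n : ℕ) (V : FGModuleCat.{u} (ZMod 2))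
    (t : gamPiece (ZMod 2) V n ⊗[ZMod 2] V) (w : V) :
    (multTwo n).app V (TensorProduct.map LinearMap.id ((mulTwo (idF.twist 1)).app V)
      (TensorProduct.assoc (ZMod 2) _ _ _ (t ⊗ₜ w))) =
      (multL n).app V t * dp (ZMod 2) 1 (Finsupp.single 1 w) := by
  induction t using TensorProduct.induction_on with
  | zero =>
    rw [TensorProduct.zero_tmul, map_zero, map_zero, map_zero]
    exact (zero_mul _).symm.trans (congrArg (· * _) (map_zero ((multL n).app V)).symm)
  | add t t' ht ht' =>
    rw [TensorProduct.add_tmul, map_add, map_add, map_add, ht, ht', ← add_mul]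
    exact congrArg (· * _) (map_add ((multL n).app V) t t').symm
  | tmul x m =>
    rw [TensorProduct.assoc_tmul, TensorProduct.map_tmul]
    change incl V 0 x.1 * incl V 1 (dp (ZMod 2) 1 m * dp (ZMod 2) 1 w) =
      incl V 0 x.1 * dp (ZMod 2) 1 (Finsupp.single 1 m) * _
    rw [map_mul, incl_dp, incl_dp, mul_assoc]

/-- Seen inside `L(V)`, the morphism `g` is the differential too: in `x · γ₁(w^{(1)})` only `x` gets
differentiated, as `∂` kills `γ₁`. Since `multTwo` is injective, the kernel of `g` consists of the
elements that become cycles in `L(V)`. -/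
theorem multTwo_gMap {d : ℕ} (hd : 4 ≤ d) (V : FGModuleCat.{u} (ZMod 2))
    (t : gamPiece (ZMod 2) V (d - 2) ⊗[ZMod 2] V) :
    (multTwo (d - 4)).app V ((gMap d).app V t) =
      skewDiff (shiftLin V) ((multL (d - 2)).app V t) := by
  -- For `d = n + 4` the truncated differences `d - 2` and `d - 4` reduce to `n + 2` and `n`.
  obtain ⟨n, rfl⟩ := Nat.exists_eq_add_of_le' hd
  induction t using TensorProduct.induction_on with
  | zero => simp only [map_zero]
  | add t t' ht ht' => simp only [map_add, ht, ht']
  | tmul x w =>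
    have h1 : (gMap (n + 4)).app V (x ⊗ₜ w) =
        TensorProduct.map LinearMap.id ((mulTwo (idF.twist 1)).app V)
          (TensorProduct.assoc (ZMod 2) _ _ _
            ((gamProj (ZMod 2) V n).rTensor V (coversch V x.1) ⊗ₜ w)) := by
      rw [← map_gamProj_versch]
      rfl
    rw [h1]
    refine (multTwo_mulTwo n V _ w).trans ?_
    rw [multL_gamProj_coversch x.2]
    change _ = skewDiff (shiftLin V) (incl V 0 x.1 * dp (ZMod 2) 1 (Finsupp.single 1 w))
    rw [skewDiff_mul, skewDiff_dp, if_neg (by omega), mul_zero, zero_add]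

/-- Already `L^1_0` vanishes: a factor from `V^{(1)}` has weight 2. The index `(1 : ℕ) - 1` is a
difference of integers, left unevaluated so as to match `d - 1` for `d = 1`. -/
theorem subsingleton_SK_one (V : FGModuleCat.{u} (ZMod 2)) :
    Subsingleton ((SK 1 ((1 : ℕ) - 1)).obj V) := by
  refine subsingleton_of_forall_eq 0 fun z => Subtype.ext (Subtype.ext ?_)
  obtain ⟨t, ht, h⟩ := exists_inclEmb_eq z.1.2
  have h0 : tensorPiece V 1 = ⊥ := by
    rw [tensorPiece, Submodule.span_eq_bot]
    rintro _ ⟨a, x, m, ha, _⟩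
    omega
  rw [h0, Submodule.mem_bot] at ht
  rw [← h, ht, map_zero]
  rfl

/-- The isomorphism `V^{(1)} → SK^2_1`. -/
def twistToSK : Hom (idF.{u}.twist 1) (SK 2 ((2 : ℕ) - 1)) :=
  toSK (codRestrict (F := L) ((embΓ sumTwist).comp (Hom.single 1)) (isStable_bipiece 2 _)
    fun V w => by
      have := inclEmb_mem_bipiece (V := V) (d := 2) (t := 1 ⊗ₜ w)
        (Submodule.subset_span ⟨0, 1, w, rfl, one_mem_gamPiece, rfl⟩)
      rw [inclEmb_tmul, map_one, one_mul] at this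
      exact this)
    fun V w => by
      change skewDiff (shiftLin V) (dp (ZMod 2) 1 (Finsupp.single 1 w)) = 0
      rw [skewDiff_dp, if_neg (by omega)]

theorem isIso_twistToSK : twistToSK.{u}.IsIso := by
  intro V
  refine ⟨fun v w h => ?_, fun z => ?_⟩
  · have h' : emb (ZMod 2) (ℕ →₀ V) (Finsupp.single 1 v) = emb (ZMod 2) _ (Finsupp.single 1 w) :=
      congrArg (fun y : (SK 2 ((2 : ℕ) - 1)).obj V => (y.1.1 : Gam (ZMod 2) (ℕ →₀ V))) h
    exact Finsupp.single_injective 1 (emb_injective _ h')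
  · suffices h : ∃ w : V, dp (ZMod 2) 1 (Finsupp.single 1 w) = z.1.1 from
      ⟨h.choose, Subtype.ext (Subtype.ext h.choose_spec)⟩
    obtain ⟨t, ht, h⟩ := exists_inclEmb_eq z.1.2
    rw [← h]
    clear h
    refine (Submodule.span_le (p := (LinearMap.range (emb (ZMod 2) (ℕ →₀ V) ∘ₗ
      Finsupp.lsingle 1)).comap (inclEmb V))).mpr ?_ ht
    rintro _ ⟨a, x, w, ha, hx, rfl⟩
    -- The factor `γ₁(w^{(1)})` uses up the whole weight 2, so the other factor is a scalar.
    obtain rfl : a = 0 := by omega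
    obtain ⟨c, rfl⟩ := exists_of_mem_gamPiece_zero hx
    refine ⟨c • w, ?_⟩
    rw [inclEmb_tmul, map_smul, map_smul, map_one, smul_mul_assoc, one_mul]
    rfl

/-- The isomorphism `V ⊗ V^{(1)} → SK^3_2`. -/
def tensorToSK : Hom (idF.{u}.tensor (idF.twist 1)) (SK 3 ((3 : ℕ) - 1)) :=
  toSK (codRestrict (F := L) ((mulΓ sumTwist).comp (((embΓ sumTwist).comp singleZero).tensor
    ((embΓ sumTwist).comp (Hom.single 1)))) (isStable_bipiece 3 _)
    fun V t => by
      induction t using TensorProduct.induction_on with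
      | zero => rw [map_zero]; exact zero_mem _
      | add t t' ht ht' => rw [map_add]; exact add_mem ht ht'
      | tmul v w =>
        have := inclEmb_mem_bipiece (V := V) (d := 3) (t := dp (ZMod 2) 1 v ⊗ₜ w)
          (Submodule.subset_span ⟨1, _, w, rfl, dp_mem_gamPiece _ _, rfl⟩)
        rw [inclEmb_tmul, incl_dp] at this
        exact this)
    fun V t => by
      induction t using TensorProduct.induction_on with
      | zero => rw [map_zero]; exact map_zero _
      | add t t' ht ht' => rw [map_add]; exact (map_add _ _ _).trans (by rw [ht, ht', add_zero])
      | tmul v w =>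
        change skewDiff (shiftLin V) (dp (ZMod 2) 1 (Finsupp.single 0 v) *
          dp (ZMod 2) 1 (Finsupp.single 1 w)) = 0
        rw [skewDiff_mul, skewDiff_dp, skewDiff_dp, if_neg (by omega), if_neg (by omega), mul_zero,
          zero_mul, add_zero]

theorem tensorToSK_app (V : FGModuleCat.{u} (ZMod 2)) (t : V ⊗[ZMod 2] V) :
    ((tensorToSK.app V t).1.1 : Gam (ZMod 2) (ℕ →₀ V)) =
      inclEmb V ((emb (ZMod 2) V).rTensor V t) := by
  induction t using TensorProduct.induction_on with
  | zero => rw [map_zero, map_zero, map_zero]; rfl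
  | add t t' ht ht' => rw [map_add, map_add, map_add, ← ht, ← ht']; rfl
  | tmul v w =>
    rw [LinearMap.rTensor_tmul, inclEmb_tmul, emb_apply, incl_dp]
    rfl

theorem isIso_tensorToSK : tensorToSK.{u}.IsIso := by
  intro V
  refine ⟨fun t t' h => ?_, fun z => ?_⟩
  · have h' := congrArg (fun y : (SK 3 ((3 : ℕ) - 1)).obj V => (y.1.1 : Gam (ZMod 2) (ℕ →₀ V))) h
    exact Module.Flat.rTensor_preserves_injective_linearMap _ (emb_injective V)
      (inclEmb_injective ((tensorToSK_app V t).symm.trans (h'.trans (tensorToSK_app V t'))))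
  · suffices h : ∃ t : V ⊗[ZMod 2] V, inclEmb V ((emb (ZMod 2) V).rTensor V t) = z.1.1 from
      ⟨h.choose, Subtype.ext (Subtype.ext ((tensorToSK_app V _).trans h.choose_spec))⟩
    obtain ⟨t, ht, h⟩ := exists_inclEmb_eq z.1.2
    rw [← h]
    clear h
    refine (Submodule.span_le (p := (LinearMap.range (inclEmb V ∘ₗ
      (emb (ZMod 2) V).rTensor V)).comap (inclEmb V))).mpr ?_ ht
    rintro _ ⟨a, x, w, ha, hx, rfl⟩
    -- In weight 3, the factor `γ₁(w^{(1)})` leaves weight 1, that is one vector of `V^{(0)}`.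
    obtain rfl : a = 1 := by omega
    obtain ⟨v, rfl⟩ := exists_of_mem_gamPiece_one hx
    exact ⟨v ⊗ₜ w, rfl⟩

/-- The morphism `Γᵈ(V) → SK^d_{d-1}` induced by the differential. -/
def gammaToSK (d : ℕ) : Hom (gammaPow.{u} d idF) (SK d (d - 1)) :=
  (diffToSK d (sub_add_cancel (d : ℤ) 1)).comp (gammaToL d)

/-- This is exactness in degree `d - 1`, combined with `L^d_d = Γᵈ(V)`. -/
theorem gammaToSK_surjective (d : ℕ) (V : FGModuleCat.{u} (ZMod 2)) :
    Function.Surjective ((gammaToSK d).app V) := by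
  intro z
  obtain ⟨y, hy, hyz⟩ := exists_skewDiff_eq (by omega) z.1.2 (skewDiff_SK z)
  rw [sub_add_cancel] at hy
  obtain ⟨x, hx, rfl⟩ := exists_incl_eq hy
  exact ⟨⟨x, hx⟩, Subtype.ext (Subtype.ext hyz)⟩

/-- The kernel of `∂` on `Γᵈ(V) = L^d_d` is the top piece `SK^d_d`, already identified with `Λᵈ(V)`.
-/
theorem isCokernel_gammaToSK (d : ℕ) : (gammaToSK.{u} d).IsCokernel (lamΓ d) := by
  intro V
  refine ⟨gammaToSK_surjective d V, le_antisymm (fun x hx => ?_) ?_⟩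
  · have h0 : skewDiff (shiftLin V) (incl V 0 x.1) = 0 :=
      congrArg (fun y : (SK d (d - 1)).obj V => (y.1.1 : Gam (ZMod 2) (ℕ →₀ V))) hx
    obtain ⟨y, hy, hyx⟩ := exists_ext_of_skewDiff_eq_zero (incl_mem_bipiece x.2) h0
    exact ⟨⟨y, hy⟩, Subtype.ext (incl_injective 0 hyx)⟩
  · rintro _ ⟨y, rfl⟩
    refine Subtype.ext (Subtype.ext ?_)
    change skewDiff (shiftLin V) (incl V 0 (extToGam V y.1)) = 0
    rw [skewDiff_incl, coversch_extToGam y.2, map_zero]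

/-- The lift exists because all of `L^d_{d-1}` lies in the image of the injection `multL`. As
`multL` and `multTwo` turn `f` and `g` into `∂`, the kernel of `g` is the space of cycles and the
image of `f` the space of boundaries; these agree by exactness in degree `d - 1`. -/
theorem exists_SK_lift {d : ℕ} (hd : 4 ≤ d) :
    ∃ i : Hom (SK.{u} d (d - 1)) ((gammaPow (d - 2) idF).tensor (idF.twist 1)),
      (multL (d - 2)).comp i = SKtoL d (d - 1) ∧ i.IsKernel (gMap d) ∧ i.IsImage (fMap d) ∧
      i.comp (gammaToSK d) = fMap d := by
  obtain ⟨i, hi⟩ := (multL.{u} (d - 2)).exists_lift (multL_injective (d - 2)) (SKtoL d (d - 1))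
    (fun V z => by
      have := z.1.2
      obtain ⟨n, rfl⟩ := Nat.exists_eq_add_of_le' (show 2 ≤ d by omega)
      exact exists_multL_eq this)
  have hi' : ∀ V z, (multL (d - 2)).app V (i.app V z) = z.1.1 := fun V z =>
    LinearMap.congr_fun (congrFun (congrArg Hom.app hi) V) z
  have hinj : ∀ V, Function.Injective (i.app V) := fun V z z' h =>
    Subtype.ext (Subtype.ext (by rw [← hi', ← hi', h]))
  have hf : i.comp (gammaToSK d) = fMap d := by
    refine Hom.ext (funext fun V => LinearMap.ext fun x => multL_injective (d - 2) V ?_)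
    refine (hi' V ((gammaToSK d).app V x)).trans ?_
    rw [multL_fMap (by omega)]
    rfl
  refine ⟨i, hi, fun V => ⟨hinj V, le_antisymm ?_ fun t ht => ?_⟩,
    fun V => ⟨hinj V, le_antisymm ?_ ?_⟩, hf⟩
  · rintro _ ⟨z, rfl⟩
    refine LinearMap.mem_ker.mpr (multTwo_injective (d - 4) V ?_)
    rw [multTwo_gMap hd, hi', skewDiff_SK, map_zero]
  · have h0 : skewDiff (shiftLin V) ((multL (d - 2)).app V t) = 0 := by
      rw [← multTwo_gMap hd, LinearMap.mem_ker.mp ht, map_zero]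
    -- An element of `SK^d_{d-1}` is a cycle together with its membership in the component
    -- `L^d_{d-1}`.
    have hm : (multL (d - 2)).app V t ∈ bipiece V d (d - 1) := by
      obtain ⟨n, rfl⟩ := Nat.exists_eq_add_of_le' (show 2 ≤ d by omega)
      rw [multL_app]
      refine inclEmb_mem_bipiece ?_
      clear ht h0
      induction t using TensorProduct.induction_on with
      | zero => rw [map_zero]; exact zero_mem _
      | add t t' ht ht' => rw [map_add]; exact add_mem ht ht'
      | tmul x w => exact Submodule.subset_span ⟨n, x.1, w, rfl, x.2, rfl⟩
    refine ⟨⟨⟨_, hm⟩, LinearMap.mem_ker.mpr (Subtype.ext h0)⟩, multL_injective (d - 2) V ?_⟩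
    rw [hi']
  · rintro _ ⟨z, rfl⟩
    obtain ⟨x, rfl⟩ := gammaToSK_surjective d V z
    exact ⟨x, (LinearMap.congr_fun (congrFun (congrArg Hom.app hf) V) x).symm⟩
  · rintro _ ⟨x, rfl⟩
    exact ⟨(gammaToSK d).app V x, LinearMap.congr_fun (congrFun (congrArg Hom.app hf) V) x⟩

end SecondPiece

/-! ### Coefficients of the action, and generators of a functor -/

section Slice

variable {S : Type*} [CommRing S] [Algebra (ZMod 2) S] {M N : Type*} [AddCommGroup M]
  [Module (ZMod 2) M] [AddCommGroup N] [Module (ZMod 2) N]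

variable (M) in
/-- The map `S ⊗ M → M` attached to a linear form on `S`. -/
def slice (l : S →ₗ[ZMod 2] ZMod 2) : S ⊗[ZMod 2] M →ₗ[ZMod 2] M :=
  (TensorProduct.lid (ZMod 2) M).toLinearMap ∘ₗ l.rTensor M

theorem slice_tmul (l : S →ₗ[ZMod 2] ZMod 2) (s : S) (m : M) : slice M l (s ⊗ₜ m) = l s • m := rfl

theorem slice_baseChange (l : S →ₗ[ZMod 2] ZMod 2) (f : M →ₗ[ZMod 2] N) (x : S ⊗[ZMod 2] M) :
    slice N l (f.baseChange S x) = f (slice M l x) := by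
  induction x using TensorProduct.induction_on with
  | zero => simp only [map_zero]
  | add x y hx hy => simp only [map_add, hx, hy]
  | tmul s m => rw [LinearMap.baseChange_tmul, slice_tmul, slice_tmul, map_smul]

theorem slice_distrib_symm (l : S →ₗ[ZMod 2] ZMod 2) (x : S ⊗[ZMod 2] M) (n : N) :
    slice (M ⊗[ZMod 2] N) l ((distrib S M N).symm (x ⊗ₜ (1 ⊗ₜ n))) = slice M l x ⊗ₜ n := by
  induction x using TensorProduct.induction_on with
  | zero => simp only [map_zero, TensorProduct.zero_tmul]
  | add x y hx hy => simp only [map_add, TensorProduct.add_tmul, hx, hy]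
  | tmul s m =>
    rw [distrib_symm_tmul, one_mul, slice_tmul, slice_tmul, TensorProduct.smul_tmul']

theorem distrib_symm_one_tmul (m : M) (y : S ⊗[ZMod 2] N) :
    (distrib S M N).symm ((1 ⊗ₜ m) ⊗ₜ y) =
      (TensorProduct.mk (ZMod 2) M N m).baseChange S y := by
  induction y using TensorProduct.induction_on with
  | zero => simp only [map_zero, TensorProduct.tmul_zero]
  | add x y hx hy => simp only [map_add, TensorProduct.tmul_add, hx, hy]
  | tmul s m =>
    rw [distrib_symm_tmul, mul_one, LinearMap.baseChange_tmul, TensorProduct.mk_apply]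

theorem tensorMap_one_tmul {M' N' : Type*} [AddCommGroup M'] [Module (ZMod 2) M']
    [AddCommGroup N'] [Module (ZMod 2) N'] (φ : S ⊗[ZMod 2] M →ₗ[S] S ⊗[ZMod 2] M')
    (ψ : S ⊗[ZMod 2] N →ₗ[S] S ⊗[ZMod 2] N') (m : M) (n : N) :
    tensorMap φ ψ (1 ⊗ₜ (m ⊗ₜ n)) = (distrib S M' N').symm (φ (1 ⊗ₜ m) ⊗ₜ ψ (1 ⊗ₜ n)) := by
  rw [← tensorMap_distrib_symm, distrib_symm_tmul, one_mul]

/-- A morphism commutes with taking coefficients of the action over `S`. Thus its value at one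
element `s` fixes its values at all coefficients of the images of `s`. -/
theorem PolyFunctor.Hom.app_slice {F G : PolyFunctor.{u}} (h : Hom F G)
    {U V : FGModuleCat.{u} (ZMod 2)} {S : Type u} [CommRing S] [Algebra (ZMod 2) S]
    (φ : S ⊗[ZMod 2] U →ₗ[S] S ⊗[ZMod 2] V) (l : S →ₗ[ZMod 2] ZMod 2) (s : F.obj U) :
    h.app V (slice _ l (F.map φ (1 ⊗ₜ s))) = slice _ l (G.map φ (1 ⊗ₜ h.app U s)) := by
  rw [← slice_baseChange, h.naturality, LinearMap.baseChange_tmul]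

/-- The element `s` generates the functor `F`: the values of `F` are spanned by the coefficients of
the images of `s` under extensions of scalars of the action of linear maps. -/
def PolyFunctor.Generates {F : PolyFunctor.{u}} {U : FGModuleCat.{u} (ZMod 2)} (s : F.obj U) :
    Prop :=
  ∀ V : FGModuleCat.{u} (ZMod 2), Submodule.span (ZMod 2) {x : F.obj V |
    ∃ (S : Type u) (_ : CommRing S) (_ : Algebra (ZMod 2) S)
      (φ : S ⊗[ZMod 2] U →ₗ[S] S ⊗[ZMod 2] V) (l : S →ₗ[ZMod 2] ZMod 2),
      slice _ l (F.map φ (1 ⊗ₜ s)) = x} = ⊤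

theorem PolyFunctor.Generates.hom_ext {F G : PolyFunctor.{u}} {U : FGModuleCat.{u} (ZMod 2)}
    {s : F.obj U} (hs : Generates s) {h h' : Hom F G} (e : h.app U s = h'.app U s) : h = h' := by
  refine Hom.ext (funext fun V => LinearMap.ext_on (hs V) ?_)
  rintro _ ⟨S, _, _, φ, l, rfl⟩
  rw [h.app_slice, h'.app_slice, e]

/-- A morphism is determined by its value at the generator, and over `𝔽₂` the only multiples of `x`
are 0 and `x`; they belong to the zero morphism and to `h`. -/
theorem PolyFunctor.Generates.isUniqueNonzero {F G : PolyFunctor.{u}}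
    {U : FGModuleCat.{u} (ZMod 2)} {s : F.obj U} (hs : Generates s) {h : Hom F G} {x : G.obj U}
    (hx : x ≠ 0) (hh : h.app U s = x)
    (H : ∀ h' : Hom F G, ∃ c : ZMod 2, h'.app U s = c • x) : h.IsUniqueNonzero := by
  refine ⟨?_, fun h' h0 => hs.hom_ext ?_⟩
  · rintro rfl
    exact hx hh.symm
  · have : ∀ c : ZMod 2, c = 0 ∨ c = 1 := by decide
    obtain ⟨c, hc⟩ := H h'
    obtain rfl | rfl : c = 0 ∨ c = 1 := this c
    · refine absurd (hs.hom_ext ?_) h0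
      rw [hc, zero_smul]
      rfl
    · rw [hc, one_smul, hh]

end Slice

/-! ### Generators of `Γᵈ` and of `Γᵈ ⊗ I^{(1)}` -/

section Generators

variable {S : Type*} [CommRing S] [Algebra (ZMod 2) S] {M : Type*} [AddCommGroup M]
  [Module (ZMod 2) M]

theorem extSeries_sum {ι : Type*} (t : Finset ι) (x : ι → S ⊗[ZMod 2] M) :
    extSeries S (∑ i ∈ t, x i) = ∏ i ∈ t, extSeries S (x i) := by
  classical
  induction t using Finset.induction_on with
  | empty => rw [Finset.sum_empty, Finset.prod_empty, extSeries_zero]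
  | insert i t hi ih => rw [Finset.sum_insert hi, Finset.prod_insert hi, extSeries_add, ih]

theorem prod_tmul_prod {ι A B : Type*} [CommRing A] [Algebra (ZMod 2) A] [CommRing B]
    [Algebra (ZMod 2) B] (t : Finset ι) (a : ι → A) (b : ι → B) :
    ∏ i ∈ t, (a i ⊗ₜ[ZMod 2] b i) = (∏ i ∈ t, a i) ⊗ₜ[ZMod 2] ∏ i ∈ t, b i := by
  classical
  induction t using Finset.induction_on with
  | empty => rfl
  | insert i t hi ih =>
    rw [Finset.prod_insert hi, Finset.prod_insert hi, Finset.prod_insert hi, ih,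
      Algebra.TensorProduct.tmul_mul_tmul]

/-- The divided power of a generic element. -/
theorem coeff_extSeries_generic {I : Type*} [Fintype I] [DecidableEq I] (b : I → M) (d : ℕ) :
    PowerSeries.coeff d (extSeries (MvPolynomial I (ZMod 2))
      (∑ i, MvPolynomial.X i ⊗ₜ[ZMod 2] b i)) =
      ∑ n ∈ Finset.finsuppAntidiag Finset.univ d,
        MvPolynomial.monomial n 1 ⊗ₜ[ZMod 2] mono (ZMod 2) b n := by
  rw [extSeries_sum, PowerSeries.coeff_prod]
  refine Finset.sum_congr rfl fun n _ => ?_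
  simp only [extSeries_tmul, coeff_extSeriesAux]
  rw [prod_tmul_prod, mono_eq_prod b n Finset.univ (Finset.subset_univ _),
    MvPolynomial.monomial_eq, map_one, one_mul, Finsupp.prod_fintype]
  exact fun i => pow_zero _

/-- `γ_d(∑ Xᵢ bᵢ)` is the generating polynomial of the divided power monomials of degree `d`, and a
coefficient of it isolates one of them. -/
theorem slice_extSeries_generic {I : Type*} [Fintype I] (b : I → M) {d : ℕ} (n : I →₀ ℕ)
    (hn : ∑ i, n i = d) :
    slice _ (MvPolynomial.lcoeff (R := ZMod 2) n)
      (PowerSeries.coeff d (extSeries (MvPolynomial I (ZMod 2))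
        (∑ i, MvPolynomial.X i ⊗ₜ[ZMod 2] b i))) = mono (ZMod 2) b n := by
  classical
  rw [coeff_extSeries_generic, map_sum, Finset.sum_eq_single n]
  · rw [slice_tmul]
    simp
  · intro m _ hm
    rw [slice_tmul]
    simp [MvPolynomial.coeff_monomial, hm]
  · intro h
    exact absurd (Finset.mem_finsuppAntidiag.mpr ⟨hn, Finset.subset_univ _⟩) h

/-- The divided power `γₙ(m)` as an element of `Γⁿ`. -/
def dpPiece (n : ℕ) (m : M) : gamPiece (ZMod 2) M n := ⟨dp (ZMod 2) n m, dp_mem_gamPiece n m⟩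

theorem prod_dp_mem_gamPiece {I : Type*} (s : Finset I) (n : I → ℕ) (b : I → M) :
    ∏ i ∈ s, dp (ZMod 2) (n i) (b i) ∈ gamPiece (ZMod 2) M (∑ i ∈ s, n i) := by
  classical
  induction s using Finset.induction_on with
  | empty => exact one_mem_gamPiece
  | insert i s hi ih =>
    rw [Finset.prod_insert hi, Finset.sum_insert hi]
    exact mul_mem_gamPiece (dp_mem_gamPiece _ _) ih

/-- This is `gradedPiece_eq_monoSpan` for a single index. The proof transports exponents from `Unit
× I` to `I`, and the span from `Γ(M)` to the subspace `Γᵈ(M)`. -/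
theorem span_mono_gamPiece {I : Type*} [Fintype I] {b : I → M}
    (hb : Submodule.span (ZMod 2) (Set.range b) = ⊤) (d : ℕ) :
    Submodule.span (ZMod 2) {x : gamPiece (ZMod 2) M d |
      ∃ n : I →₀ ℕ, ∑ i, n i = d ∧ x.1 = mono (ZMod 2) b n} = ⊤ := by
  have h := gradedPiece_eq_monoSpan (k := ZMod 2) (fun _ : Unit => 1)
    (fun _ => (LinearMap.id : M →ₗ[ZMod 2] M)) hb d
  have h1 : gamPiece (ZMod 2) M d ≤ Submodule.span (ZMod 2)
      {x | ∃ n : I →₀ ℕ, ∑ i, n i = d ∧ x = mono (ZMod 2) b n} := by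
    refine h.le.trans (Submodule.span_mono ?_)
    rintro _ ⟨n, hn, rfl⟩
    refine ⟨n.equivMapDomain (Equiv.punitProd I), ?_, ?_⟩
    · rw [← hn, Finsupp.linearCombination_apply, Finsupp.sum_fintype _ _ (by simp)]
      exact Fintype.sum_equiv (Equiv.punitProd I).symm _ _ fun i => by simp
    · rw [mono_eq_prod _ _ Finset.univ (Finset.subset_univ _),
        mono_eq_prod _ _ Finset.univ (Finset.subset_univ _)]
      exact Fintype.prod_equiv (Equiv.punitProd I) _ _ fun i => by simp
  rw [eq_top_iff]
  rintro ⟨x, hx⟩ -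
  have h2 := h1 hx
  have h3 : (Submodule.span (ZMod 2) {x : gamPiece (ZMod 2) M d |
      ∃ n : I →₀ ℕ, ∑ i, n i = d ∧ x.1 = mono (ZMod 2) b n}).map
        (gamPiece (ZMod 2) M d).subtype = Submodule.span (ZMod 2)
      {x | ∃ n : I →₀ ℕ, ∑ i, n i = d ∧ x = mono (ZMod 2) b n} := by
    rw [Submodule.map_span]
    congr 1
    ext y
    constructor
    · rintro ⟨x, hx, rfl⟩
      exact hx
    · rintro ⟨n, hn, rfl⟩
      refine ⟨⟨mono (ZMod 2) b n, ?_⟩, ⟨n, hn, rfl⟩, rfl⟩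
      rw [mono_eq_prod b n Finset.univ (Finset.subset_univ _), ← hn]
      exact prod_dp_mem_gamPiece _ _ _
  rw [← h3] at h2
  obtain ⟨y, hy, hyx⟩ := h2
  rwa [show (⟨x, hx⟩ : gamPiece (ZMod 2) M d) = y from Subtype.ext hyx.symm]

theorem map_gammaPow_dpPiece (d : ℕ) {U V : FGModuleCat.{u} (ZMod 2)} {S : Type u} [CommRing S]
    [Algebra (ZMod 2) S] (φ : S ⊗[ZMod 2] U →ₗ[S] S ⊗[ZMod 2] V) (x : U) :
    (gamPiece (ZMod 2) V d).subtype.baseChange S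
      ((gammaPow d idF).map φ (1 ⊗ₜ dpPiece d x)) =
      PowerSeries.coeff d (extSeries S (φ (1 ⊗ₜ x))) := by
  refine (subtype_subMap (isStable_gamPiece idF d) φ _).trans ?_
  rw [LinearMap.baseChange_tmul]
  exact gammaMap_tmul_dp φ d x

theorem slice_map_dpPiece (d : ℕ) {U V : FGModuleCat.{u} (ZMod 2)} {I : Type u} [Fintype I]
    (φ : MvPolynomial I (ZMod 2) ⊗[ZMod 2] U →ₗ[MvPolynomial I (ZMod 2)]
      MvPolynomial I (ZMod 2) ⊗[ZMod 2] V) {x : U} {b : I → V}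
    (hφ : φ (1 ⊗ₜ x) = ∑ i, MvPolynomial.X i ⊗ₜ[ZMod 2] b i) {n : I →₀ ℕ} (hn : ∑ i, n i = d) :
    (slice (gamPiece (ZMod 2) V d) (MvPolynomial.lcoeff (R := ZMod 2) n)
      ((gammaPow d idF).map φ (1 ⊗ₜ dpPiece d x))).1 = mono (ZMod 2) b n := by
  have h := slice_baseChange (MvPolynomial.lcoeff (R := ZMod 2) n)
    (gamPiece (ZMod 2) V d).subtype ((gammaPow d idF).map φ (1 ⊗ₜ dpPiece d x))
  rw [map_gammaPow_dpPiece, hφ, slice_extSeries_generic b n hn] at h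
  exact h.symm

theorem exists_linearMap_eq {U V : FGModuleCat.{u} (ZMod 2)} {I : Type*}
    (c : Module.Basis I (ZMod 2) U) (S : Type u) [CommRing S] [Algebra (ZMod 2) S]
    (q : I → S ⊗[ZMod 2] V) :
    ∃ φ : S ⊗[ZMod 2] U →ₗ[S] S ⊗[ZMod 2] V, ∀ i, φ (1 ⊗ₜ c i) = q i :=
  ⟨LinearMap.liftBaseChange S (c.constr (ZMod 2) q), fun i => by
    rw [LinearMap.liftBaseChange_tmul, one_smul, Module.Basis.constr_basis]⟩

/-- When `c i` is sent to a generic vector of `V`, the coefficients of the image of `γ_d(c i)`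
include all monomials of degree `d`, which span `Γᵈ(V)`. -/
theorem generates_dpPiece (d : ℕ) {U : FGModuleCat.{u} (ZMod 2)} {I : Type*}
    (c : Module.Basis I (ZMod 2) U) (i : I) :
    Generates (F := gammaPow.{u} d idF) (U := U) (dpPiece d (c i)) := by
  intro V
  let b := Module.Free.chooseBasis (ZMod 2) V
  refine top_unique ((span_mono_gamPiece b.span_eq d).ge.trans (Submodule.span_mono ?_))
  rintro x ⟨n, hn, hx⟩
  obtain ⟨φ, hφ⟩ := exists_linearMap_eq c
    (MvPolynomial (Module.Free.ChooseBasisIndex (ZMod 2) V) (ZMod 2))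
    fun _ => ∑ i, MvPolynomial.X i ⊗ₜ[ZMod 2] b i
  refine ⟨_, inferInstance, inferInstance, φ, MvPolynomial.lcoeff (R := ZMod 2) n,
    Subtype.ext ?_⟩
  rw [hx]
  exact slice_map_dpPiece d φ (hφ i) hn

theorem map_dpPiece_tmul (d : ℕ) {U V : FGModuleCat.{u} (ZMod 2)} {S : Type u} [CommRing S]
    [Algebra (ZMod 2) S] (φ : S ⊗[ZMod 2] U →ₗ[S] S ⊗[ZMod 2] V) (x y : U) :
    ((gammaPow.{u} d idF).tensor (idF.twist 1)).map φ (1 ⊗ₜ (dpPiece d x ⊗ₜ y)) =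
      (distrib S (gamPiece (ZMod 2) V d) V).symm
        ((gammaPow d idF).map φ (1 ⊗ₜ dpPiece d x) ⊗ₜ frobT S V 1 (φ (1 ⊗ₜ y))) := by
  refine (tensorMap_one_tmul ((gammaPow.{u} d idF).map φ) ((idF.twist 1).map φ)
    (dpPiece d x) y).trans ?_
  rw [← twistMap_one_tmul]

theorem slice_map_dpPiece_tmul (d : ℕ) {U V : FGModuleCat.{u} (ZMod 2)} {S : Type u} [CommRing S]
    [Algebra (ZMod 2) S] (φ : S ⊗[ZMod 2] U →ₗ[S] S ⊗[ZMod 2] V) (l : S →ₗ[ZMod 2] ZMod 2)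
    (x : U) {y : U} {w : V} (h : φ (1 ⊗ₜ y) = 1 ⊗ₜ w) :
    slice (gamPiece (ZMod 2) V d ⊗[ZMod 2] V) l
      (((gammaPow.{u} d idF).tensor (idF.twist 1)).map φ (1 ⊗ₜ (dpPiece d x ⊗ₜ y))) =
      slice (gamPiece (ZMod 2) V d) l ((gammaPow d idF).map φ (1 ⊗ₜ dpPiece d x)) ⊗ₜ w := by
  rw [map_dpPiece_tmul, h, frobT_tmul, one_pow]
  exact slice_distrib_symm l _ w

/-- As `c i` and `c j` are independent, `c i` can go to a generic vector while `c j` goes to a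
prescribed `w`. The second tensor factor is then constant, and the coefficients include all `mono ⊗
w`. -/
theorem generates_dpPiece_tmul (d : ℕ) {U : FGModuleCat.{u} (ZMod 2)} {I : Type*}
    (c : Module.Basis I (ZMod 2) U) {i j : I} (hij : i ≠ j) :
    Generates (F := (gammaPow.{u} d idF).tensor (idF.twist 1)) (U := U)
      (dpPiece d (c i) ⊗ₜ c j) := by
  classical
  intro V
  let b := Module.Free.chooseBasis (ZMod 2) V
  rw [eq_top_iff]
  rintro t -
  induction t using TensorProduct.induction_on with
  | zero => exact zero_mem _
  | add t t' ht ht' => exact add_mem ht ht'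
  | tmul x w =>
    have hx : x ∈ Submodule.span (ZMod 2) {x : gamPiece (ZMod 2) V d |
      ∃ n, ∑ i, n i = d ∧ x.1 = mono (ZMod 2) b n} := by
      rw [span_mono_gamPiece b.span_eq d]; trivial
    induction hx using Submodule.span_induction with
    | zero => rw [TensorProduct.zero_tmul]; exact zero_mem _
    | add x y _ _ hx hy => rw [TensorProduct.add_tmul]; exact add_mem hx hy
    | smul r x _ hx => rw [← TensorProduct.smul_tmul']; exact Submodule.smul_mem _ _ hx
    | mem x hx =>
      obtain ⟨n, hn, hx⟩ := hx
      refine Submodule.subset_span ?_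
      obtain ⟨φ, hφ⟩ := exists_linearMap_eq c
        (MvPolynomial (Module.Free.ChooseBasisIndex (ZMod 2) V) (ZMod 2))
        -- The basis vectors other than `c i` may all go to `w`: only `c i` and `c j` occur in the
        -- generator.
        fun k => if k = i then ∑ i, MvPolynomial.X i ⊗ₜ[ZMod 2] b i else 1 ⊗ₜ[ZMod 2] w
      refine ⟨_, inferInstance, inferInstance, φ, MvPolynomial.lcoeff (R := ZMod 2) n, ?_⟩
      have h := slice_map_dpPiece d φ ((hφ i).trans (if_pos rfl)) hn
      rw [← hx] at h
      rw [← Subtype.ext h]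
      exact slice_map_dpPiece_tmul d φ _ _ ((hφ j).trans (if_neg (Ne.symm hij)))

end Generators

/-! ### Coordinate spaces -/

section Coordinates

/-- The vector space with basis indexed by `Fin m`, in the universe `u`. -/
def coordSpace (m : ℕ) : FGModuleCat.{u} (ZMod 2) :=
  FGModuleCat.of (ZMod 2) (ULift.{u} (Fin m) → ZMod 2)

/-- The standard basis. -/
def coordBasis (m : ℕ) : Module.Basis (Fin m) (ZMod 2) (coordSpace.{u} m) :=
  (Pi.basisFun (ZMod 2) (ULift.{u} (Fin m))).reindex Equiv.ulift

theorem dp_mul_mono_of_eq_zero {k I M : Type*} [CommRing k] [AddCommGroup M] [Module k M]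
    (v : I → M) {n : I →₀ ℕ} {i : I} (h : n i = 0) (a : ℕ) :
    dp k a (v i) * mono k v n = mono k v (n + Finsupp.single i a) := by
  rw [dp_mul_mono, h, add_zero, Nat.choose_self, one_smul]

variable {V : Type*} [AddCommGroup V] [Module (ZMod 2) V] {β : Type*}
  (c : Module.Basis β (ZMod 2) V)

theorem mono_sumBasis_ne_zero (n : (ℕ × β) →₀ ℕ) : mono (ZMod 2) (sumBasis c) n ≠ 0 :=
  (linearIndependent_mono (sumBasis c)).ne_zero n

end Coordinates

/-! ### Uniqueness of `f` -/

section FirstMorphism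

theorem exists_smul_dpPiece {M : Type*} [AddCommGroup M] [Module (ZMod 2) M]
    (c : Module.Basis (Fin 1) (ZMod 2) M) {n : ℕ} (x : gamPiece (ZMod 2) M n) :
    ∃ k : ZMod 2, x = k • dpPiece n (c 0) := by
  have hx : x ∈ Submodule.span (ZMod 2) {x : gamPiece (ZMod 2) M n |
      ∃ m, ∑ i, m i = n ∧ x.1 = mono (ZMod 2) c m} := by
    rw [span_mono_gamPiece c.span_eq n]; trivial
  have h : {x : gamPiece (ZMod 2) M n | ∃ m, ∑ i, m i = n ∧ x.1 = mono (ZMod 2) c m} ⊆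
      {dpPiece n (c 0)} := by
    rintro x ⟨m, hm, hx⟩
    refine Subtype.ext (hx.trans ?_)
    rw [mono_eq_prod _ _ Finset.univ (Finset.subset_univ _)]
    simp only [Fin.isValue, Finset.univ_unique, Fin.default_eq_zero, Finset.sum_singleton] at hm
    simp only [Finset.univ_unique, Fin.default_eq_zero, Finset.prod_singleton, hm]
    rfl
  obtain ⟨k, hk⟩ := Submodule.mem_span_singleton.mp (Submodule.span_mono h hx)
  exact ⟨k, hk.symm⟩

theorem exists_smul_dpPiece_tmul {M : Type*} [AddCommGroup M] [Module (ZMod 2) M]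
    (c : Module.Basis (Fin 1) (ZMod 2) M) {n : ℕ} (t : gamPiece (ZMod 2) M n ⊗[ZMod 2] M) :
    ∃ k : ZMod 2, t = k • (dpPiece n (c 0) ⊗ₜ c 0) := by
  induction t using TensorProduct.induction_on with
  | zero => exact ⟨0, (zero_smul _ _).symm⟩
  | add t t' ht ht' =>
    obtain ⟨a, rfl⟩ := ht
    obtain ⟨b, rfl⟩ := ht'
    exact ⟨a + b, (add_smul _ _ _).symm⟩
  | tmul x w =>
    obtain ⟨a, rfl⟩ := exists_smul_dpPiece c x
    have hw := c.sum_repr w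
    simp only [Finset.univ_unique, Fin.default_eq_zero, Finset.sum_singleton] at hw
    exact ⟨a * c.repr w 0, by
      rw [← hw, TensorProduct.smul_tmul_smul, hw]⟩

theorem multL_dpPiece_tmul (n : ℕ) {V : FGModuleCat.{u} (ZMod 2)} (x y : V) :
    (multL n).app V (dpPiece n x ⊗ₜ y) =
      dp (ZMod 2) n (Finsupp.single 0 x) * dp (ZMod 2) 1 (Finsupp.single 1 y) := by
  refine (multL_app n V _).trans ?_
  rw [LinearMap.rTensor_tmul, inclEmb_tmul]
  exact congrArg (· * _) (incl_dp 0 n x)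

theorem fMap_dpPiece {d : ℕ} (hd : 2 ≤ d) {V : FGModuleCat.{u} (ZMod 2)} (x : V) :
    (fMap d).app V (dpPiece d x) = dpPiece (d - 2) x ⊗ₜ x := by
  refine multL_injective (d - 2) V ?_
  rw [multL_fMap hd, multL_dpPiece_tmul]
  change skewDiff (shiftLin V) (incl V 0 (dp (ZMod 2) d x)) = _
  rw [incl_dp, skewDiff_dp, if_pos hd, shiftLin_single]

/-- Its image in `L(V)` is a member of the monomial basis. -/
theorem dpPiece_tmul_ne_zero (n : ℕ) {V : FGModuleCat.{u} (ZMod 2)} {β : Type*}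
    (c : Module.Basis β (ZMod 2) V) (i j : β) :
    (dpPiece n (c i) ⊗ₜ[ZMod 2] c j : gamPiece (ZMod 2) V n ⊗[ZMod 2] V) ≠ 0 := by
  classical
  intro h
  have h1 := (multL_dpPiece_tmul n (c i) (c j)).symm.trans
    ((congrArg ((multL n).app V) h).trans (map_zero _))
  rw [← sumBasis_apply c (0, i), ← sumBasis_apply c (1, j), ← mono_single (sumBasis c) (1, j),
    dp_mul_mono_of_eq_zero _ (by simp)] at h1
  exact mono_sumBasis_ne_zero c _ h1

/-- `Γᵈ` is generated by `γ_d(x)` on the line spanned by `x`. On this line the target is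
one-dimensional, spanned by `γ_{d-2}(x) ⊗ x`, which is the value of `f`. -/
theorem isUniqueNonzero_fMap {d : ℕ} (hd : 2 ≤ d) : (fMap.{u} d).IsUniqueNonzero :=
  (generates_dpPiece d (coordBasis 1) 0).isUniqueNonzero
    (dpPiece_tmul_ne_zero (d - 2) (coordBasis 1) 0 0) (fMap_dpPiece hd _)
    (fun _ => exists_smul_dpPiece_tmul (coordBasis 1) _)

end FirstMorphism

/-! ### Weight vectors for diagonal actions -/

section SecondMorphism

/-- The grading by `ℕ →₀ ℕ` records the degree in each `V^{(r)}` separately. It refines weight and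
degree, and gives the number of factors from `V` and from `V^{(1)}`. -/
theorem incl_mem_gradedPiece {V : Type*} [AddCommGroup V] [Module (ZMod 2) V] (r : ℕ) {n : ℕ}
    {x : Gam (ZMod 2) V} (hx : x ∈ gamPiece (ZMod 2) V n) :
    incl V r x ∈ gradedPiece (k := ZMod 2) (fun r : ℕ => Finsupp.single r 1)
      (fun r (v : V) => Finsupp.single r v) (Finsupp.single r n) := by
  refine gamPiece_induction (P := fun n x => incl V r x ∈ gradedPiece (k := ZMod 2)
    (fun r : ℕ => Finsupp.single r 1) (fun r (v : V) => Finsupp.single r v) (Finsupp.single r n))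
    ?_ (fun d => ?_) (fun d x y hx hy => ?_) (fun d n x m _ hx => ?_) hx
  · rw [map_one, Finsupp.single_zero]; exact one_mem_gradedPiece
  · rw [map_zero]; exact zero_mem _
  · rw [map_add]; exact add_mem hx hy
  · rw [map_mul, incl_dp]
    have h1 := dp_mem_gradedPiece (k := ZMod 2) (w := fun r : ℕ => Finsupp.single r 1)
      (j := fun r (v : V) => Finsupp.single r v) r n m
    rw [Finsupp.smul_single, smul_eq_mul, mul_one] at h1
    rw [Finsupp.single_add]
    exact mul_mem_gradedPiece h1 hx

theorem multTwo_mem_gradedPiece (n : ℕ) (V : FGModuleCat.{u} (ZMod 2))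
    (t : gamPiece (ZMod 2) V n ⊗[ZMod 2] gamPiece (ZMod 2) V 2) :
    (multTwo n).app V t ∈ gradedPiece (k := ZMod 2) (fun r : ℕ => Finsupp.single r 1)
      (fun r (v : V) => Finsupp.single r v) (Finsupp.single 0 n + Finsupp.single 1 2) := by
  rw [multTwo_app]
  induction t using TensorProduct.induction_on with
  | zero => rw [map_zero, map_zero]; exact zero_mem _
  | add t t' ht ht' => rw [map_add, map_add]; exact add_mem ht ht'
  | tmul x y =>
    rw [TensorProduct.map_tmul, inclMul_tmul]
    exact mul_mem_gradedPiece (incl_mem_gradedPiece 0 x.2) (incl_mem_gradedPiece 1 y.2)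

theorem gammaMap_mono {S M I : Type*} [CommRing S] [Algebra (ZMod 2) S] [AddCommGroup M]
    [Module (ZMod 2) M] {v : I → M} {ψ : S ⊗[ZMod 2] M →ₗ[S] S ⊗[ZMod 2] M} {χ : I → S}
    (hψ : ∀ i, ψ (1 ⊗ₜ v i) = χ i ⊗ₜ v i) (n : I →₀ ℕ) :
    gammaMap ψ (1 ⊗ₜ mono (ZMod 2) v n) =
      (n.prod fun i a => χ i ^ a) ⊗ₜ mono (ZMod 2) v n := by
  have h := prod_tmul_prod n.support (fun _ => (1 : S)) fun i => dp (ZMod 2) (n i) (v i)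
  rw [Finset.prod_const_one] at h
  rw [mono, Finsupp.prod, ← h, map_prod, Finsupp.prod, ← prod_tmul_prod]
  refine Finset.prod_congr rfl fun i _ => ?_
  rw [gammaMap_tmul_dp, hψ, extSeries_tmul, coeff_extSeriesAux]

/-- Each monomial is an eigenvector of a diagonal map, so the map multiplies each coordinate by the
corresponding product of eigenvalues. -/
theorem repr_gammaMap {S M I : Type*} [CommRing S] [Algebra (ZMod 2) S] [AddCommGroup M]
    [Module (ZMod 2) M] {b : Module.Basis I (ZMod 2) M} {ψ : S ⊗[ZMod 2] M →ₗ[S] S ⊗[ZMod 2] M}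
    {χ : I → S} (hψ : ∀ i, ψ (1 ⊗ₜ b i) = χ i ⊗ₜ b i) (z : Gam (ZMod 2) M) (n : I →₀ ℕ) :
    ((monoBasis b).coord n).lTensor S (gammaMap ψ (1 ⊗ₜ z)) =
      (n.prod fun i a => χ i ^ a) ⊗ₜ (monoBasis b).coord n z := by
  have hz : z ∈ Submodule.span (ZMod 2) (Set.range (monoBasis b)) := by
    rw [(monoBasis b).span_eq]; trivial
  induction hz using Submodule.span_induction with
  | zero => simp only [TensorProduct.tmul_zero, map_zero]
  | add x y _ _ hx hy => simp only [TensorProduct.tmul_add, map_add, hx, hy]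
  | smul r x _ hx =>
    rw [TensorProduct.tmul_smul, ← AlgHom.coe_restrictScalars' (ZMod 2), map_smul, map_smul,
      AlgHom.coe_restrictScalars', hx, map_smul, TensorProduct.tmul_smul]
  | mem x hx =>
    obtain ⟨m, rfl⟩ := hx
    rw [monoBasis_apply, gammaMap_mono hψ, LinearMap.lTensor_tmul, ← monoBasis_apply]
    by_cases h : m = n
    · rw [h]
    · rw [Module.Basis.coord_apply, Module.Basis.repr_self, Finsupp.single_eq_of_ne' h,
        TensorProduct.tmul_zero, TensorProduct.tmul_zero]

/-- The exponents in a weight vector for a diagonal action. -/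
theorem prod_eq_of_gammaMap_eq {S M I : Type*} [CommRing S] [Algebra (ZMod 2) S] [AddCommGroup M]
    [Module (ZMod 2) M] {b : Module.Basis I (ZMod 2) M} {ψ : S ⊗[ZMod 2] M →ₗ[S] S ⊗[ZMod 2] M}
    {χ : I → S} (hψ : ∀ i, ψ (1 ⊗ₜ b i) = χ i ⊗ₜ b i) {z : Gam (ZMod 2) M} {s : S}
    (hz : gammaMap ψ (1 ⊗ₜ z) = s ⊗ₜ z) {n : I →₀ ℕ} (hn : (monoBasis b).repr z n ≠ 0) :
    (n.prod fun i a => χ i ^ a) = s := by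
  have h := repr_gammaMap hψ z n
  -- A nonzero scalar of `𝔽₂` is 1, so the eigenvalues can be compared after cancelling the
  -- coordinate.
  have h1 : (monoBasis b).coord n z = 1 := by
    have : ∀ k : ZMod 2, k ≠ 0 → k = 1 := by decide
    exact this _ hn
  rw [hz, LinearMap.lTensor_tmul, h1] at h
  have := congrArg (TensorProduct.rid (ZMod 2) S) h
  rwa [TensorProduct.rid_tmul, TensorProduct.rid_tmul, one_smul, one_smul, eq_comm] at this

theorem sumMap_one_tmul_of_eq_tmul {S M N : Type*} [CommRing S] [Algebra (ZMod 2) S]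
    [AddCommGroup M] [Module (ZMod 2) M] [AddCommGroup N] [Module (ZMod 2) N]
    {φ : S ⊗[ZMod 2] M →ₗ[S] S ⊗[ZMod 2] N} {m : M} {s : S} {w : N} (h : φ (1 ⊗ₜ m) = s ⊗ₜ w)
    (r : ℕ) : sumMap φ (1 ⊗ₜ Finsupp.single r m) = (s ^ 2 ^ r) ⊗ₜ Finsupp.single r w := by
  rw [sumMap_one_tmul, twistMap_one_tmul, h, frobT_tmul, LinearMap.baseChange_tmul]
  rfl

theorem map_gammaPow_dpPiece_of_eq_tmul (d : ℕ) {U V : FGModuleCat.{u} (ZMod 2)} {S : Type u}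
    [CommRing S] [Algebra (ZMod 2) S] {φ : S ⊗[ZMod 2] U →ₗ[S] S ⊗[ZMod 2] V} {x : U} {w : V}
    (h : φ (1 ⊗ₜ x) = 1 ⊗ₜ w) :
    (gammaPow d idF).map φ (1 ⊗ₜ dpPiece d x) = 1 ⊗ₜ dpPiece d w := by
  refine baseChange_subtype_injective S _ ?_
  rw [map_gammaPow_dpPiece, h, extSeries_tmul, coeff_extSeriesAux, one_pow,
    LinearMap.baseChange_tmul]
  rfl

/-- The polynomial ring in one variable over the field with two elements, in the universe `u`. -/
abbrev PolyTwo : Type u := Polynomial (ULift.{u} (ZMod 2))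

/-- The linear form on polynomials that takes the coefficient of the variable. -/
def linCoeff : PolyTwo.{u} →ₗ[ZMod 2] ZMod 2 :=
  ULift.moduleEquiv.toLinearMap ∘ₗ (Polynomial.lcoeff (ULift.{u} (ZMod 2)) 1).restrictScalars _

theorem linCoeff_X_pow (n : ℕ) : linCoeff.{u} (Polynomial.X ^ n) = if n = 1 then 1 else 0 := by
  change ((Polynomial.X ^ n : PolyTwo.{u}).coeff 1).down = _
  rw [Polynomial.coeff_X_pow]
  split_ifs with h1 h2 h2
  · rfl
  · exact absurd h1.symm h2
  · exact absurd h2.symm h1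
  · rfl

/-- The exponents of monomials of given degree and weight. -/
theorem exponent_cases {N : ℕ} {n : (ℕ × Fin 3) →₀ ℕ}
    (h1 : Finsupp.linearCombination ℕ (fun p : ℕ × Fin 3 => Finsupp.single p.1 1) n =
      Finsupp.single 0 N + Finsupp.single 1 2)
    (h2 : (n.sum fun p a => (![0, 1, 3] : Fin 3 → ℕ) p.2 * 2 ^ p.1 * a) = 2) :
    n.support ⊆ {0, 1} ×ˢ Finset.univ ∧ n (0, 2) = 0 ∧ n (1, 2) = 0 ∧
      (n (0, 0) = N ∧ n (0, 1) = 0 ∧ n (1, 0) = 1 ∧ n (1, 1) = 1 ∨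
        n (0, 0) = N - 2 ∧ n (0, 1) = 2 ∧ n (1, 0) = 2 ∧ n (1, 1) = 0) := by
  have hr : ∀ r, (n.sum fun p a => a * Finsupp.single p.1 1 r) =
      (Finsupp.single 0 N + Finsupp.single 1 2 : ℕ →₀ ℕ) r := by
    intro r
    rw [← h1, Finsupp.linearCombination_apply, Finsupp.sum, Finsupp.sum, Finsupp.finsetSum_apply]
    rfl
  have hs : n.support ⊆ {0, 1} ×ˢ Finset.univ := by
    intro p hp
    by_contra hp1
    simp only [Finset.mem_product, Finset.mem_insert, Finset.mem_singleton, Finset.mem_univ,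
      and_true, not_or] at hp1
    have h := hr p.1
    rw [Finsupp.add_apply, Finsupp.single_eq_of_ne hp1.1, Finsupp.single_eq_of_ne hp1.2,
      Finsupp.sum, add_zero, Finset.sum_eq_zero_iff] at h
    have := h p hp
    rw [Finsupp.single_eq_same, mul_one] at this
    exact Finsupp.mem_support_iff.mp hp this
  have h0 := hr 0
  have h1 := hr 1
  rw [Finsupp.sum_of_support_subset n hs _ (by simp)] at h0 h1 h2
  rw [Finset.sum_product] at h0 h1 h2
  simp [Fin.sum_univ_three] at h0 h1 h2
  -- A factor from the third basis vector would contribute at least 3 to a total weight of 2.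
  have h3 : n (0, 2) = 0 := by
    by_contra h
    have : 3 ≤ 3 * n (0, 2) := by omega
    omega
  have h4 : n (1, 2) = 0 := by omega
  have h5 : n (1, 1) = 0 ∨ n (1, 1) = 1 := by omega
  refine ⟨hs, h3, h4, ?_⟩
  omega

end SecondMorphism

/-! ### Uniqueness of `g` -/

section WeightVectors

variable {V : FGModuleCat.{u} (ZMod 2)} (c : Module.Basis (Fin 3) (ZMod 2) V)

/-- The diagonal action with weights `0, 1, 3` on a three dimensional space. -/
theorem exists_diagonal : ∃ φ : PolyTwo.{u} ⊗[ZMod 2] V →ₗ[PolyTwo.{u}] PolyTwo.{u} ⊗[ZMod 2] V,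
    ∀ i, φ (1 ⊗ₜ c i) = (Polynomial.X ^ (![0, 1, 3] : Fin 3 → ℕ) i) ⊗ₜ c i :=
  exists_linearMap_eq c PolyTwo.{u} _

/-- Two gradings restrict the monomials of `z`: there are `N` factors from `V` and two from
`V^{(1)}`, and the diagonal weight is 2, where vectors of `V^{(1)}` count twice. So either `c 1`
occurs once in `V^{(1)}`, or it occurs with exponent 2 in `V`. The weight 3 of `c 2` keeps that
vector out and leaves it free for the additivity test. For `N < 2` the second case does not arise,
and the truncated `N - 2` is harmless. -/
theorem mem_span_pair_of_gammaMap_eq {N : ℕ} {z : Gam (ZMod 2) (ℕ →₀ V)}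
    (hz : z ∈ gradedPiece (k := ZMod 2) (fun r : ℕ => Finsupp.single r 1)
      (fun r (v : V) => Finsupp.single r v) (Finsupp.single 0 N + Finsupp.single 1 2))
    {φ : PolyTwo.{u} ⊗[ZMod 2] V →ₗ[PolyTwo.{u}] PolyTwo.{u} ⊗[ZMod 2] V}
    (hφ : ∀ i, φ (1 ⊗ₜ c i) = (Polynomial.X ^ (![0, 1, 3] : Fin 3 → ℕ) i) ⊗ₜ c i)
    (h : gammaMap (sumMap φ) (1 ⊗ₜ z) = (Polynomial.X ^ 2 : PolyTwo.{u}) ⊗ₜ z) :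
    z ∈ Submodule.span (ZMod 2)
      {dp (ZMod 2) N (Finsupp.single 0 (c 0)) * dp (ZMod 2) 1 (Finsupp.single 1 (c 0)) *
          dp (ZMod 2) 1 (Finsupp.single 1 (c 1)),
        dp (ZMod 2) (N - 2) (Finsupp.single 0 (c 0)) * dp (ZMod 2) 2 (Finsupp.single 0 (c 1)) *
          dp (ZMod 2) 2 (Finsupp.single 1 (c 0))} := by
  have hsupp : ∀ n, (monoBasis (sumBasis c)).repr z n ≠ 0 →
      Finsupp.linearCombination ℕ (fun p : ℕ × Fin 3 => Finsupp.single p.1 1) n =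
        Finsupp.single 0 N + Finsupp.single 1 2 := by
    intro n hn
    have e := gradedPiece_eq_monoSpan (k := ZMod 2) (fun r : ℕ => Finsupp.single r 1)
      (fun r => (Finsupp.lsingle r : V →ₗ[ZMod 2] ℕ →₀ V)) c.span_eq
      (Finsupp.single 0 N + Finsupp.single 1 2)
    have hz1 := e.le hz
    have hv : (fun p : ℕ × Fin 3 => (Finsupp.lsingle p.1 : V →ₗ[ZMod 2] ℕ →₀ V) (c p.2)) =
        sumBasis c := funext fun p => (sumBasis_apply c p).symm
    rw [hv, monoSpan, ← show ⇑(monoBasis (sumBasis c)) = mono (ZMod 2) (sumBasis c) from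
      funext (monoBasis_apply _), Module.Basis.mem_span_image] at hz1
    exact hz1 (Finsupp.mem_support_iff.mpr hn)
  have hwt : ∀ n, (monoBasis (sumBasis c)).repr z n ≠ 0 →
      (n.sum fun p a => (![0, 1, 3] : Fin 3 → ℕ) p.2 * 2 ^ p.1 * a) = 2 := by
    intro n hn
    have h1 := prod_eq_of_gammaMap_eq (b := sumBasis c)
      (χ := fun p => Polynomial.X ^ ((![0, 1, 3] : Fin 3 → ℕ) p.2 * 2 ^ p.1)) (fun p => by
        rw [sumBasis_apply, sumMap_one_tmul_of_eq_tmul (hφ p.2), pow_mul]) h hn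
    simp only [← pow_mul] at h1
    rw [Finsupp.prod, Finset.prod_pow_eq_pow_sum] at h1
    have := congrArg Polynomial.natDegree h1
    rwa [Polynomial.natDegree_X_pow, Polynomial.natDegree_X_pow] at this
  have hrepr := (monoBasis (sumBasis c)).linearCombination_repr z
  rw [← hrepr, Finsupp.linearCombination_apply, Finsupp.sum]
  refine Submodule.sum_mem _ fun n hn => Submodule.smul_mem _ _ ?_
  have hn := Finsupp.mem_support_iff.mp hn
  obtain ⟨hs, h02, h12, h⟩ := exponent_cases (hsupp n hn) (hwt n hn)
  rw [monoBasis_apply, mono_eq_prod _ n _ hs, Finset.prod_product,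
    Finset.prod_pair zero_ne_one, Fin.prod_univ_three, Fin.prod_univ_three]
  simp only [sumBasis_apply, h02, h12, dp_zero, mul_one]
  obtain ⟨h00, h01, h10, h11⟩ | ⟨h00, h01, h10, h11⟩ := h
  · rw [h00, h01, h10, h11, dp_zero, mul_one, ← mul_assoc]
    exact Submodule.subset_span (Set.mem_insert _ _)
  · rw [h00, h01, h10, h11, dp_zero, mul_one]
    exact Submodule.subset_span (Set.mem_insert_of_mem _ rfl)

theorem gammaMap_dp_of_eq_tmul {S : Type*} [CommRing S] [Algebra (ZMod 2) S] {M N : Type*}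
    [AddCommGroup M] [Module (ZMod 2) M] [AddCommGroup N] [Module (ZMod 2) N]
    {φ : S ⊗[ZMod 2] M →ₗ[S] S ⊗[ZMod 2] N} {m : M} {w : N} (h : φ (1 ⊗ₜ m) = 1 ⊗ₜ w) (r n : ℕ) :
    gammaMap (sumMap φ) (1 ⊗ₜ dp (ZMod 2) n (Finsupp.single r m)) =
      1 ⊗ₜ dp (ZMod 2) n (Finsupp.single r w) := by
  rw [gammaMap_tmul_dp, sumMap_one_tmul_of_eq_tmul h, one_pow, extSeries_tmul,
    coeff_extSeriesAux, one_pow]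

theorem gammaMap_dp_of_eq_add {S : Type*} [CommRing S] [Algebra (ZMod 2) S] {M N : Type*}
    [AddCommGroup M] [Module (ZMod 2) M] [AddCommGroup N] [Module (ZMod 2) N]
    {φ : S ⊗[ZMod 2] M →ₗ[S] S ⊗[ZMod 2] N} {m : M} {v w : N} {s : S}
    (h : φ (1 ⊗ₜ m) = 1 ⊗ₜ v + s ⊗ₜ w) (r n : ℕ) :
    gammaMap (sumMap φ) (1 ⊗ₜ dp (ZMod 2) n (Finsupp.single r m)) =
      ∑ p ∈ Finset.HasAntidiagonal.antidiagonal n, ((s ^ 2 ^ r) ^ p.2) ⊗ₜ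
        (dp (ZMod 2) p.1 (Finsupp.single r v) * dp (ZMod 2) p.2 (Finsupp.single r w)) := by
  rw [gammaMap_tmul_dp, sumMap_one_tmul, twistMap_one_tmul, h, map_add, frobT_tmul, frobT_tmul,
    map_add, LinearMap.baseChange_tmul, LinearMap.baseChange_tmul, extSeries_add,
    PowerSeries.coeff_mul]
  refine Finset.sum_congr rfl fun p _ => ?_
  rw [extSeries_tmul, extSeries_tmul, coeff_extSeriesAux, coeff_extSeriesAux,
    Algebra.TensorProduct.tmul_mul_tmul, one_pow, one_pow, one_mul]
  rfl

theorem one_tmul_mul {S B : Type*} [CommRing S] [Algebra (ZMod 2) S] [CommRing B]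
    [Algebra (ZMod 2) B] (x y : B) :
    (1 : S) ⊗ₜ[ZMod 2] (x * y) = (1 ⊗ₜ x) * (1 ⊗ₜ y) := by
  rw [Algebra.TensorProduct.tmul_mul_tmul, one_mul]

variable {φ : PolyTwo.{u} ⊗[ZMod 2] V →ₗ[PolyTwo.{u}] PolyTwo.{u} ⊗[ZMod 2] V}

/-- Here `c 1` occurs only in `V^{(1)}`, where `X` enters as `X ^ 2`; the image has no term linear
in `X`. -/
theorem slice_gammaMap_first (hx : φ (1 ⊗ₜ c 0) = 1 ⊗ₜ c 0)
    (hy : φ (1 ⊗ₜ c 1) = 1 ⊗ₜ c 1 + Polynomial.X ⊗ₜ c 2) (N : ℕ) :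
    slice _ linCoeff.{u} (gammaMap (sumMap φ) (1 ⊗ₜ (dp (ZMod 2) N (Finsupp.single 0 (c 0)) *
      dp (ZMod 2) 1 (Finsupp.single 1 (c 0)) * dp (ZMod 2) 1 (Finsupp.single 1 (c 1))))) = 0 := by
  rw [one_tmul_mul, one_tmul_mul, map_mul (gammaMap (sumMap φ)), map_mul (gammaMap (sumMap φ)),
    gammaMap_dp_of_eq_tmul hx,
    gammaMap_dp_of_eq_tmul hx, gammaMap_dp_of_eq_add hy, Finset.mul_sum, map_sum]
  refine Finset.sum_eq_zero fun p _ => ?_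
  rw [Algebra.TensorProduct.tmul_mul_tmul, Algebra.TensorProduct.tmul_mul_tmul, one_mul, one_mul,
    slice_tmul, ← pow_mul, linCoeff_X_pow, if_neg (by omega), zero_smul]

/-- `γ₂(y + X z)` has the linear term `X γ₁(y) γ₁(z)`, so the coefficient of `X` is a single
monomial of the basis. -/
theorem slice_gammaMap_second (hx : φ (1 ⊗ₜ c 0) = 1 ⊗ₜ c 0)
    (hy : φ (1 ⊗ₜ c 1) = 1 ⊗ₜ c 1 + Polynomial.X ⊗ₜ c 2) (N : ℕ) :
    slice _ linCoeff.{u} (gammaMap (sumMap φ) (1 ⊗ₜ (dp (ZMod 2) N (Finsupp.single 0 (c 0)) *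
      dp (ZMod 2) 2 (Finsupp.single 0 (c 1)) * dp (ZMod 2) 2 (Finsupp.single 1 (c 0))))) ≠ 0 := by
  classical
  rw [one_tmul_mul, one_tmul_mul, map_mul (gammaMap (sumMap φ)), map_mul (gammaMap (sumMap φ)),
    gammaMap_dp_of_eq_tmul hx,
    gammaMap_dp_of_eq_tmul hx, gammaMap_dp_of_eq_add hy, Finset.mul_sum, Finset.sum_mul, map_sum,
    Finset.sum_eq_single (1, 1)]
  · rw [Algebra.TensorProduct.tmul_mul_tmul, Algebra.TensorProduct.tmul_mul_tmul, one_mul, mul_one,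
      slice_tmul, ← pow_mul, linCoeff_X_pow, if_pos (by norm_num), one_smul]
    have h : dp (ZMod 2) N (Finsupp.single 0 (c 0)) * (dp (ZMod 2) 1 (Finsupp.single 0 (c 1)) *
        dp (ZMod 2) 1 (Finsupp.single 0 (c 2))) * dp (ZMod 2) 2 (Finsupp.single 1 (c 0)) =
        dp (ZMod 2) N (sumBasis c (0, 0)) * (dp (ZMod 2) 1 (sumBasis c (0, 1)) *
          (dp (ZMod 2) 1 (sumBasis c (0, 2)) *
            mono (ZMod 2) (sumBasis c) (Finsupp.single (1, 0) 2))) := by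
      rw [mono_single]
      simp only [sumBasis_apply, mul_assoc]
    rw [h, dp_mul_mono_of_eq_zero, dp_mul_mono_of_eq_zero, dp_mul_mono_of_eq_zero]
    · exact mono_sumBasis_ne_zero c _
    all_goals simp
  · intro p hp hp1
    rw [Algebra.TensorProduct.tmul_mul_tmul, Algebra.TensorProduct.tmul_mul_tmul, one_mul, mul_one,
      slice_tmul, ← pow_mul, linCoeff_X_pow, if_neg, zero_smul]
    intro h
    rw [Finset.HasAntidiagonal.mem_antidiagonal] at hp
    exact hp1 (Prod.ext (by simp at h ⊢; omega) (by simp at h ⊢; omega))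
  · intro h
    exact absurd (by simp) h

/-- The value of a morphism on an element of weight two that is additive in the second basis
vector. -/
theorem exists_multTwo_app_eq {F : PolyFunctor.{u}} {N : ℕ}
    (h : Hom F ((gammaPow N idF).tensor (gammaPow 2 (idF.twist 1)))) {s : F.obj V}
    (hs : ∀ φ : PolyTwo.{u} ⊗[ZMod 2] V →ₗ[PolyTwo.{u}] PolyTwo.{u} ⊗[ZMod 2] V,
      (∀ i, φ (1 ⊗ₜ c i) = (Polynomial.X ^ (![0, 1, 3] : Fin 3 → ℕ) i) ⊗ₜ c i) →
      F.map φ (1 ⊗ₜ s) = (Polynomial.X ^ 2 : PolyTwo.{u}) ⊗ₜ s)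
    (hs' : ∀ φ : PolyTwo.{u} ⊗[ZMod 2] V →ₗ[PolyTwo.{u}] PolyTwo.{u} ⊗[ZMod 2] V,
      φ (1 ⊗ₜ c 0) = 1 ⊗ₜ c 0 → φ (1 ⊗ₜ c 1) = 1 ⊗ₜ c 1 + Polynomial.X ⊗ₜ c 2 →
      slice _ linCoeff.{u} (F.map φ (1 ⊗ₜ s)) = 0) :
    ∃ a : ZMod 2, (multTwo N).app V (h.app V s) =
      a • (dp (ZMod 2) N (Finsupp.single 0 (c 0)) * dp (ZMod 2) 1 (Finsupp.single 1 (c 0)) *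
          dp (ZMod 2) 1 (Finsupp.single 1 (c 1))) := by
  obtain ⟨φ, hφ⟩ := exists_diagonal c
  -- By naturality for the diagonal map, the value at `s` is a weight vector of the same weight as
  -- `s`.
  have h1 := mem_span_pair_of_gammaMap_eq c (multTwo_mem_gradedPiece N V (h.app V s)) hφ (by
    have := ((multTwo N).comp h).naturality φ (1 ⊗ₜ s)
    rw [hs φ hφ, LinearMap.baseChange_tmul, LinearMap.baseChange_tmul] at this
    exact this.symm)
  obtain ⟨a, b, hab⟩ := Submodule.mem_span_pair.mp h1
  obtain ⟨ψ, hψ⟩ := exists_linearMap_eq c PolyTwo.{u}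
    ![1 ⊗ₜ[ZMod 2] c 0, 1 ⊗ₜ[ZMod 2] c 1 + Polynomial.X ⊗ₜ[ZMod 2] c 2, 1 ⊗ₜ[ZMod 2] c 2]
  have hx : ψ (1 ⊗ₜ c 0) = 1 ⊗ₜ c 0 := hψ 0
  have hy : ψ (1 ⊗ₜ c 1) = 1 ⊗ₜ c 1 + Polynomial.X ⊗ₜ c 2 := hψ 1
  -- Naturality for `c 1 ↦ c 1 + X c 2`: the linear coefficient vanishes at `s`, hence at its value,
  -- and this excludes the second monomial.
  have h2 : slice _ linCoeff.{u} (gammaMap (sumMap ψ) (1 ⊗ₜ (multTwo N).app V (h.app V s))) = 0 := by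
    have := ((multTwo N).comp h).app_slice ψ linCoeff.{u} s
    rw [hs' ψ hx hy, map_zero] at this
    exact this.symm
  have h3 : ∀ k : ZMod 2, k = 0 ∨ k = 1 := by decide
  refine ⟨a, ?_⟩
  rw [← hab]
  obtain rfl | rfl := h3 b
  · rw [zero_smul, add_zero]
  · refine absurd ?_ (slice_gammaMap_second c hx hy (N - 2))
    rw [← hab, TensorProduct.tmul_add, map_add, map_add, one_smul] at h2
    obtain rfl | rfl := h3 a
    · rwa [zero_smul, TensorProduct.tmul_zero, map_zero, map_zero, zero_add] at h2
    · rwa [one_smul, slice_gammaMap_first c hx hy, zero_add] at h2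

theorem map_dpPiece_tmul_of_eq (d : ℕ) {x y : V} (hx : φ (1 ⊗ₜ x) = 1 ⊗ₜ x) :
    ((gammaPow.{u} d idF).tensor (idF.twist 1)).map φ (1 ⊗ₜ (dpPiece d x ⊗ₜ y)) =
      (TensorProduct.mk (ZMod 2) (gamPiece (ZMod 2) V d) V (dpPiece d x)).baseChange PolyTwo.{u}
        (frobT PolyTwo.{u} V 1 (φ (1 ⊗ₜ y))) := by
  rw [map_dpPiece_tmul, map_gammaPow_dpPiece_of_eq_tmul d hx]
  exact distrib_symm_one_tmul _ _

theorem map_diagonal_generator (d : ℕ)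
    (hφ : ∀ i, φ (1 ⊗ₜ c i) = (Polynomial.X ^ (![0, 1, 3] : Fin 3 → ℕ) i) ⊗ₜ c i) :
    ((gammaPow.{u} d idF).tensor (idF.twist 1)).map φ (1 ⊗ₜ (dpPiece d (c 0) ⊗ₜ c 1)) =
      (Polynomial.X ^ 2 : PolyTwo.{u}) ⊗ₜ (dpPiece d (c 0) ⊗ₜ c 1) := by
  have h0 := hφ 0
  have h1 := hφ 1
  simp only [Matrix.cons_val_zero, Matrix.cons_val_one, pow_zero, pow_one] at h0 h1
  rw [map_dpPiece_tmul_of_eq d h0, h1, frobT_tmul, LinearMap.baseChange_tmul, pow_one,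
    TensorProduct.mk_apply]

/-- The vector `c 1` enters through the Frobenius twist, which is additive and squares `X`, so no
linear term appears. -/
theorem slice_map_generator (d : ℕ) (hx : φ (1 ⊗ₜ c 0) = 1 ⊗ₜ c 0)
    (hy : φ (1 ⊗ₜ c 1) = 1 ⊗ₜ c 1 + Polynomial.X ⊗ₜ c 2) :
    slice (gamPiece (ZMod 2) V d ⊗[ZMod 2] V) linCoeff.{u}
      (((gammaPow.{u} d idF).tensor (idF.twist 1)).map φ (1 ⊗ₜ (dpPiece d (c 0) ⊗ₜ c 1))) = 0 := by
  have h : slice V linCoeff.{u} (frobT PolyTwo.{u} V 1 (φ (1 ⊗ₜ c 1))) = 0 := by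
    rw [hy, map_add, frobT_tmul, frobT_tmul, map_add, slice_tmul, slice_tmul, one_pow,
      ← pow_zero Polynomial.X, linCoeff_X_pow, linCoeff_X_pow, if_neg (by omega),
      if_neg (by omega), zero_smul, zero_smul, add_zero]
  rw [map_dpPiece_tmul_of_eq d hx]
  exact (slice_baseChange _ _ _).trans ((congrArg _ h).trans (map_zero _))

theorem multTwo_gMap_generator {d : ℕ} (hd : 4 ≤ d) :
    (multTwo (d - 4)).app V ((gMap d).app V (dpPiece (d - 2) (c 0) ⊗ₜ c 1)) =
      dp (ZMod 2) (d - 4) (Finsupp.single 0 (c 0)) * dp (ZMod 2) 1 (Finsupp.single 1 (c 0)) *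
        dp (ZMod 2) 1 (Finsupp.single 1 (c 1)) := by
  rw [multTwo_gMap hd, multL_dpPiece_tmul, skewDiff_mul, skewDiff_dp, skewDiff_dp,
    if_neg (by omega), if_pos (by omega), mul_zero, zero_add, shiftLin_single, Nat.sub_sub]

end WeightVectors

/-- The generator is `γ_{d-2}(x) ⊗ y`, taken in dimension 3 so that a third vector is available as a
direction in which to vary `y`. Any morphism sends it to a multiple of `γ_{d-4}(x) ⊗ γ₁(x) γ₁(y)`,
which is the value of `g` and is nonzero because its image in `L(V)` is a basis monomial. -/
theorem isUniqueNonzero_gMap {d : ℕ} (hd : 4 ≤ d) : (gMap.{u} d).IsUniqueNonzero := by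
  classical
  refine (generates_dpPiece_tmul (d - 2) (coordBasis 3)
    (zero_ne_one : (0 : Fin 3) ≠ 1)).isUniqueNonzero ?_ rfl fun h => ?_
  · intro h
    have h1 := multTwo_gMap_generator (coordBasis.{u} 3) hd
    rw [h, map_zero, ← sumBasis_apply (coordBasis.{u} 3) (0, 0),
      ← sumBasis_apply (coordBasis.{u} 3) (1, 0), ← sumBasis_apply (coordBasis.{u} 3) (1, 1),
      ← mono_single (sumBasis (coordBasis.{u} 3)) (1, 1), mul_assoc,
      dp_mul_mono_of_eq_zero _ (by simp), dp_mul_mono_of_eq_zero _ (by simp)] at h1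
    exact mono_sumBasis_ne_zero _ _ h1.symm
  · obtain ⟨a, ha⟩ := exists_multTwo_app_eq (coordBasis.{u} 3) h
      (fun _ hφ => map_diagonal_generator (coordBasis 3) (d - 2) hφ)
      (fun _ hx hy => slice_map_generator (coordBasis 3) (d - 2) hx hy)
    refine ⟨a, multTwo_injective (d - 4) _ ?_⟩
    rw [ha, ← multTwo_gMap_generator (coordBasis.{u} 3) hd, map_smul]

end SkewKoszul

end

theorem mainTheorem7 (d : ℕ) :
    -- the top piece is the exterior power
    (∃ e : PolyFunctor.Hom (PolyFunctor.Lam.{u} d) (SK d d), e.IsIso ∧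
      ∀ (V : FGModuleCat.{u} (ZMod 2)) (v : Fin d → V),
        (SKtoL d d).app V (e.app V (exteriorPower.ιMulti (ZMod 2) d v)) = ∏ t, gen 0 (v t)) ∧
    -- the next piece for `d = 1, 2, 3`
    (d = 1 → ∀ V : FGModuleCat.{u} (ZMod 2), Subsingleton ((SK d (d - 1)).obj V)) ∧
    (d = 2 → ∃ e : PolyFunctor.Hom (PolyFunctor.idF.{u}.twist 1) (SK d (d - 1)), e.IsIso ∧
      ∀ (V : FGModuleCat.{u} (ZMod 2)) (w : V),
        (SKtoL d (d - 1)).app V (e.app V w) = gen 1 w) ∧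
    (d = 3 → ∃ e : PolyFunctor.Hom (PolyFunctor.idF.{u}.tensor (PolyFunctor.idF.twist 1))
        (SK d (d - 1)), e.IsIso ∧
      ∀ (V : FGModuleCat.{u} (ZMod 2)) (v w : V),
        (SKtoL d (d - 1)).app V (e.app V (v ⊗ₜ w)) = gen 0 v * gen 1 w) ∧
    -- the next piece for `d ≥ 4`, as a kernel, an image and a cokernel
    (4 ≤ d →
      (fMap.{u} d).IsUniqueNonzero ∧ (gMap.{u} d).IsUniqueNonzero ∧
      ∃ i : PolyFunctor.Hom (SK.{u} d (d - 1))
          ((PolyFunctor.gammaPow (d - 2) PolyFunctor.idF).tensor (PolyFunctor.idF.twist 1)),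
        (multL (d - 2)).comp i = SKtoL d (d - 1) ∧
        i.IsKernel (gMap d) ∧
        i.IsImage (fMap d) ∧
        ∃ c : PolyFunctor.Hom (PolyFunctor.Lam.{u} d) (PolyFunctor.gammaPow d PolyFunctor.idF),
          (∀ (V : FGModuleCat.{u} (ZMod 2)) (v : Fin d → V),
            (PolyFunctor.gammaPowι d PolyFunctor.idF).app V
              (c.app V (exteriorPower.ιMulti (ZMod 2) d v)) = ∏ t, dp (ZMod 2) 1 (v t)) ∧
          (∀ V : FGModuleCat.{u} (ZMod 2), Function.Injective (c.app V)) ∧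
          ∃ q : PolyFunctor.Hom (PolyFunctor.gammaPow d PolyFunctor.idF) (SK d (d - 1)),
            i.comp q = fMap d ∧ q.IsCokernel c) ∧
    -- the lower pieces, as kernels, images and cokernels of the differential
    (∀ i : ℤ, i < d - 1 →
      (SKι.{u} d i).IsKernel (diff d (sub_add_cancel i 1)) ∧
      (SKι.{u} d i).IsImage (diff d (rfl : i + 1 = i + 1)) ∧
      ∃ q : PolyFunctor.Hom (Lpiece.{u} d (i + 1)) (SK d i),
        (SKι d i).comp q = diff d (rfl : i + 1 = i + 1) ∧
        q.IsCokernel (diff d (add_assoc i 1 1 : i + 1 + 1 = i + (1 + 1)))) := by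
  refine ⟨⟨lamToSK d, isIso_lamToSK d, lamToSK_ιMulti d⟩, ?_, ?_, ?_, fun hd => ?_, fun i hi => ?_⟩
  · rintro rfl
    exact subsingleton_SK_one
  · rintro rfl
    exact ⟨twistToSK, isIso_twistToSK, fun _ _ => rfl⟩
  · rintro rfl
    exact ⟨tensorToSK, isIso_tensorToSK, fun _ _ _ => rfl⟩
  · obtain ⟨i, hL, hker, him, hq⟩ := exists_SK_lift.{u} hd
    exact ⟨isUniqueNonzero_fMap (by omega), isUniqueNonzero_gMap hd, i, hL, hker, him, lamΓ d,
      fun V v => extToGam_ιMulti d v, lamΓ_injective d, gammaToSK d, hq, isCokernel_gammaToSK d⟩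
  · exact ⟨isKernel_SKι d i, isImage_SKι (by omega), diffToSK d rfl, rfl, isCokernel_diffToSK hi⟩
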